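/- **Corner patches.** Work in Cartesian coordinates with origin at the corner and axes along the mesh lines. On each of the four half-axes let a side length $\ell$ and a width $h$ be given with $0<2h\le\ell$ (they may differ from one half-axis to another). The half-axis is cut at $h$; the near part $(0,h)$ may in addition be bisected, and the far part $(h,\ell)$ may in addition be bisected. In a quadrant, the products of the intervals on its two half-axes form a rectangular partition of a macro element, whose sides are the two lengths $\ell$. A *corner patch* $\omega$ consists of the macro elements, so partitioned, of a nonempty set of quadrants other than a pair of opposite quadrants (so it is one macro element, or several joined around the corner). Let $\omega_c$ (corner region) be the part formed by the cells that are products of two near intervals, and let the overlapped edge patch $\omega_E$ be formed by all other cells. The regions are open: each is the interior of the union of its closed cells, and $\overline\omega=\overline{\omega_c}\cup\overline{\omega_E}$. For $\sigma\ge1$, the patch is called $\sigma$-*shape-regular* if in each of its quadrants the two lengths $\ell$ have ratio at most $\sigma$, and the two widths $h$ have ratio at most $\sigma$. The ratios $h/\ell$ are not bounded from below. **Taylor–Hood pair.** For $D\in\{\omega,\omega_c,\omega_E\}$ let $M(D)$ be the space of continuous functions on $D$ that are bilinear ($\mathbb Q_1$) on each cell of $D$ and have mean value zero on $D$, and let $\boldsymbol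 V(D)$ be the space of vector fields in $\boldsymbol H^1_0(D)$ that are continuous and biquadratic ($\mathbb Q_2$) on each cell of $D$. The pair is *inf-sup stable on $D$ with constant $\gamma>0$* if $$\inf_{0\ne q\in M(D)}\ \sup_{0\ne\boldsymbol v\in\boldsymbol V(D)}\frac{(\operatorname{div}\boldsymbol v,q)_D}{|\boldsymbol v|_{1,D}\,\|q\|_{0,D}}\ \ge\ \gamma .$$ **Hypotheses on a corner patch.** * (H1, on $\omega_E$) Every long and thin element of $\omega_E$ is divided into two by a grid line orthogonal to it: on each half-axis that bounds a quadrant of the patch, the far part $(h,\ell)$ is bisected. * (H2, on $\omega_c$) The pair is inf-sup stable on $\omega_c$ with a constant $\beta_c>0$. **Theorem.** There is a function $\Phi:(0,\infty)^2\to(0,\infty)$ such that: 1. for every corner patch satisfying (H1), and all $\beta,\beta_c>0$: if the pair is inf-sup stable on $\omega_E$ with constant $\beta$ and on $\omega_c$ with constant $\beta_c$ (H2), then it is inf-sup stable on $\omega$ with constant $\beta_{\mathcal P}=\Phi(\beta,\beta_c)$; 2. for every $\sigma\ge1$ there is $\beta=\beta(\sigma)>0$ such that on every $\sigma$-shape-regular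 corner patch satisfying (H1) the pair is inf-sup stable on $\omega_E$ with constant $\beta$; consequently, if (H2) holds with a constant $\beta_c$, the pair is inf-sup stable on $\omega$ with constant $\beta_{\mathcal P}=\Phi(\beta,\beta_c)$. In particular, $\beta_{\mathcal P}$ depends only on $\beta$ and $\beta_c$, and is independent of the size and the aspect ratio of the elements. -/

import Mathlib

open MeasureTheory Set

noncomputable section

namespace TaylorHood

/-! ## The Taylor–Hood pair on a rectangular partition

A partition is given by the set `T` of its open cells; functions are functions on the plane. -/

/-- The open set partitioned by the open cells of `T`: the interior of the union of the closed
cells. -/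
def domain (T : Set (Set (ℝ × ℝ))) : Set (ℝ × ℝ) :=
  interior (⋃ K ∈ T, closure K)

/-- On `K`, `f` coincides with a polynomial of degree at most `l` in each variable. -/
def IsQ (l : ℕ) (K : Set (ℝ × ℝ)) (f : ℝ × ℝ → ℝ) : Prop :=
  ∃ a : Fin (l + 1) → Fin (l + 1) → ℝ,
    ∀ p ∈ K, f p = ∑ i, ∑ j, a i j * p.1 ^ (i : ℕ) * p.2 ^ (j : ℕ)

/-- The pressure space: continuous piecewise bilinear functions on the domain, with zero mean
value. Only the values on the domain matter. -/
structure IsPressure (T : Set (Set (ℝ × ℝ))) (q : ℝ × ℝ → ℝ) : Prop where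
  continuousOn : ContinuousOn q (domain T)
  bilinear : ∀ K ∈ T, IsQ 1 K q
  mean_zero : ∫ p in domain T, q p = 0

/-- One component of the velocity space: continuous piecewise biquadratic functions on the domain
which vanish on its boundary, extended by zero to the plane. For a continuous piecewise
polynomial function the trace is the boundary value, and all weak first derivatives are the square
integrable cellwise derivatives, so these are the continuous piecewise biquadratic functions
in `H¹₀`. -/
structure IsVelocityComponent (T : Set (Set (ℝ × ℝ))) (f : ℝ × ℝ → ℝ) : Prop where
  continuous : Continuous f
  zero_outside : ∀ p, p ∉ domain T → f p = 0
  biquadratic : ∀ K ∈ T, IsQ 2 K f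

/-- The velocity space; a velocity is the pair of its components. -/
def IsVelocity (T : Set (Set (ℝ × ℝ))) (v : (ℝ × ℝ → ℝ) × (ℝ × ℝ → ℝ)) : Prop :=
  IsVelocityComponent T v.1 ∧ IsVelocityComponent T v.2

/-- Partial derivative in the first variable; for piecewise polynomials it is meaningful inside
the cells, hence almost everywhere. -/
def dx (f : ℝ × ℝ → ℝ) (p : ℝ × ℝ) : ℝ := deriv (fun t => f (t, p.2)) p.1

/-- Partial derivative in the second variable. -/
def dy (f : ℝ × ℝ → ℝ) (p : ℝ × ℝ) : ℝ := deriv (fun t => f (p.1, t)) p.2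

/-- The `L²` norm on `D`. -/
def l2norm (D : Set (ℝ × ℝ)) (q : ℝ × ℝ → ℝ) : ℝ :=
  Real.sqrt (∫ p in D, q p ^ 2)

/-- The `H¹` seminorm on `D` of a vector field. -/
def h1seminorm (D : Set (ℝ × ℝ)) (v : (ℝ × ℝ → ℝ) × (ℝ × ℝ → ℝ)) : ℝ :=
  Real.sqrt (∫ p in D, (dx v.1 p ^ 2 + dy v.1 p ^ 2 + dx v.2 p ^ 2 + dy v.2 p ^ 2))

/-- The `L²` product on `D` of the divergence of `v` with `q`. -/
def divProd (D : Set (ℝ × ℝ)) (v : (ℝ × ℝ → ℝ) × (ℝ × ℝ → ℝ)) (q : ℝ × ℝ → ℝ) : ℝ :=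
  ∫ p in D, (dx v.1 p + dy v.2 p) * q p

/-- The inf-sup constant of the Taylor–Hood pair on the partition `T`: the infimum over the nonzero
pressures of the supremum over the nonzero velocities, in the extended reals (so that neither is
given a junk value). -/
def infSup (T : Set (Set (ℝ × ℝ))) : EReal :=
  ⨅ (q : ℝ × ℝ → ℝ) (_ : IsPressure T q ∧ l2norm (domain T) q ≠ 0),
    ⨆ (v : (ℝ × ℝ → ℝ) × (ℝ × ℝ → ℝ)) (_ : IsVelocity T v ∧ h1seminorm (domain T) v ≠ 0),
      ((divProd (domain T) v q / (h1seminorm (domain T) v * l2norm (domain T) q) : ℝ) : EReal)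

/-- The Taylor–Hood pair on `T` is inf-sup stable with constant `β`. -/
def InfSupStable (T : Set (Set (ℝ × ℝ))) (β : ℝ) : Prop :=
  (β : EReal) ≤ infSup T

/-! ## Corner patches

The corner is the origin and the cells are parallel to the axes. -/

/-- The grid on one of the four half-axes that start at the corner. The near part `(0, h)` is the
side of the corner region, of the width `h` of the thin elements; `ℓ` is the side of the
macro element. The parts `(0, h)` and `(h, ℓ)` may each be bisected. -/
structure Arm where
  h : ℝ
  ℓ : ℝ
  h_pos : 0 < h
  two_h_le : 2 * h ≤ ℓ
  nearSplit : Prop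
  farSplit : Prop

/-- The grid intervals of the part of the half-axis next to the corner. -/
def Arm.near (A : Arm) : Set (Set ℝ) :=
  {I | (¬ A.nearSplit ∧ I = Ioo 0 A.h) ∨
    (A.nearSplit ∧ (I = Ioo 0 (A.h / 2) ∨ I = Ioo (A.h / 2) A.h))}

/-- The grid intervals of the long part of the half-axis. -/
def Arm.far (A : Arm) : Set (Set ℝ) :=
  {I | (¬ A.farSplit ∧ I = Ioo A.h A.ℓ) ∨
    (A.farSplit ∧ (I = Ioo A.h ((A.h + A.ℓ) / 2) ∨ I = Ioo ((A.h + A.ℓ) / 2) A.ℓ))}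

/-- The sign of a half-axis. -/
def sgn (b : Bool) : ℝ := if b then 1 else -1

/-- The product of two intervals, reflected into the quadrant `s`. -/
def box (s : Bool × Bool) (I J : Set ℝ) : Set (ℝ × ℝ) :=
  {p | sgn s.1 * p.1 ∈ I ∧ sgn s.2 * p.2 ∈ J}

/-- A corner patch with its partition. It is formed by one macro element, or by joining several
macro elements, around the corner: one macro element in each quadrant of `quadrants`. The
quadrants may be any nonempty set of quadrants but two opposite ones, which meet only in the
corner. The grid lines are those of the half-axes `armX true`, `armX false`, `armY true`,
`armY false`. -/
structure CornerPatch where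
  armX : Bool → Arm
  armY : Bool → Arm
  quadrants : Finset (Bool × Bool)
  nonempty : quadrants.Nonempty
  not_opposite : ∀ s : Bool × Bool, quadrants ≠ {s, (!s.1, !s.2)}

namespace CornerPatch

/-- The cells of the corner region, near the corner in both directions. -/
def cornerCells (P : CornerPatch) : Set (Set (ℝ × ℝ)) :=
  {K | ∃ s ∈ P.quadrants, ∃ I ∈ (P.armX s.1).near, ∃ J ∈ (P.armY s.2).near, K = box s I J}

/-- The cells of the overlapped edge patch: the long and thin cells along the two half-axes of each
quadrant, and the cells of the remaining rectangle, away from both half-axes. -/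
def edgeCells (P : CornerPatch) : Set (Set (ℝ × ℝ)) :=
  {K | ∃ s ∈ P.quadrants, ∃ I J : Set ℝ,
    ((I ∈ (P.armX s.1).far ∧ J ∈ (P.armY s.2).near) ∨
      (I ∈ (P.armX s.1).near ∧ J ∈ (P.armY s.2).far) ∨
      (I ∈ (P.armX s.1).far ∧ J ∈ (P.armY s.2).far)) ∧ K = box s I J}

/-- All cells of the corner patch. -/
def cells (P : CornerPatch) : Set (Set (ℝ × ℝ)) := P.cornerCells ∪ P.edgeCells

/-- Every long and thin element is divided into two, by a grid line orthogonal to it. -/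
def EdgeDivided (P : CornerPatch) : Prop :=
  ∀ s ∈ P.quadrants, (P.armX s.1).farSplit ∧ (P.armY s.2).farSplit

/-- In every quadrant, the macro element and its corner rectangle have aspect ratio at
most `σ`. -/
def ShapeRegular (P : CornerPatch) (σ : ℝ) : Prop :=
  ∀ s ∈ P.quadrants,
    (P.armX s.1).ℓ ≤ σ * (P.armY s.2).ℓ ∧ (P.armY s.2).ℓ ≤ σ * (P.armX s.1).ℓ ∧
    (P.armX s.1).h ≤ σ * (P.armY s.2).h ∧ (P.armY s.2).h ≤ σ * (P.armX s.1).h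

end CornerPatch

end TaylorHood

end

/-!
A pressure `q` is fixed together with a bound `S` for the functional `(div ·, q)` in the dual of
the velocity space; inf-sup stability with constant `β` means that `β * ‖q‖ ≤ S` for every pressure
(`InfSupStable.mul_l2norm_le`, `infSupStable_of`).

*The whole patch.* Velocities of the corner region and of the edge patch, extended by zero, are
velocities of the patch. Since the integral of their divergence vanishes
(`IsVelocityComponent.integral_dx`), stability on the two parts bounds `q - c₁` on the corner
region and `q - c₂` on the edge patch, with the mean values `c₁` and `c₂`. The difference of the
constants is controlled without any further velocity. In each quadrant, the vertex `(h, h)` is a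
vertex of a cell of the corner region and of a cell of the big rectangle away from both half-axes,
and both cells are at least as large as a fixed fraction of the corner rectangle. As `q` is
continuous at the vertex, an inverse estimate gives
`(c₁ - c₂)² * h * h ≤ C * (‖q - c₁‖² + ‖q - c₂‖²)` (`CornerPatch.sq_sub_mul_corner_le`), and these
areas sum up to that of the corner region. Hence `‖q‖ ≤ ‖q - c₂‖` is bounded by a multiple of `S`
that depends only on the two inf-sup constants.

*The edge patch.* Consider two cells of equal height above each other, such as the two halves of a
divided thin cell. Bubbles in `x`, times the bubbles and the hat function in `y`, determine the
horizontal slope of `q` on them; the resulting bound for the oscillation in `x`, measured in the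
scaling of the `L²` norm, is uniform as long as the width is at most a multiple of the height
(`DivBound.sq_sub_le`). By the symmetry in the diagonal, this applies to the thin cells in the
direction across them, and to the cells of the big rectangles in both directions. So in each
quadrant `q` is close to a constant on the big rectangle, and on the thin cells it is close to its
values on the big rectangle. The constants of two adjacent quadrants are compared by a velocity
that runs across the thin strip between the two big rectangles and is constant along its direction
in the strip (`DivBound.abs_sub_le_of_strip`). Opposite quadrants are linked by a third one. Thus
`q` differs from a constant by at most a multiple of `S` in the `L²` norm, and so does it from
zero, as its mean value vanishes (`EdgeBound.integral_sq_le`).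
-/

noncomputable section

namespace TaylorHood

/-! ### Partitions into rectangles -/

/-- A finite family of pairwise disjoint nonempty open rectangles, parallel to the axes. -/
structure IsMesh (T : Set (Set (ℝ × ℝ))) : Prop where
  finite : T.Finite
  rect : ∀ K ∈ T, ∃ a b c d : ℝ, a < b ∧ c < d ∧ K = Ioo a b ×ˢ Ioo c d
  disjoint : T.PairwiseDisjoint id

section

variable {T T₁ T₂ : Set (Set (ℝ × ℝ))} {K : Set (ℝ × ℝ)}

theorem IsMesh.mono (hT : IsMesh T) (h : T₁ ⊆ T) : IsMesh T₁ :=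
  ⟨hT.finite.subset h, fun K hK => hT.rect K (h hK), hT.disjoint.subset h⟩

theorem IsMesh.isOpen (hT : IsMesh T) (hK : K ∈ T) : IsOpen K := by
  obtain ⟨a, b, c, d, -, -, rfl⟩ := hT.rect K hK
  exact isOpen_Ioo.prod isOpen_Ioo

theorem IsMesh.measurableSet (hT : IsMesh T) (hK : K ∈ T) : MeasurableSet K :=
  (hT.isOpen hK).measurableSet

theorem IsMesh.isCompact_closure (hT : IsMesh T) (hK : K ∈ T) : IsCompact (closure K) := by
  obtain ⟨a, b, c, d, -, -, rfl⟩ := hT.rect K hK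
  exact ((Metric.isBounded_Ioo a b).prod (Metric.isBounded_Ioo c d)).isCompact_closure

theorem IsMesh.volume_frontier (hT : IsMesh T) (hK : K ∈ T) : volume (frontier K) = 0 := by
  obtain ⟨a, b, c, d, -, -, rfl⟩ := hT.rect K hK
  exact ((convex_Ioo a b).prod (convex_Ioo c d)).addHaar_frontier volume

theorem IsMesh.disjoint_closure (hT : IsMesh T) {K' : Set (ℝ × ℝ)} (hK : K ∈ T) (hK' : K' ∈ T)
    (h : K ≠ K') : Disjoint K (closure K') :=
  (hT.disjoint hK hK' h).closure_right (hT.isOpen hK)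

theorem isOpen_domain (T : Set (Set (ℝ × ℝ))) : IsOpen (domain T) := isOpen_interior

theorem domain_mono (h : T₁ ⊆ T) : domain T₁ ⊆ domain T :=
  interior_mono (biUnion_subset_biUnion_left h)

theorem IsMesh.subset_domain (hT : IsMesh T) (hK : K ∈ T) : K ⊆ domain T :=
  interior_maximal (subset_closure.trans (subset_biUnion_of_mem (u := fun K => closure K) hK))
    (hT.isOpen hK)

/-- The domain and the union of the open cells differ by a part of the edges, a null set. -/
theorem IsMesh.domain_ae_eq (hT : IsMesh T) : domain T =ᵐ[volume] ⋃₀ T := by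
  refine Filter.EventuallyLE.antisymm ?_
    (LE.le.eventuallyLE (sUnion_subset fun K hK => hT.subset_domain hK))
  rw [ae_le_set]
  refine measure_mono_null (t := ⋃ K ∈ T, frontier K) ?_ ?_
  · rintro p ⟨hp, hp'⟩
    obtain ⟨K, hK, hpK⟩ := mem_iUnion₂.1 (interior_subset hp)
    refine mem_iUnion₂.2 ⟨K, hK, hpK, fun h => hp' ⟨K, hK, interior_subset h⟩⟩
  · exact (measure_biUnion_null_iff hT.finite.countable).2 fun K hK => hT.volume_frontier hK

theorem IsMesh.integrableOn_domain (hT : IsMesh T) {f : ℝ × ℝ → ℝ}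
    (hf : ∀ K ∈ T, IntegrableOn f K) : IntegrableOn f (domain T) := by
  rw [integrableOn_congr_set_ae hT.domain_ae_eq, sUnion_eq_biUnion]
  exact (integrableOn_finite_biUnion hT.finite).2 hf

theorem IsMesh.integral_domain (hT : IsMesh T) {f : ℝ × ℝ → ℝ}
    (hf : ∀ K ∈ T, IntegrableOn f K) :
    ∫ p in domain T, f p = ∑ K ∈ hT.finite.toFinset, ∫ p in K, f p := by
  rw [setIntegral_congr_set hT.domain_ae_eq, ← integral_biUnion_finset]
  · congr 2
    ext p; simp
  · intro K hK; exact hT.measurableSet (by simpa using hK)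
  · intro K hK K' hK' h; exact hT.disjoint (by simpa using hK) (by simpa using hK') h
  · intro K hK; exact hf K (by simpa using hK)

theorem IsMesh.integral_domain_union (hT : IsMesh (T₁ ∪ T₂)) (hd : Disjoint T₁ T₂)
    {f : ℝ × ℝ → ℝ} (hf : ∀ K ∈ T₁ ∪ T₂, IntegrableOn f K) :
    ∫ p in domain (T₁ ∪ T₂), f p = (∫ p in domain T₁, f p) + ∫ p in domain T₂, f p := by
  have h1 := hT.mono (subset_union_left : T₁ ⊆ T₁ ∪ T₂)
  have h2 := hT.mono (subset_union_right : T₂ ⊆ T₁ ∪ T₂)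
  rw [hT.integral_domain hf, h1.integral_domain fun K hK => hf K (Or.inl hK),
    h2.integral_domain fun K hK => hf K (Or.inr hK), ← Finset.sum_union]
  · congr 1
    ext K; simp
  · rw [Finset.disjoint_left]
    intro K hK hK'
    exact (Set.disjoint_left.1 hd) (by simpa using hK) (by simpa using hK')

theorem IsMesh.domain_volume_ne_top (hT : IsMesh T) : volume (domain T) ≠ ⊤ := by
  refine ((measure_mono (interior_subset)).trans_lt
    (measure_biUnion_lt_top hT.finite fun K hK => (hT.isCompact_closure hK).measure_lt_top)).ne

/-! ### Piecewise polynomials -/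

/-- On `K`, the function `f` coincides with a continuous function on the plane. -/
def ContExt (K : Set (ℝ × ℝ)) (f : ℝ × ℝ → ℝ) : Prop :=
  ∃ g : ℝ × ℝ → ℝ, Continuous g ∧ EqOn f g K

theorem ContExt.add {f g : ℝ × ℝ → ℝ} (hf : ContExt K f) (hg : ContExt K g) :
    ContExt K (fun p => f p + g p) := by
  obtain ⟨f', hf', h⟩ := hf
  obtain ⟨g', hg', h'⟩ := hg
  exact ⟨_, hf'.add hg', fun p hp => by simp [h hp, h' hp]⟩

theorem ContExt.mul {f g : ℝ × ℝ → ℝ} (hf : ContExt K f) (hg : ContExt K g) :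
    ContExt K (fun p => f p * g p) := by
  obtain ⟨f', hf', h⟩ := hf
  obtain ⟨g', hg', h'⟩ := hg
  exact ⟨_, hf'.mul hg', fun p hp => by simp [h hp, h' hp]⟩

theorem ContExt.sub_const {f : ℝ × ℝ → ℝ} (hf : ContExt K f) (c : ℝ) :
    ContExt K (fun p => f p - c) := by
  obtain ⟨f', hf', h⟩ := hf
  exact ⟨fun p => f' p - c, hf'.sub continuous_const, fun p hp => by simp [h hp]⟩

theorem ContExt.sq {f : ℝ × ℝ → ℝ} (hf : ContExt K f) : ContExt K (fun p => f p ^ 2) := by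
  simpa only [pow_two] using hf.mul hf

theorem IsMesh.integrableOn (hT : IsMesh T) (hK : K ∈ T) {f : ℝ × ℝ → ℝ} (hf : ContExt K f) :
    IntegrableOn f K := by
  obtain ⟨g, hg, h⟩ := hf
  exact ((hg.continuousOn.integrableOn_compact (hT.isCompact_closure hK)).mono_set
    subset_closure).congr_fun h.symm (hT.measurableSet hK)

theorem IsQ.contExt {l : ℕ} {f : ℝ × ℝ → ℝ} (hf : IsQ l K f) : ContExt K f := by
  obtain ⟨a, ha⟩ := hf
  exact ⟨fun p => ∑ i, ∑ j, a i j * p.1 ^ (i : ℕ) * p.2 ^ (j : ℕ), by fun_prop, ha⟩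

/-- On an open cell, a function in `ℚ_l` is differentiable along horizontal lines, and its
derivative is again a polynomial there. -/
theorem IsQ.differentiableAt_and_dx_contExt {l : ℕ} {f : ℝ × ℝ → ℝ} (hK : IsOpen K)
    (hf : IsQ l K f) :
    (∀ p ∈ K, DifferentiableAt ℝ (fun t => f (t, p.2)) p.1) ∧ ContExt K (dx f) := by
  obtain ⟨a, ha⟩ := hf
  have key : ∀ p ∈ K, HasDerivAt (fun t => f (t, p.2))
      (∑ i : Fin (l + 1), ∑ j : Fin (l + 1),
        a i j * (((i : ℕ) : ℝ) * p.1 ^ ((i : ℕ) - 1)) * p.2 ^ (j : ℕ)) p.1 := by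
    intro p hp
    have h1 : HasDerivAt (fun t => ∑ i : Fin (l + 1), ∑ j : Fin (l + 1),
        a i j * t ^ (i : ℕ) * p.2 ^ (j : ℕ))
        (∑ i : Fin (l + 1), ∑ j : Fin (l + 1),
        a i j * (((i : ℕ) : ℝ) * p.1 ^ ((i : ℕ) - 1)) * p.2 ^ (j : ℕ)) p.1 := by
      refine HasDerivAt.fun_sum fun i _ => HasDerivAt.fun_sum fun j _ => ?_
      exact ((hasDerivAt_pow (i : ℕ) p.1).const_mul _).mul_const _
    refine h1.congr_of_eventuallyEq ?_
    have : ∀ᶠ t in nhds p.1, (t, p.2) ∈ K :=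
      (by fun_prop : Continuous fun t : ℝ => (t, p.2)).continuousAt.eventually (hK.mem_nhds hp)
    filter_upwards [this] with t ht using ha _ ht
  refine ⟨fun p hp => (key p hp).differentiableAt, _, ?_, fun p hp => (key p hp).deriv⟩
  fun_prop

theorem IsQ.comp_swap {l : ℕ} {f : ℝ × ℝ → ℝ} (hf : IsQ l K f) :
    IsQ l (Prod.swap ⁻¹' K) (f ∘ Prod.swap) := by
  obtain ⟨a, ha⟩ := hf
  refine ⟨fun i j => a j i, fun p hp => ?_⟩
  rw [Function.comp_apply, ha _ hp, Finset.sum_comm]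
  refine Finset.sum_congr rfl fun i _ => Finset.sum_congr rfl fun j _ => ?_
  simp only [Prod.fst_swap, Prod.snd_swap]; ring

theorem IsQ.sub_const {l : ℕ} {f : ℝ × ℝ → ℝ} (hf : IsQ l K f) (c : ℝ) :
    IsQ l K (fun p => f p - c) := by
  obtain ⟨a, ha⟩ := hf
  refine ⟨fun i j => a i j - if i = 0 ∧ j = 0 then c else 0, fun p hp => ?_⟩
  beta_reduce
  rw [ha p hp]
  simp only [sub_mul, Finset.sum_sub_distrib]
  congr 1
  rw [Finset.sum_eq_single 0, Finset.sum_eq_single 0]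
  · simp
  · intro j _ hj; simp [hj]
  · simp
  · intro i _ hi; simp [hi]
  · simp

theorem isQ_of_eqOn_zero {l : ℕ} {f : ℝ × ℝ → ℝ} (hf : ∀ p ∈ K, f p = 0) : IsQ l K f :=
  ⟨0, fun p hp => by simp [hf p hp]⟩

/-! ### Interchange of the coordinates -/

/-- The partition reflected in the diagonal. -/
def swapT (T : Set (Set (ℝ × ℝ))) : Set (Set (ℝ × ℝ)) := (preimage Prod.swap) '' T

theorem preimage_swap_mem_swapT (hK : K ∈ T) : Prod.swap ⁻¹' K ∈ swapT T := ⟨K, hK, rfl⟩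

theorem swapT_swapT : swapT (swapT T) = T := by
  unfold swapT
  rw [← image_comp]
  convert image_id T using 2
  rw [Function.comp_apply, ← preimage_comp, Prod.swap_swap_eq, preimage_id, id]

theorem domain_swapT : domain (swapT T) = Prod.swap ⁻¹' domain T := by
  have h := (Homeomorph.prodComm ℝ ℝ).preimage_interior (⋃ K ∈ T, closure K)
  rw [Homeomorph.coe_prodComm] at h
  unfold domain
  rw [h, swapT, biUnion_image, preimage_iUnion₂]
  congr 1
  refine iUnion₂_congr fun K _ => ?_
  have h := (Homeomorph.prodComm ℝ ℝ).preimage_closure K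
  rw [Homeomorph.coe_prodComm] at h
  exact h.symm

theorem IsMesh.swapT (hT : IsMesh T) : IsMesh (swapT T) := by
  refine ⟨hT.finite.image _, ?_, ?_⟩
  · rintro _ ⟨K, hK, rfl⟩
    obtain ⟨a, b, c, d, h, h', rfl⟩ := hT.rect K hK
    exact ⟨c, d, a, b, h', h, preimage_swap_prod _ _⟩
  · rintro _ ⟨K, hK, rfl⟩ _ ⟨K', hK', rfl⟩ h
    exact (hT.disjoint hK hK' fun e => h (by rw [e])).preimage _

theorem dx_comp_swap (f : ℝ × ℝ → ℝ) : dx (f ∘ Prod.swap) = dy f ∘ Prod.swap := rfl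
theorem dy_comp_swap (f : ℝ × ℝ → ℝ) : dy (f ∘ Prod.swap) = dx f ∘ Prod.swap := rfl

theorem IsVelocityComponent.swapT {f : ℝ × ℝ → ℝ} (hf : IsVelocityComponent T f) :
    IsVelocityComponent (swapT T) (f ∘ Prod.swap) := by
  refine ⟨hf.continuous.comp continuous_swap, fun p hp => ?_, ?_⟩
  · rw [domain_swapT] at hp
    exact hf.zero_outside _ hp
  · rintro _ ⟨K, hK, rfl⟩
    exact (hf.biquadratic K hK).comp_swap

theorem setIntegral_comp_swap (D : Set (ℝ × ℝ)) (f : ℝ × ℝ → ℝ) :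
    ∫ p in Prod.swap ⁻¹' D, f p.swap = ∫ p in D, f p :=
  (Measure.measurePreserving_swap (μ := (volume : Measure ℝ)) (ν := (volume : Measure ℝ))
    ).setIntegral_preimage_emb MeasurableEquiv.prodComm.measurableEmbedding f D

theorem IsVelocityComponent.dx_contExt {f : ℝ × ℝ → ℝ} (hT : IsMesh T)
    (hf : IsVelocityComponent T f) (hK : K ∈ T) : ContExt K (dx f) :=
  ((hf.biquadratic K hK).differentiableAt_and_dx_contExt (hT.isOpen hK)).2

theorem IsVelocityComponent.dy_contExt {f : ℝ × ℝ → ℝ} (hT : IsMesh T)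
    (hf : IsVelocityComponent T f) (hK : K ∈ T) : ContExt K (dy f) := by
  obtain ⟨g, hg, h⟩ := hf.swapT.dx_contExt hT.swapT (preimage_swap_mem_swapT hK)
  exact ⟨g ∘ Prod.swap, hg.comp continuous_swap, fun p hp => h (x := p.swap) (by simpa using hp)⟩

theorem IsVelocityComponent.neg {f : ℝ × ℝ → ℝ} (hf : IsVelocityComponent T f) :
    IsVelocityComponent T (fun p => -f p) := by
  refine ⟨hf.continuous.neg, fun p hp => by simp [hf.zero_outside p hp], fun K hK => ?_⟩
  obtain ⟨a, ha⟩ := hf.biquadratic K hK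
  exact ⟨fun i j => - a i j, fun p hp => by simp [ha p hp]⟩

theorem isVelocityComponent_zero : IsVelocityComponent T (fun _ => 0) :=
  ⟨continuous_const, fun _ _ => rfl, fun _ _ => isQ_of_eqOn_zero fun _ _ => rfl⟩

theorem dx_neg (f : ℝ × ℝ → ℝ) (p : ℝ × ℝ) : dx (fun p => -f p) p = -dx f p := by
  unfold dx; exact deriv.fun_neg
theorem dy_neg (f : ℝ × ℝ → ℝ) (p : ℝ × ℝ) : dy (fun p => -f p) p = -dy f p := by
  unfold dy; exact deriv.fun_neg
theorem dx_zero (p : ℝ × ℝ) : dx (fun _ => 0) p = 0 := by simp [dx]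
theorem dy_zero (p : ℝ × ℝ) : dy (fun _ => 0) p = 0 := by simp [dy]

end

/-! ### The derivatives of a velocity have mean value zero -/

section
variable {T T₁ T₂ : Set (Set (ℝ × ℝ))} {K : Set (ℝ × ℝ)}

theorem IsMesh.isCompact_iUnion_closure (hT : IsMesh T) : IsCompact (⋃ K ∈ T, closure K) :=
  hT.finite.isCompact_biUnion fun _ hK => hT.isCompact_closure hK

/-- Off finitely many grid lines, a point lies either in an open cell or away from the closed
cells. -/
theorem IsMesh.exists_gridLines (hT : IsMesh T) : ∃ X Y : Set ℝ, X.Finite ∧ Y.Finite ∧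
    ∀ p : ℝ × ℝ, p.1 ∉ X → p.2 ∉ Y → p ∈ (⋃ K ∈ T, closure K) → ∃ K ∈ T, p ∈ K := by
  choose! a b c d _ _ hE using hT.rect
  refine ⟨a '' T ∪ b '' T, c '' T ∪ d '' T, (hT.finite.image _).union (hT.finite.image _),
    (hT.finite.image _).union (hT.finite.image _), fun p hX hY hp => ?_⟩
  obtain ⟨K, hK, hpK⟩ := mem_iUnion₂.1 hp
  refine ⟨K, hK, ?_⟩
  rw [hE K hK] at hpK ⊢
  rw [closure_prod_eq] at hpK
  have h1 : p.1 ∈ Icc (a K) (b K) := closure_minimal Ioo_subset_Icc_self isClosed_Icc hpK.1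
  have h2 : p.2 ∈ Icc (c K) (d K) := closure_minimal Ioo_subset_Icc_self isClosed_Icc hpK.2
  have e1 : p.1 ≠ a K := fun e => hX (Or.inl ⟨K, hK, e.symm⟩)
  have e2 : p.1 ≠ b K := fun e => hX (Or.inr ⟨K, hK, e.symm⟩)
  have e3 : p.2 ≠ c K := fun e => hY (Or.inl ⟨K, hK, e.symm⟩)
  have e4 : p.2 ≠ d K := fun e => hY (Or.inr ⟨K, hK, e.symm⟩)
  exact ⟨⟨lt_of_le_of_ne h1.1 e1.symm, lt_of_le_of_ne h1.2 e2⟩,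
    ⟨lt_of_le_of_ne h2.1 e3.symm, lt_of_le_of_ne h2.2 e4⟩⟩

theorem IsVelocityComponent.eventuallyEq_zero {f : ℝ × ℝ → ℝ} (hT : IsMesh T)
    (hf : IsVelocityComponent T f) {p : ℝ × ℝ} (hp : p ∉ ⋃ K ∈ T, closure K) :
    ∀ᶠ p' in nhds p, f p' = 0 := by
  have : IsOpen (⋃ K ∈ T, closure K)ᶜ := hT.isCompact_iUnion_closure.isClosed.isOpen_compl
  filter_upwards [this.mem_nhds hp] with p' hp'
  exact hf.zero_outside _ fun h => hp' (interior_subset h)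

theorem hasDerivAt_fst_of_eventually_zero {f : ℝ × ℝ → ℝ} {p : ℝ × ℝ}
    (h : ∀ᶠ p' in nhds p, f p' = 0) :
    HasDerivAt (fun t => f (t, p.2)) 0 p.1 := by
  refine (hasDerivAt_const p.1 (0 : ℝ)).congr_of_eventuallyEq ?_
  exact (by fun_prop : Continuous fun t : ℝ => (t, p.2)).continuousAt.eventually h

theorem hasDerivAt_snd_of_eventually_zero {f : ℝ × ℝ → ℝ} {p : ℝ × ℝ}
    (h : ∀ᶠ p' in nhds p, f p' = 0) :
    HasDerivAt (fun t => f (p.1, t)) 0 p.2 := by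
  refine (hasDerivAt_const p.2 (0 : ℝ)).congr_of_eventuallyEq ?_
  exact (by fun_prop : Continuous fun t : ℝ => (p.1, t)).continuousAt.eventually h

/-- For almost every `y`, the function `f (·, y)` is continuous with compact support and
differentiable off finitely many points, so that the integral of its derivative vanishes; conclude
by Fubini. -/
theorem IsVelocityComponent.integral_dx {f : ℝ × ℝ → ℝ} (hT : IsMesh T)
    (hf : IsVelocityComponent T f) : ∫ p in domain T, dx f p = 0 := by
  have hcl := hT.isCompact_iUnion_closure
  have hsub : ∀ p ∉ (⋃ K ∈ T, closure K), dx f p = 0 := fun p hp =>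
    (hasDerivAt_fst_of_eventually_zero (hf.eventuallyEq_zero hT hp)).deriv
  have hae : domain T =ᵐ[volume] ⋃ K ∈ T, closure K := by
    refine Filter.EventuallyLE.antisymm (LE.le.eventuallyLE interior_subset) ?_
    rw [ae_le_set]
    refine measure_mono_null (t := ⋃ K ∈ T, frontier K) ?_
      ((measure_biUnion_null_iff hT.finite.countable).2 fun K hK => hT.volume_frontier hK)
    rintro p ⟨hp, hp'⟩
    obtain ⟨K, hK, hpK⟩ := mem_iUnion₂.1 hp
    exact mem_iUnion₂.2
      ⟨K, hK, hpK, fun h => hp' (hT.subset_domain hK (interior_subset h))⟩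
  have hint : Integrable (dx f) := by
    rw [← integrableOn_iff_integrable_of_support_subset (s := ⋃ K ∈ T, closure K),
      ← integrableOn_congr_set_ae hae]
    · exact hT.integrableOn_domain fun K hK => hT.integrableOn hK (hf.dx_contExt hT hK)
    · intro p hp; by_contra h; exact hp (hsub p h)
  rw [setIntegral_congr_set hae, setIntegral_eq_integral_of_forall_compl_eq_zero hsub]
  have hint' : Integrable (dx f) (volume.prod volume) := hint
  rw [Measure.volume_eq_prod, integral_prod_symm _ hint']
  obtain ⟨X, Y, hX, hY, hXY⟩ := hT.exists_gridLines
  obtain ⟨M, hM⟩ := hcl.isBounded.subset_closedBall 0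
  rw [integral_eq_zero_of_ae]
  filter_upwards [hint'.prod_left_ae, hY.countable.ae_notMem volume] with y hy hyY
  have hout : ∀ x, x ∉ Ioo (-(|M| + 1)) (|M| + 1) → (x, y) ∉ ⋃ K ∈ T, closure K := by
    intro x hx h
    have h1 := hM h
    rw [mem_closedBall_zero_iff, Prod.norm_def] at h1
    have h2 : |x| ≤ M := (le_max_left _ _).trans h1
    apply hx
    have h3 := abs_le.1 (h2.trans (le_abs_self M))
    exact ⟨by linarith, by linarith⟩
  have h0 : ∀ x, x ∉ Ioo (-(|M| + 1)) (|M| + 1) → f (x, y) = 0 := fun x hx =>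
    hf.zero_outside _ fun h => hout x hx (interior_subset h)
  have hle : -(|M| + 1) ≤ |M| + 1 := by linarith [abs_nonneg M]
  rw [← setIntegral_eq_integral_of_forall_compl_eq_zero
    (s := Ioc (-(|M| + 1)) (|M| + 1)) (fun x hx => hsub _ (hout x fun h => hx ⟨h.1, h.2.le⟩)),
    ← intervalIntegral.integral_of_le hle]
  rw [MeasureTheory.integral_eq_of_hasDerivAt_off_countable (fun x => f (x, y)) _ hX.countable]
  · rw [h0 _ (by simp), h0 _ (by simp)]; simp
  · exact (hf.continuous.comp (by fun_prop)).continuousOn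
  · rintro x ⟨-, hx⟩
    show HasDerivAt _ (deriv (fun t => f (t, y)) x) x
    rw [hasDerivAt_deriv_iff]
    by_cases h : (x, y) ∈ ⋃ K ∈ T, closure K
    · obtain ⟨K, hK, hp⟩ := hXY (x, y) hx hyY h
      exact ((hf.biquadratic K hK).differentiableAt_and_dx_contExt (hT.isOpen hK)).1 _ hp
    · exact (hasDerivAt_fst_of_eventually_zero (hf.eventuallyEq_zero hT h)).differentiableAt
  · exact hy.intervalIntegrable

theorem IsVelocityComponent.integral_dy {f : ℝ × ℝ → ℝ} (hT : IsMesh T)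
    (hf : IsVelocityComponent T f) : ∫ p in domain T, dy f p = 0 := by
  have h := hf.swapT.integral_dx hT.swapT
  rw [domain_swapT, dx_comp_swap] at h
  exact (setIntegral_comp_swap (domain T) (dy f)).symm.trans h

/-! ### The inf-sup condition as an estimate for each pressure -/

theorem h1seminorm_nonneg (D : Set (ℝ × ℝ)) (v) : 0 ≤ h1seminorm D v := Real.sqrt_nonneg _
theorem l2norm_nonneg (D : Set (ℝ × ℝ)) (q) : 0 ≤ l2norm D q := Real.sqrt_nonneg _

theorem l2norm_sq (D : Set (ℝ × ℝ)) (q) : l2norm D q ^ 2 = ∫ p in D, q p ^ 2 :=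
  Real.sq_sqrt (integral_nonneg fun _ => sq_nonneg _)

theorem IsPressure.contExt {q : ℝ × ℝ → ℝ} (hq : IsPressure T q) (hK : K ∈ T) : ContExt K q :=
  (hq.bilinear K hK).contExt

/-- The inf-sup condition gives a bound for each pressure. `S` bounds the functional `(div ·, q)`
in the dual of the velocity space. -/
theorem InfSupStable.mul_l2norm_le {β S : ℝ} (h : InfSupStable T β) {q : ℝ × ℝ → ℝ}
    (hq : IsPressure T q) (hS : 0 ≤ S)
    (hv : ∀ v, IsVelocity T v → divProd (domain T) v q ≤ S * h1seminorm (domain T) v) :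
    β * l2norm (domain T) q ≤ S := by
  by_cases h0 : l2norm (domain T) q = 0
  · simpa [h0] using hS
  have hpos : 0 < l2norm (domain T) q := lt_of_le_of_ne (l2norm_nonneg _ _) (Ne.symm h0)
  rw [← le_div_iff₀ hpos]
  have : (β : EReal) ≤ ((S / l2norm (domain T) q : ℝ) : EReal) := by
    refine h.trans ((iInf₂_le q ⟨hq, h0⟩).trans (iSup₂_le fun v hv' => ?_))
    rw [EReal.coe_le_coe_iff]
    have hvpos : 0 < h1seminorm (domain T) v :=
      lt_of_le_of_ne (h1seminorm_nonneg _ _) (Ne.symm hv'.2)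
    rw [div_le_div_iff₀ (mul_pos hvpos hpos) hpos]
    nlinarith [hv v hv'.1]
  exact_mod_cast this

theorem divProd_eq_zero_of_h1seminorm (hT : IsMesh T) {v} (hv : IsVelocity T v)
    (h : h1seminorm (domain T) v = 0) (q : ℝ × ℝ → ℝ) : divProd (domain T) v q = 0 := by
  have hi : IntegrableOn (fun p => dx v.1 p ^ 2 + dy v.1 p ^ 2 + dx v.2 p ^ 2 + dy v.2 p ^ 2)
      (domain T) := hT.integrableOn_domain fun K hK => hT.integrableOn hK
    ((((hv.1.dx_contExt hT hK).sq.add (hv.1.dy_contExt hT hK).sq).add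
      (hv.2.dx_contExt hT hK).sq).add (hv.2.dy_contExt hT hK).sq)
  have hn : ∀ p, 0 ≤ dx v.1 p ^ 2 + dy v.1 p ^ 2 + dx v.2 p ^ 2 + dy v.2 p ^ 2 := fun p => by
    positivity
  rw [h1seminorm, Real.sqrt_eq_zero (integral_nonneg hn), integral_eq_zero_iff_of_nonneg hn hi] at h
  refine integral_eq_zero_of_ae ?_
  filter_upwards [h] with p hp
  have hp' : dx v.1 p ^ 2 + dy v.1 p ^ 2 + dx v.2 p ^ 2 + dy v.2 p ^ 2 = 0 := hp
  have h1 : dx v.1 p = 0 := by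
    apply pow_eq_zero_iff (two_ne_zero) |>.1
    nlinarith [sq_nonneg (dx v.1 p), sq_nonneg (dy v.1 p), sq_nonneg (dx v.2 p),
      sq_nonneg (dy v.2 p)]
  have h2 : dy v.2 p = 0 := by
    apply pow_eq_zero_iff (two_ne_zero) |>.1
    nlinarith [sq_nonneg (dx v.1 p), sq_nonneg (dy v.1 p), sq_nonneg (dx v.2 p),
      sq_nonneg (dy v.2 p)]
  simp [h1, h2]

/-- Conversely, such a bound for all pressures gives the inf-sup condition. The velocities with
vanishing seminorm, which the supremum leaves out, have vanishing divergence. -/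
theorem infSupStable_of (hT : IsMesh T) {β : ℝ} (hβ : 0 < β)
    (h : ∀ q, IsPressure T q → ∀ S : ℝ, 0 ≤ S →
      (∀ v, IsVelocity T v → divProd (domain T) v q ≤ S * h1seminorm (domain T) v) →
      β * l2norm (domain T) q ≤ S) : InfSupStable T β := by
  refine le_iInf₂ fun q hq => ?_
  by_contra hlt
  obtain ⟨r, hr1, hr2⟩ := EReal.lt_iff_exists_real_btwn.1 (not_le.1 hlt)
  have hr : r < β := by exact_mod_cast hr2
  have hpos : 0 < l2norm (domain T) q := lt_of_le_of_ne (l2norm_nonneg _ _) (Ne.symm hq.2)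
  have key := h q hq.1 (max r 0 * l2norm (domain T) q) (by positivity) fun v hv => by
    by_cases h0 : h1seminorm (domain T) v = 0
    · rw [divProd_eq_zero_of_h1seminorm hT hv h0, h0]; simp
    have hvpos : 0 < h1seminorm (domain T) v :=
      lt_of_le_of_ne (h1seminorm_nonneg _ _) (Ne.symm h0)
    have h1 : ((divProd (domain T) v q / (h1seminorm (domain T) v * l2norm (domain T) q) : ℝ) :
        EReal) < r := (le_iSup₂ (f := fun v (_ : IsVelocity T v ∧ h1seminorm (domain T) v ≠ 0) =>
        ((divProd (domain T) v q / (h1seminorm (domain T) v * l2norm (domain T) q) : ℝ) :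
        EReal)) v ⟨hv, h0⟩).trans_lt hr1
    have h2 : divProd (domain T) v q / (h1seminorm (domain T) v * l2norm (domain T) q) < r := by
      exact_mod_cast h1
    rw [div_lt_iff₀ (mul_pos hvpos hpos)] at h2
    have := mul_le_mul_of_nonneg_right (le_max_left r 0) (mul_pos hvpos hpos).le
    linarith
  have : β ≤ max r 0 := le_of_mul_le_mul_right key hpos
  exact absurd this (not_le.2 (max_lt hr hβ))

/-- A bound for `(∂ₓf, q)` and `(∂ᵧf, q)` by the `H¹` seminorm, for all velocity components `f`. -/
def DivBound (T : Set (Set (ℝ × ℝ))) (q : ℝ × ℝ → ℝ) (S : ℝ) : Prop :=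
  ∀ f, IsVelocityComponent T f →
    |∫ p in domain T, dx f p * q p| ≤ S * √(∫ p in domain T, (dx f p ^ 2 + dy f p ^ 2)) ∧
    |∫ p in domain T, dy f p * q p| ≤ S * √(∫ p in domain T, (dx f p ^ 2 + dy f p ^ 2))

theorem divBound_of {q : ℝ × ℝ → ℝ} {S : ℝ}
    (hv : ∀ v, IsVelocity T v → divProd (domain T) v q ≤ S * h1seminorm (domain T) v) :
    DivBound T q S := by
  intro f hf
  have h1 := hv (f, fun _ => 0) ⟨hf, isVelocityComponent_zero⟩
  have h2 := hv (fun p => - f p, fun _ => 0) ⟨hf.neg, isVelocityComponent_zero⟩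
  have h3 := hv (fun _ => 0, f) ⟨isVelocityComponent_zero, hf⟩
  have h4 := hv (fun _ => 0, fun p => - f p) ⟨isVelocityComponent_zero, hf.neg⟩
  simp only [divProd, h1seminorm, dx_zero, dy_zero, dx_neg, dy_neg, neg_mul, add_zero, zero_add,
    integral_neg, neg_sq, ne_eq, OfNat.ofNat_ne_zero, not_false_eq_true, zero_pow] at h1 h2 h3 h4
  exact ⟨abs_le'.2 ⟨h1, h2⟩, abs_le'.2 ⟨h3, h4⟩⟩

theorem DivBound.swapT {q : ℝ × ℝ → ℝ} {S : ℝ} (h : DivBound T q S) :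
    DivBound (swapT T) (q ∘ Prod.swap) S := by
  intro f hf
  have hf' := hf.swapT
  rw [swapT_swapT] at hf'
  have h' := h _ hf'
  have e1 : ∀ g : ℝ × ℝ → ℝ, ∫ p in domain (TaylorHood.swapT T), g p =
      ∫ p in domain T, g p.swap := fun g => by
    rw [domain_swapT, ← setIntegral_comp_swap (domain T)]; simp
  simp only [dx_comp_swap, dy_comp_swap, Function.comp_apply] at h'
  rw [e1, e1, e1]
  simp only [Function.comp_apply, Prod.swap_swap]
  simp only [add_comm (dx f _ ^ 2)]
  exact ⟨h'.2, h'.1⟩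

end

/-! ### Test functions of one variable -/

/-- A nonnegative function of one variable, bounded by one, that vanishes outside `(a, b)` and whose
derivative is bounded by `M`. -/
structure IsBump (φ : ℝ → ℝ) (a b M : ℝ) : Prop where
  continuous : Continuous φ
  nonneg : ∀ x, 0 ≤ φ x
  le_one : ∀ x, φ x ≤ 1
  zero_outside : ∀ x, x ∉ Ioo a b → φ x = 0
  abs_deriv_le : ∀ x, |deriv φ x| ≤ M

theorem deriv_eq_zero_of_nonneg {φ : ℝ → ℝ} (h : ∀ x, 0 ≤ φ x) {x : ℝ} (hx : φ x = 0) :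
    deriv φ x = 0 := by
  have : IsLocalMin φ x := Filter.Eventually.of_forall fun y => by rw [hx]; exact h y
  exact this.deriv_eq_zero

/-- The quadratic bubble on the interval `(x₀, x₁)`. -/
def bubble (x₀ x₁ x : ℝ) : ℝ := max 0 (4 * (x - x₀) * (x₁ - x) / (x₁ - x₀) ^ 2)

/-- The continuous piecewise linear function that vanishes outside `(w₀, w₃)` and equals one on
`[w₁, w₂]`. -/
def trapezoid (w₀ w₁ w₂ w₃ x : ℝ) : ℝ :=
  max 0 (min 1 (min ((x - w₀) / (w₁ - w₀)) ((w₃ - x) / (w₃ - w₂))))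

theorem bubble_of_mem {x₀ x₁ x : ℝ} (hx : x ∈ Ioo x₀ x₁) :
    bubble x₀ x₁ x = 4 * (x - x₀) * (x₁ - x) / (x₁ - x₀) ^ 2 := by
  have h1 := sub_pos.2 hx.1
  have h2 := sub_pos.2 hx.2
  exact max_eq_right (by positivity)

theorem bubble_of_notMem {x₀ x₁ x : ℝ} (h : x₀ < x₁) (hx : x ∉ Ioo x₀ x₁) :
    bubble x₀ x₁ x = 0 := by
  refine max_eq_left (div_nonpos_of_nonpos_of_nonneg ?_ (sq_nonneg _))
  rcases le_or_gt x x₀ with h1 | h1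
  · nlinarith
  · have : x₁ ≤ x := by by_contra h2; exact hx ⟨h1, not_le.1 h2⟩
    nlinarith

theorem deriv_bubble {x₀ x₁ x : ℝ} (hx : x ∈ Ioo x₀ x₁) :
    deriv (bubble x₀ x₁) x = 4 * (x₀ + x₁ - 2 * x) / (x₁ - x₀) ^ 2 := by
  have h : HasDerivAt (fun t => 4 * (t - x₀) * (x₁ - t) / (x₁ - x₀) ^ 2)
      (4 * (x₀ + x₁ - 2 * x) / (x₁ - x₀) ^ 2) x := by
    have h1 := ((((hasDerivAt_id x).sub_const x₀).const_mul 4).mul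
      ((hasDerivAt_id x).const_sub x₁)).div_const ((x₁ - x₀) ^ 2)
    refine h1.congr_deriv ?_
    simp only [id]; ring
  refine (h.congr_of_eventuallyEq ?_).deriv
  filter_upwards [isOpen_Ioo.mem_nhds hx] with t ht using bubble_of_mem ht

theorem isBump_bubble {x₀ x₁ : ℝ} (h : x₀ < x₁) : IsBump (bubble x₀ x₁) x₀ x₁ (4 / (x₁ - x₀)) := by
  have hd := sub_pos.2 h
  have hn : ∀ x, 0 ≤ bubble x₀ x₁ x := fun x => le_max_left _ _
  refine ⟨by unfold bubble; fun_prop, hn, fun x => ?_, fun x hx => bubble_of_notMem h hx,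
    fun x => ?_⟩
  · refine max_le zero_le_one ?_
    rw [div_le_one (by positivity)]
    nlinarith [sq_nonneg ((x - x₀) - (x₁ - x))]
  · by_cases hx : x ∈ Ioo x₀ x₁
    · rw [deriv_bubble hx, abs_div, abs_of_pos (by positivity : 0 < (x₁ - x₀) ^ 2),
        div_le_div_iff₀ (by positivity) hd, abs_mul, abs_of_pos (by norm_num : (0 : ℝ) < 4)]
      have : |x₀ + x₁ - 2 * x| ≤ x₁ - x₀ := abs_le.2 ⟨by linarith [hx.2], by linarith [hx.1]⟩
      nlinarith
    · rw [deriv_eq_zero_of_nonneg hn (bubble_of_notMem h hx), abs_zero]; positivity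

section trapezoid
variable {w₀ w₁ w₂ w₃ x : ℝ}

theorem trapezoid_left (h12 : w₁ ≤ w₂) (h23 : w₂ < w₃) (hx : x ∈ Ioo w₀ w₁) :
    trapezoid w₀ w₁ w₂ w₃ x = (x - w₀) / (w₁ - w₀) := by
  have h1 : 0 < x - w₀ := sub_pos.2 hx.1
  have h2 : 0 < w₁ - w₀ := by linarith [hx.2]
  have h3 : (x - w₀) / (w₁ - w₀) ≤ 1 := (div_le_one h2).2 (by linarith [hx.2])
  have h4 : 1 ≤ (w₃ - x) / (w₃ - w₂) := (one_le_div (by linarith)).2 (by linarith [hx.2])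
  rw [trapezoid, min_eq_left (h3.trans h4), min_eq_right h3, max_eq_right (by positivity)]

theorem trapezoid_right (h01 : w₀ < w₁) (h12 : w₁ ≤ w₂) (hx : x ∈ Ioo w₂ w₃) :
    trapezoid w₀ w₁ w₂ w₃ x = (w₃ - x) / (w₃ - w₂) := by
  have h1 : 0 < w₃ - x := sub_pos.2 hx.2
  have h2 : 0 < w₃ - w₂ := by linarith [hx.1]
  have h3 : (w₃ - x) / (w₃ - w₂) ≤ 1 := (div_le_one h2).2 (by linarith [hx.1])
  have h4 : 1 ≤ (x - w₀) / (w₁ - w₀) := (one_le_div (by linarith)).2 (by linarith [hx.1])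
  rw [trapezoid, min_eq_right (h3.trans h4), min_eq_right h3, max_eq_right (by positivity)]

theorem trapezoid_mid (h01 : w₀ < w₁) (h23 : w₂ < w₃) (hx : x ∈ Icc w₁ w₂) :
    trapezoid w₀ w₁ w₂ w₃ x = 1 := by
  have h3 : 1 ≤ (w₃ - x) / (w₃ - w₂) := (one_le_div (by linarith)).2 (by linarith [hx.2])
  have h4 : 1 ≤ (x - w₀) / (w₁ - w₀) := (one_le_div (by linarith)).2 (by linarith [hx.1])
  rw [trapezoid, min_eq_left (le_min h4 h3), max_eq_right zero_le_one]

theorem deriv_trapezoid_left (h12 : w₁ ≤ w₂) (h23 : w₂ < w₃) (hx : x ∈ Ioo w₀ w₁) :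
    deriv (trapezoid w₀ w₁ w₂ w₃) x = 1 / (w₁ - w₀) := by
  refine ((((hasDerivAt_id x).sub_const w₀).div_const (w₁ - w₀)).congr_of_eventuallyEq ?_).deriv
  filter_upwards [isOpen_Ioo.mem_nhds hx] with t ht using trapezoid_left h12 h23 ht

theorem deriv_trapezoid_right (h01 : w₀ < w₁) (h12 : w₁ ≤ w₂) (hx : x ∈ Ioo w₂ w₃) :
    deriv (trapezoid w₀ w₁ w₂ w₃) x = -1 / (w₃ - w₂) := by
  refine ((((hasDerivAt_id x).const_sub w₃).div_const (w₃ - w₂)).congr_of_eventuallyEq ?_).deriv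
  filter_upwards [isOpen_Ioo.mem_nhds hx] with t ht using trapezoid_right h01 h12 ht

theorem deriv_trapezoid_mid (h01 : w₀ < w₁) (h23 : w₂ < w₃) (hx : x ∈ Ioo w₁ w₂) :
    deriv (trapezoid w₀ w₁ w₂ w₃) x = 0 := by
  refine ((hasDerivAt_const x (1 : ℝ)).congr_of_eventuallyEq ?_).deriv
  filter_upwards [isOpen_Ioo.mem_nhds hx] with t ht
    using trapezoid_mid h01 h23 (Ioo_subset_Icc_self ht)

theorem isBump_trapezoid {M : ℝ} (h01 : w₀ < w₁) (h23 : w₂ < w₃)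
    (hM : 1 / (w₁ - w₀) ≤ M) (hM' : 1 / (w₃ - w₂) ≤ M) :
    IsBump (trapezoid w₀ w₁ w₂ w₃) w₀ w₃ M := by
  have h1 := sub_pos.2 h01
  have h2 := sub_pos.2 h23
  have hM0 : 0 ≤ M := le_trans (by positivity) hM
  refine ⟨by unfold trapezoid; fun_prop, fun x => le_max_left _ _,
    fun x => max_le zero_le_one (min_le_left _ _), fun x hx => max_eq_left ?_, fun x => ?_⟩
  · rcases le_or_gt x w₀ with h | h
    · exact (min_le_right _ _).trans ((min_le_left _ _).trans
        (div_nonpos_of_nonpos_of_nonneg (by linarith) h1.le))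
    · have : w₃ ≤ x := by by_contra h'; exact hx ⟨h, not_le.1 h'⟩
      exact (min_le_right _ _).trans ((min_le_right _ _).trans
        (div_nonpos_of_nonpos_of_nonneg (by linarith) h2.le))
  · have l1 : LipschitzWith M.toNNReal fun x => (x - w₀) / (w₁ - w₀) := by
      refine LipschitzWith.of_dist_le_mul fun x y => ?_
      rw [Real.coe_toNNReal _ hM0, Real.dist_eq, Real.dist_eq, ← sub_div, sub_sub_sub_cancel_right,
        abs_div, abs_of_pos h1, div_eq_mul_one_div, mul_comm]
      gcongr
    have l2 : LipschitzWith M.toNNReal fun x => (w₃ - x) / (w₃ - w₂) := by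
      refine LipschitzWith.of_dist_le_mul fun x y => ?_
      rw [Real.coe_toNNReal _ hM0, Real.dist_eq, Real.dist_eq, ← sub_div, sub_sub_sub_cancel_left,
        abs_div, abs_of_pos h2, div_eq_mul_one_div, mul_comm, abs_sub_comm]
      gcongr
    have l3 : LipschitzWith M.toNNReal (trapezoid w₀ w₁ w₂ w₃) := by
      have h := ((l1.min l2).const_min 1).const_max 0
      rw [max_self] at h
      exact h
    have := norm_deriv_le_of_lipschitz (x₀ := x) l3
    rwa [Real.coe_toNNReal _ hM0, Real.norm_eq_abs] at this

end trapezoid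

/-! ### Velocities that are products of functions of one variable -/

section
variable {T : Set (Set (ℝ × ℝ))} {K : Set (ℝ × ℝ)} {q : ℝ × ℝ → ℝ} {S : ℝ}

/-- A continuous function that is supported in the closure of some cells, and biquadratic on these,
is a velocity component: it vanishes on the other cells, which are disjoint from the support. -/
theorem isVelocityComponent_of (hT : IsMesh T) {T₀ : Set (Set (ℝ × ℝ))} (h0 : T₀ ⊆ T)
    {W : Set (ℝ × ℝ)} (hW : IsOpen W) (hWc : W ⊆ ⋃ K ∈ T₀, closure K) {f : ℝ × ℝ → ℝ}
    (hf : Continuous f) (hfW : ∀ p ∉ W, f p = 0) (hQ : ∀ K ∈ T₀, IsQ 2 K f) :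
    IsVelocityComponent T f := by
  refine ⟨hf, fun p hp => hfW p fun h => hp (domain_mono h0 (interior_maximal hWc hW h)),
    fun K hK => ?_⟩
  by_cases hK0 : K ∈ T₀
  · exact hQ K hK0
  · refine isQ_of_eqOn_zero fun p hp => hfW p fun h => ?_
    obtain ⟨K', hK', hp'⟩ := mem_iUnion₂.1 (hWc h)
    exact Set.disjoint_left.1 (hT.disjoint_closure hK (h0 hK') fun e => hK0 (e ▸ hK')) hp hp'

theorem isQ_two_of_mul {f : ℝ × ℝ → ℝ} {c e : Fin 3 → ℝ}
    (h : ∀ p ∈ K, f p = (c 0 + c 1 * p.1 + c 2 * p.1 ^ 2) * (e 0 + e 1 * p.2 + e 2 * p.2 ^ 2)) :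
    IsQ 2 K f := by
  refine ⟨fun i j => c i * e j, fun p hp => ?_⟩
  rw [h p hp]
  simp only [Nat.reduceAdd, Fin.sum_univ_three, Fin.val_zero, Fin.val_one, Fin.val_two]
  ring

theorem IsQ.exists_bilinear (h : IsQ 1 K q) : ∃ A B C D : ℝ, ∀ p ∈ K,
    q p = A + B * p.1 + C * p.2 + D * p.1 * p.2 := by
  obtain ⟨a, ha⟩ := h
  refine ⟨a 0 0, a 1 0, a 0 1, a 1 1, fun p hp => ?_⟩
  rw [ha p hp]
  simp only [Nat.reduceAdd, Fin.sum_univ_two, Fin.val_zero, Fin.val_one]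
  ring

theorem dx_mul (φ ψ : ℝ → ℝ) (p : ℝ × ℝ) :
    dx (fun p => φ p.1 * ψ p.2) p = deriv φ p.1 * ψ p.2 := by
  unfold dx; exact deriv_mul_const_field (u := φ) (ψ p.2)
theorem dy_mul (φ ψ : ℝ → ℝ) (p : ℝ × ℝ) :
    dy (fun p => φ p.1 * ψ p.2) p = φ p.1 * deriv ψ p.2 := by
  unfold dy; exact deriv_const_mul_field (v := ψ) (φ p.1)

/-- The `H¹` seminorm of a product of two bumps is bounded by the maximal slopes and the area of the
support. -/
theorem DivBound.bump_le (h : DivBound T q S) (hS : 0 ≤ S)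
    {φ ψ : ℝ → ℝ} {a b c d M M' : ℝ} (hab : a < b) (hcd : c < d) (hφ : IsBump φ a b M)
    (hψ : IsBump ψ c d M') (hf : IsVelocityComponent T fun p => φ p.1 * ψ p.2) :
    |∫ p in domain T, deriv φ p.1 * ψ p.2 * q p| ≤
      S * √((M ^ 2 + M' ^ 2) * ((b - a) * (d - c))) := by
  have h1 := (h _ hf).1
  simp only [dx_mul, dy_mul] at h1
  refine h1.trans (mul_le_mul_of_nonneg_left (Real.sqrt_le_sqrt ?_) hS)
  have hW : MeasurableSet (Ioo a b ×ˢ Ioo c d) := measurableSet_Ioo.prod measurableSet_Ioo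
  have hz : ∀ p ∉ Ioo a b ×ˢ Ioo c d,
      (deriv φ p.1 * ψ p.2) ^ 2 + (φ p.1 * deriv ψ p.2) ^ 2 = 0 := by
    intro p hp
    by_cases hp1 : p.1 ∈ Ioo a b
    · have := hψ.zero_outside p.2 fun h2 => hp ⟨hp1, h2⟩
      rw [this, deriv_eq_zero_of_nonneg hψ.nonneg this]; simp
    · have := hφ.zero_outside p.1 hp1
      rw [this, deriv_eq_zero_of_nonneg hφ.nonneg this]; simp
  have hvol : volume (Ioo a b ×ˢ Ioo c d) = ENNReal.ofReal ((b - a) * (d - c)) := by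
    rw [Measure.volume_eq_prod, Measure.prod_prod, Real.volume_Ioo, Real.volume_Ioo,
      ENNReal.ofReal_mul (by linarith)]
  have hvolr : volume.real (Ioo a b ×ˢ Ioo c d) = (b - a) * (d - c) := by
    rw [measureReal_def, hvol, ENNReal.toReal_ofReal]
    exact mul_nonneg (by linarith) (by linarith)
  calc ∫ p in domain T, ((deriv φ p.1 * ψ p.2) ^ 2 + (φ p.1 * deriv ψ p.2) ^ 2)
      = ∫ p in domain T ∩ Ioo a b ×ˢ Ioo c d,
          ((deriv φ p.1 * ψ p.2) ^ 2 + (φ p.1 * deriv ψ p.2) ^ 2) := by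
        refine setIntegral_eq_of_subset_of_forall_sdiff_eq_zero
          (isOpen_domain T).measurableSet inter_subset_left ?_
        rintro p ⟨hp, hp'⟩
        exact hz p fun h => hp' ⟨hp, h⟩
    _ ≤ (M ^ 2 + M' ^ 2) * volume.real (domain T ∩ Ioo a b ×ˢ Ioo c d) := by
        refine (le_abs_self _).trans ?_
        rw [← Real.norm_eq_abs]
        refine norm_setIntegral_le_of_norm_le_const ?_ fun p hp => ?_
        · exact (measure_mono inter_subset_right).trans_lt (by rw [hvol]; simp)
        · have b1 : (deriv φ p.1 * ψ p.2) ^ 2 ≤ M ^ 2 := by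
            rw [sq_le_sq, abs_mul, abs_of_nonneg (hψ.nonneg p.2)]
            calc |deriv φ p.1| * ψ p.2 ≤ M * 1 :=
                  mul_le_mul (hφ.abs_deriv_le _) (hψ.le_one _) (hψ.nonneg _)
                    ((abs_nonneg _).trans (hφ.abs_deriv_le 0))
              _ ≤ |M| := by rw [mul_one]; exact le_abs_self M
          have b2 : (φ p.1 * deriv ψ p.2) ^ 2 ≤ M' ^ 2 := by
            rw [sq_le_sq, abs_mul, abs_of_nonneg (hφ.nonneg p.1)]
            calc φ p.1 * |deriv ψ p.2| ≤ 1 * M' :=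
                  mul_le_mul (hφ.le_one _) (hψ.abs_deriv_le _) (abs_nonneg _) zero_le_one
              _ ≤ |M'| := by rw [one_mul]; exact le_abs_self M'
          rw [Real.norm_of_nonneg (by positivity)]
          linarith
    _ ≤ (M ^ 2 + M' ^ 2) * ((b - a) * (d - c)) := by
        rw [← hvolr]
        refine mul_le_mul_of_nonneg_left ?_ (by positivity)
        exact measureReal_mono inter_subset_right (by rw [hvol]; simp)

/-- The integral over the domain of a function that vanishes on all cells but two. -/
theorem IsMesh.integral_eq_add (hT : IsMesh T) {K₁ K₂ : Set (ℝ × ℝ)} (h1 : K₁ ∈ T) (h2 : K₂ ∈ T)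
    (hne : K₁ ≠ K₂) {g : ℝ × ℝ → ℝ} (hg : ∀ K ∈ T, ContExt K g)
    (h0 : ∀ K ∈ T, K ≠ K₁ → K ≠ K₂ → ∀ p ∈ K, g p = 0) :
    ∫ p in domain T, g p = (∫ p in K₁, g p) + ∫ p in K₂, g p := by
  classical
  rw [hT.integral_domain fun K hK => hT.integrableOn hK (hg K hK),
    ← Finset.sum_pair (f := fun K => ∫ p in K, g p) hne]
  refine (Finset.sum_subset ?_ ?_).symm
  · intro K hK
    rcases Finset.mem_insert.1 hK with rfl | hK
    · simpa
    · rw [Finset.mem_singleton.1 hK]; simpa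
  · intro K hK hK'
    rw [Finset.mem_insert, Finset.mem_singleton, not_or] at hK'
    have hKT : K ∈ T := by simpa using hK
    exact setIntegral_eq_zero_of_forall_eq_zero fun p hp => h0 K hKT hK'.1 hK'.2 p hp

theorem integral_rect_mul_bilinear {u v : ℝ → ℝ} (hu : Continuous u) (hv : Continuous v)
    {a b c d : ℝ} (hab : a ≤ b) (hcd : c ≤ d) (A B C D : ℝ) :
    ∫ p in Ioo a b ×ˢ Ioo c d, u p.1 * v p.2 * (A + B * p.1 + C * p.2 + D * p.1 * p.2) =
      A * ((∫ x in a..b, u x) * ∫ y in c..d, v y) +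
      B * ((∫ x in a..b, u x * x) * ∫ y in c..d, v y) +
      C * ((∫ x in a..b, u x) * ∫ y in c..d, v y * y) +
      D * ((∫ x in a..b, u x * x) * ∫ y in c..d, v y * y) := by
  have hI : ∀ g : ℝ × ℝ → ℝ, Continuous g → IntegrableOn g (Ioo a b ×ˢ Ioo c d) := fun g hg =>
    (hg.continuousOn.integrableOn_compact (isCompact_Icc.prod isCompact_Icc)).mono_set
      (prod_mono Ioo_subset_Icc_self Ioo_subset_Icc_self)
  have e : ∀ f g : ℝ → ℝ, ∫ p in Ioo a b ×ˢ Ioo c d, f p.1 * g p.2 =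
      (∫ x in a..b, f x) * ∫ y in c..d, g y := fun f g => by
    rw [Measure.volume_eq_prod, setIntegral_prod_mul, intervalIntegral.integral_of_le hab,
      intervalIntegral.integral_of_le hcd, integral_Ioc_eq_integral_Ioo,
      integral_Ioc_eq_integral_Ioo]
  rw [← e, ← e, ← e, ← e, ← integral_const_mul, ← integral_const_mul, ← integral_const_mul,
    ← integral_const_mul, ← integral_add (hI _ (by fun_prop)) (hI _ (by fun_prop)),
    ← integral_add (hI _ (by fun_prop)) (hI _ (by fun_prop)),
    ← integral_add (hI _ (by fun_prop)) (hI _ (by fun_prop))]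
  congr 1
  ext p
  ring

/-- A pressure has at an interior point of the domain the value of its polynomial on any cell next
to that point. -/
theorem eq_of_mem_closure {D : Set (ℝ × ℝ)} (hq : ContinuousOn q D) (hKD : K ⊆ D)
    {g : ℝ × ℝ → ℝ} (hg : Continuous g) (h : ∀ p ∈ K, q p = g p) {z : ℝ × ℝ} (hz : z ∈ D)
    (hzK : z ∈ closure K) : q z = g z := by
  have : (nhdsWithin z K).NeBot := mem_closure_iff_nhdsWithin_neBot.1 hzK
  refine tendsto_nhds_unique ((hq z hz).mono_left (nhdsWithin_mono z hKD)) ?_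
  refine (hg.continuousAt.tendsto.mono_left nhdsWithin_le_nhds).congr' ?_
  filter_upwards [self_mem_nhdsWithin] with p hp using (h p hp).symm

end

/-! ### Control of the oscillation across a pair of cells -/

section
variable {T : Set (Set (ℝ × ℝ))} {K : Set (ℝ × ℝ)} {q : ℝ × ℝ → ℝ} {S : ℝ}

theorem integral_cubic {f : ℝ → ℝ} (a b k l m n : ℝ)
    (hf : ∀ x, f x = k + l * x + m * x ^ 2 + n * x ^ 3) :
    ∫ x in a..b, f x = k * (b - a) + l * ((b ^ 2 - a ^ 2) / 2) + m * ((b ^ 3 - a ^ 3) / 3) +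
        n * ((b ^ 4 - a ^ 4) / 4) := by
  have h : ∀ x, HasDerivAt (fun x => k * x + l * (x ^ 2 / 2) + m * (x ^ 3 / 3) + n * (x ^ 4 / 4))
      (k + l * x + m * x ^ 2 + n * x ^ 3) x := fun x => by
    have h1 := ((((hasDerivAt_id x).const_mul k).add
      (((hasDerivAt_pow 2 x).div_const 2).const_mul l)).add
      (((hasDerivAt_pow 3 x).div_const 3).const_mul m)).add
      (((hasDerivAt_pow 4 x).div_const 4).const_mul n)
    refine h1.congr_deriv ?_
    norm_num
  have hc : Continuous fun x : ℝ => k + l * x + m * x ^ 2 + n * x ^ 3 := by fun_prop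
  rw [funext hf, intervalIntegral.integral_eq_sub_of_hasDerivAt (fun x _ => h x)
    (hc.intervalIntegrable _ _)]
  ring

theorem integral_quadratic (a b k l m : ℝ) : ∫ x in a..b, (k + l * x + m * x ^ 2) =
    k * (b - a) + l * ((b ^ 2 - a ^ 2) / 2) + m * ((b ^ 3 - a ^ 3) / 3) := by
  rw [integral_cubic a b k l m 0 fun x => by ring]; ring

theorem integral_quadratic_mul_self (a b k l m : ℝ) :
    ∫ x in a..b, (k + l * x + m * x ^ 2) * x =
    k * ((b ^ 2 - a ^ 2) / 2) + l * ((b ^ 3 - a ^ 3) / 3) + m * ((b ^ 4 - a ^ 4) / 4) := by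
  rw [integral_cubic a b 0 k l m fun x => by ring]; ring

theorem IsBump.mono {φ : ℝ → ℝ} {a b a' b' M M' : ℝ} (h : IsBump φ a b M)
    (hab : Ioo a b ⊆ Ioo a' b') (hM : M ≤ M') : IsBump φ a' b' M' :=
  ⟨h.continuous, h.nonneg, h.le_one, fun x hx => h.zero_outside x fun h' => hx (hab h'),
    fun x => (h.abs_deriv_le x).trans hM⟩

/-- The derivative of the bubble integrates against `1` to zero and against `x` to minus the
integral of the bubble, so only the horizontal slope of the bilinear function remains. -/
theorem integral_deriv_bubble_mul {x₀ x₁ c d : ℝ} (hx : x₀ < x₁) (hcd : c < d) {v : ℝ → ℝ}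
    (hv : Continuous v) (A B C D : ℝ) :
    ∫ p in Ioo x₀ x₁ ×ˢ Ioo c d, 4 * (x₀ + x₁ - 2 * p.1) / (x₁ - x₀) ^ 2 * v p.2 *
      (A + B * p.1 + C * p.2 + D * p.1 * p.2) =
      -(2 / 3 * (x₁ - x₀)) * (B * (∫ y in c..d, v y) + D * ∫ y in c..d, v y * y) := by
  have hd : x₁ - x₀ ≠ 0 := (sub_pos.2 hx).ne'
  have h0 : ∫ x in x₀..x₁, 4 * (x₀ + x₁ - 2 * x) / (x₁ - x₀) ^ 2 = 0 := by
    rw [integral_cubic _ _ (4 * (x₀ + x₁) / (x₁ - x₀) ^ 2) (-8 / (x₁ - x₀) ^ 2) 0 0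
      (fun x => by ring)]
    field_simp; ring
  have h1 : ∫ x in x₀..x₁, 4 * (x₀ + x₁ - 2 * x) / (x₁ - x₀) ^ 2 * x = -(2 / 3 * (x₁ - x₀)) := by
    rw [integral_cubic _ _ 0 (4 * (x₀ + x₁) / (x₁ - x₀) ^ 2) (-8 / (x₁ - x₀) ^ 2) 0
      (fun x => by ring)]
    field_simp; ring
  rw [integral_rect_mul_bilinear (u := fun x => 4 * (x₀ + x₁ - 2 * x) / (x₁ - x₀) ^ 2)
    (by fun_prop) hv hx.le hcd.le, h0, h1]
  ring

theorem abs_le_mul_of_eq {X Y c m : ℝ} (hc : 0 ≤ c) (h : Y = c * X) (hX : |X| ≤ m) :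
    |Y| ≤ c * m := by
  rw [h, abs_mul, abs_of_nonneg hc]
  exact mul_le_mul_of_nonneg_left hX hc

theorem abs_le_of_mul_eq_add {w w' P P' M b X : ℝ} (hb : 0 < b) (hw : 0 ≤ w) (hw' : 0 ≤ w')
    (hs : w + w' = b) (hP : |P| ≤ M) (hP' : |P'| ≤ M) (h : b * X = w * P + w' * P') : |X| ≤ M := by
  refine le_of_mul_le_mul_left ?_ hb
  rw [← abs_of_pos hb, ← abs_mul, h, abs_of_pos hb, ← hs, add_mul]
  refine (abs_add_le _ _).trans (add_le_add ?_ ?_)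
  · rw [abs_mul, abs_of_nonneg hw]; exact mul_le_mul_of_nonneg_left hP hw
  · rw [abs_mul, abs_of_nonneg hw']; exact mul_le_mul_of_nonneg_left hP' hw'

/-- Testing with the bubble in `x` times a function `ψ` of `y` gives a bound for the integral of the
horizontal slope of `q` against `ψ`. On the two cells, `q` is given by the coefficients with index
`1` and `2`, and `ψ` by the quadratic polynomials with the coefficients `e` and `e'`. -/
theorem DivBound.abs_slope_le (hT : IsMesh T) (hq : ∀ K ∈ T, IsQ 1 K q) (h : DivBound T q S)
    (hS : 0 ≤ S) {x₀ x₁ y₀ y₁ y₂ b : ℝ} (hx : x₀ < x₁) (hb : 0 < b) (hy1 : y₁ = y₀ + b)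
    (hy2 : y₂ = y₁ + b) (hK1 : Ioo x₀ x₁ ×ˢ Ioo y₀ y₁ ∈ T) (hK2 : Ioo x₀ x₁ ×ˢ Ioo y₁ y₂ ∈ T)
    {A₁ B₁ C₁ D₁ A₂ B₂ C₂ D₂ : ℝ}
    (hp1 : ∀ p ∈ Ioo x₀ x₁ ×ˢ Ioo y₀ y₁, q p = A₁ + B₁ * p.1 + C₁ * p.2 + D₁ * p.1 * p.2)
    (hp2 : ∀ p ∈ Ioo x₀ x₁ ×ˢ Ioo y₁ y₂, q p = A₂ + B₂ * p.1 + C₂ * p.2 + D₂ * p.1 * p.2)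
    {ψ : ℝ → ℝ} (hψ : IsBump ψ y₀ y₂ (4 / b)) {e e' : Fin 3 → ℝ}
    (he : ∀ y ∈ Ioo y₀ y₁, ψ y = e 0 + e 1 * y + e 2 * y ^ 2)
    (he' : ∀ y ∈ Ioo y₁ y₂, ψ y = e' 0 + e' 1 * y + e' 2 * y ^ 2) :
    |2 / 3 * (x₁ - x₀) * (B₁ * (∫ y in y₀..y₁, (e 0 + e 1 * y + e 2 * y ^ 2)) +
        D₁ * (∫ y in y₀..y₁, (e 0 + e 1 * y + e 2 * y ^ 2) * y) +
      (B₂ * (∫ y in y₁..y₂, (e' 0 + e' 1 * y + e' 2 * y ^ 2)) +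
        D₂ * (∫ y in y₁..y₂, (e' 0 + e' 1 * y + e' 2 * y ^ 2) * y)))| ≤
      S * √(((4 / (x₁ - x₀)) ^ 2 + (4 / b) ^ 2) * ((x₁ - x₀) * (y₂ - y₀))) := by
  have h01 : y₀ < y₁ := by linarith
  have h12 : y₁ < y₂ := by linarith
  have hφ := isBump_bubble hx
  have hne : Ioo x₀ x₁ ×ˢ Ioo y₀ y₁ ≠ Ioo x₀ x₁ ×ˢ Ioo y₁ y₂ := by
    intro e
    have hm : ((x₀ + x₁) / 2, (y₀ + y₁) / 2) ∈ Ioo x₀ x₁ ×ˢ Ioo y₀ y₁ :=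
      ⟨⟨by simp only; linarith, by simp only; linarith⟩,
        ⟨by simp only; linarith, by simp only; linarith⟩⟩
    rw [e] at hm
    have := hm.2.1
    simp only at this
    linarith
  have hW : Ioo x₀ x₁ ×ˢ Ioo y₀ y₂ ⊆ closure (Ioo x₀ x₁ ×ˢ Ioo y₀ y₁) ∪
      closure (Ioo x₀ x₁ ×ˢ Ioo y₁ y₂) := by
    rintro ⟨x, y⟩ ⟨h1, h2⟩
    simp only [closure_prod_eq, closure_Ioo hx.ne, closure_Ioo h01.ne, closure_Ioo h12.ne]
    rcases le_total y y₁ with h3 | h3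
    · exact Or.inl ⟨Ioo_subset_Icc_self h1, h2.1.le, h3⟩
    · exact Or.inr ⟨Ioo_subset_Icc_self h1, h3, h2.2.le⟩
  have hf0 : ∀ p ∉ Ioo x₀ x₁ ×ˢ Ioo y₀ y₂, bubble x₀ x₁ p.1 * ψ p.2 = 0 := by
    intro p hp
    by_cases hp1 : p.1 ∈ Ioo x₀ x₁
    · rw [hψ.zero_outside p.2 fun h2 => hp ⟨hp1, h2⟩, mul_zero]
    · rw [hφ.zero_outside p.1 hp1, zero_mul]
  have hbp : ∀ x ∈ Ioo x₀ x₁, bubble x₀ x₁ x =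
      -(4 * x₀ * x₁) / (x₁ - x₀) ^ 2 + 4 * (x₀ + x₁) / (x₁ - x₀) ^ 2 * x +
        -4 / (x₁ - x₀) ^ 2 * x ^ 2 := fun x hx' => by
    rw [bubble_of_mem hx']; ring
  have hf : IsVelocityComponent T fun p => bubble x₀ x₁ p.1 * ψ p.2 := by
    refine isVelocityComponent_of hT
      (T₀ := {Ioo x₀ x₁ ×ˢ Ioo y₀ y₁, Ioo x₀ x₁ ×ˢ Ioo y₁ y₂}) ?_
      (isOpen_Ioo.prod isOpen_Ioo) (hW.trans (by simp))
      ((hφ.continuous.comp continuous_fst).mul (hψ.continuous.comp continuous_snd)) hf0 ?_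
    · rintro K (rfl | rfl) <;> assumption
    · rintro K (rfl | rfl)
      · exact isQ_two_of_mul (c := ![-(4 * x₀ * x₁) / (x₁ - x₀) ^ 2,
          4 * (x₀ + x₁) / (x₁ - x₀) ^ 2, -4 / (x₁ - x₀) ^ 2]) (e := e)
          fun p hp => by rw [hbp _ hp.1, he _ hp.2]; rfl
      · exact isQ_two_of_mul (c := ![-(4 * x₀ * x₁) / (x₁ - x₀) ^ 2,
          4 * (x₀ + x₁) / (x₁ - x₀) ^ 2, -4 / (x₁ - x₀) ^ 2]) (e := e')
          fun p hp => by rw [hbp _ hp.1, he' _ hp.2]; rfl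
  have key := h.bump_le hS hx (h01.trans h12) hφ hψ hf
  rw [hT.integral_eq_add hK1 hK2 hne] at key
  · rw [setIntegral_congr_fun (hT.measurableSet hK1) (g := fun p =>
        4 * (x₀ + x₁ - 2 * p.1) / (x₁ - x₀) ^ 2 * (e 0 + e 1 * p.2 + e 2 * p.2 ^ 2) *
          (A₁ + B₁ * p.1 + C₁ * p.2 + D₁ * p.1 * p.2))
        (fun p hp => by simp only [deriv_bubble hp.1, he _ hp.2, hp1 p hp]),
      setIntegral_congr_fun (hT.measurableSet hK2) (g := fun p =>
        4 * (x₀ + x₁ - 2 * p.1) / (x₁ - x₀) ^ 2 * (e' 0 + e' 1 * p.2 + e' 2 * p.2 ^ 2) *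
          (A₂ + B₂ * p.1 + C₂ * p.2 + D₂ * p.1 * p.2))
        (fun p hp => by simp only [deriv_bubble hp.1, he' _ hp.2, hp2 p hp]),
      integral_deriv_bubble_mul hx h01 (v := fun y => e 0 + e 1 * y + e 2 * y ^ 2) (by fun_prop),
      integral_deriv_bubble_mul hx h12 (v := fun y => e' 0 + e' 1 * y + e' 2 * y ^ 2)
        (by fun_prop), ← mul_add, neg_mul, abs_neg] at key
    exact key
  · intro K hK
    have := (hf.dx_contExt hT hK).mul (hq K hK).contExt
    simpa only [dx_mul] using this
  · intro K hK h1 h2 p hp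
    have hpW : p ∉ Ioo x₀ x₁ ×ˢ Ioo y₀ y₂ := fun hpW => by
      rcases hW hpW with h3 | h3
      · exact Set.disjoint_left.1 (hT.disjoint_closure hK hK1 h1) hp h3
      · exact Set.disjoint_left.1 (hT.disjoint_closure hK hK2 h2) hp h3
    rcases mul_eq_zero.1 (hf0 p hpW) with h3 | h3
    · rw [deriv_eq_zero_of_nonneg hφ.nonneg h3]; ring
    · rw [h3]; ring

/-- Let two cells of equal height lie above each other. The horizontal slope of `q` is a continuous
piecewise linear function of `y` on them, with three degrees of freedom, and the bubbles of the two
heights and the hat function between them determine it. In the scaling of the `L²` norm, the bound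
for the oscillation does not degenerate if the width is much smaller than the height. This is where
the division of the long and thin cells is used: on a single cell, the bubble alone would not see a
slope of mean value zero. -/
theorem DivBound.sq_sub_le (hT : IsMesh T) (hqc : ContinuousOn q (domain T))
    (hq : ∀ K ∈ T, IsQ 1 K q) (h : DivBound T q S)
    (hS : 0 ≤ S) {x₀ x₁ y₀ y₁ y₂ b : ℝ} (hx : x₀ < x₁) (hb : 0 < b) (hy1 : y₁ = y₀ + b)
    (hy2 : y₂ = y₁ + b) (hK1 : Ioo x₀ x₁ ×ˢ Ioo y₀ y₁ ∈ T) (hK2 : Ioo x₀ x₁ ×ˢ Ioo y₁ y₂ ∈ T)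
    {x x' y : ℝ} (hx1 : x ∈ Ioo x₀ x₁) (hx2 : x' ∈ Ioo x₀ x₁)
    (hy : y ∈ Ioo y₀ y₁ ∪ Ioo y₁ y₂) :
    (q (x, y) - q (x', y)) ^ 2 * ((x₁ - x₀) * b) ≤
      5832 * (1 + ((x₁ - x₀) / b) ^ 2) * S ^ 2 := by
  obtain ⟨A₁, B₁, C₁, D₁, hp1⟩ := (hq _ hK1).exists_bilinear
  obtain ⟨A₂, B₂, C₂, D₂, hp2⟩ := (hq _ hK2).exists_bilinear
  have h01 : y₀ < y₁ := by linarith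
  have h12 : y₁ < y₂ := by linarith
  have hd : 0 < x₁ - x₀ := sub_pos.2 hx
  -- the slopes in the two cells agree on the common edge
  have hmid : B₁ + D₁ * y₁ = B₂ + D₂ * y₁ := by
    have hz : ∀ t ∈ Ioo x₀ x₁, A₁ + B₁ * t + C₁ * y₁ + D₁ * t * y₁ =
        A₂ + B₂ * t + C₂ * y₁ + D₂ * t * y₁ := by
      intro t ht
      have hD : (t, y₁) ∈ domain T := by
        refine interior_maximal ?_ (isOpen_Ioo.prod isOpen_Ioo : IsOpen (Ioo x₀ x₁ ×ˢ Ioo y₀ y₂))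
          ⟨ht, h01, h12⟩
        rintro ⟨x, y⟩ ⟨h1, h2⟩
        rcases le_total y y₁ with h3 | h3
        · refine mem_iUnion₂.2 ⟨_, hK1, ?_⟩
          rw [closure_prod_eq, closure_Ioo h01.ne]
          exact ⟨subset_closure h1, h2.1.le, h3⟩
        · refine mem_iUnion₂.2 ⟨_, hK2, ?_⟩
          rw [closure_prod_eq, closure_Ioo h12.ne]
          exact ⟨subset_closure h1, h3, h2.2.le⟩
      have e1 := eq_of_mem_closure hqc (hT.subset_domain hK1) (by fun_prop) hp1 hD
        (by rw [closure_prod_eq, closure_Ioo h01.ne]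
            exact ⟨subset_closure ht, right_mem_Icc.2 h01.le⟩)
      have e2 := eq_of_mem_closure hqc (hT.subset_domain hK2) (by fun_prop) hp2 hD
        (by rw [closure_prod_eq, closure_Ioo h12.ne]
            exact ⟨subset_closure ht, left_mem_Icc.2 h12.le⟩)
      exact e1.symm.trans e2
    have ha := hz ((2 * x₀ + x₁) / 3) ⟨by linarith, by linarith⟩
    have hb := hz ((x₀ + 2 * x₁) / 3) ⟨by linarith, by linarith⟩
    have : (x₁ - x₀) * (B₁ + D₁ * y₁) = (x₁ - x₀) * (B₂ + D₂ * y₁) := by linarith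
    exact mul_left_cancel₀ hd.ne' this
  set N := √(((4 / (x₁ - x₀)) ^ 2 + (4 / b) ^ 2) * ((x₁ - x₀) * (y₂ - y₀))) with hN
  have hNsq : N ^ 2 = 32 * (b / (x₁ - x₀) + (x₁ - x₀) / b) := by
    rw [hN, Real.sq_sqrt (by have : 0 < y₂ - y₀ := by linarith
                             positivity), hy2, hy1]
    field_simp; ring
  have hN0 : 0 ≤ N := Real.sqrt_nonneg _
  have t1 := h.abs_slope_le hT hq hS hx hb hy1 hy2 hK1 hK2 hp1 hp2
    (ψ := bubble y₀ y₁) ((isBump_bubble h01).mono (Ioo_subset_Ioo_right h12.le)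
      (by rw [hy1, add_sub_cancel_left]))
    (e := ![-(4 * y₀ * y₁) / b ^ 2, 4 * (y₀ + y₁) / b ^ 2, -4 / b ^ 2]) (e' := 0)
    (fun y hy => by
      rw [bubble_of_mem hy, hy1, add_sub_cancel_left]
      simp only [Matrix.cons_val]; ring)
    (fun y hy => by
      rw [bubble_of_notMem h01 fun h' => by linarith [h'.2, hy.1]]; simp)
  have t2 := h.abs_slope_le hT hq hS hx hb hy1 hy2 hK1 hK2 hp1 hp2
    (ψ := bubble y₁ y₂) ((isBump_bubble h12).mono (Ioo_subset_Ioo_left h01.le)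
      (by rw [hy2, add_sub_cancel_left]))
    (e' := ![-(4 * y₁ * y₂) / b ^ 2, 4 * (y₁ + y₂) / b ^ 2, -4 / b ^ 2]) (e := 0)
    (fun y hy => by
      rw [bubble_of_notMem h12 fun h' => by linarith [h'.1, hy.2]]; simp)
    (fun y hy => by
      rw [bubble_of_mem hy, hy2, add_sub_cancel_left]
      simp only [Matrix.cons_val]; ring)
  have h4b : 1 / b ≤ 4 / b := div_le_div_of_nonneg_right (by norm_num) hb.le
  have t3 := h.abs_slope_le hT hq hS hx hb hy1 hy2 hK1 hK2 hp1 hp2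
    (ψ := trapezoid y₀ y₁ y₁ y₂) (isBump_trapezoid h01 h12
      (by rw [hy1, add_sub_cancel_left]; exact h4b) (by rw [hy2, add_sub_cancel_left]; exact h4b))
    (e := ![-y₀ / b, 1 / b, 0]) (e' := ![y₂ / b, -1 / b, 0])
    (fun y hy => by
      rw [trapezoid_left le_rfl h12 hy, hy1, add_sub_cancel_left]
      simp only [Matrix.cons_val]; ring)
    (fun y hy => by
      rw [trapezoid_right h01 le_rfl hy, hy2, add_sub_cancel_left]
      simp only [Matrix.cons_val]; ring)
  rw [← hN] at t1 t2 t3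
  simp only [integral_quadratic, integral_quadratic_mul_self] at t1 t2 t3
  simp only [Matrix.cons_val, Pi.zero_apply, zero_mul, add_zero, mul_zero, zero_add] at t1 t2 t3
  obtain ⟨s₀, hs0⟩ : ∃ s, s = B₁ + D₁ * y₀ := ⟨_, rfl⟩
  obtain ⟨s₁, hs1⟩ : ∃ s, s = B₁ + D₁ * y₁ := ⟨_, rfl⟩
  obtain ⟨s₂, hs2⟩ : ∃ s, s = B₂ + D₂ * y₂ := ⟨_, rfl⟩
  have r1 : |(x₁ - x₀) * b * (s₀ + s₁)| ≤ 9 / 2 * (S * N) := by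
    refine abs_le_mul_of_eq (by norm_num) ?_ t1
    rw [hs0, hs1, hy1]
    field_simp; ring
  have r2 : |(x₁ - x₀) * b * (s₁ + s₂)| ≤ 9 / 2 * (S * N) := by
    refine abs_le_mul_of_eq (by norm_num) ?_ t2
    rw [hs2, hs1, hmid, hy2]
    field_simp; ring
  have r3 : |(x₁ - x₀) * b * (s₀ + 4 * s₁ + s₂)| ≤ 9 * (S * N) := by
    refine abs_le_mul_of_eq (by norm_num) ?_ t3
    have e : s₀ + 4 * s₁ + s₂ =
        B₁ + D₁ * y₀ + 2 * (B₁ + D₁ * y₁) + 2 * (B₂ + D₂ * y₁) + (B₂ + D₂ * y₂) := by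
      rw [hs0, hs1, hs2]; linarith
    rw [e, hy2, hy1]
    field_simp; ring
  have hSN : 0 ≤ S * N := mul_nonneg hS hN0
  rw [abs_le] at r1 r2 r3
  -- the slope is affine in each cell, hence bounded by its three values on the grid lines
  obtain ⟨σ, hσ, hσ'⟩ : ∃ σ, q (x, y) - q (x', y) = (x - x') * σ ∧
      |(x₁ - x₀) * b * σ| ≤ 27 / 2 * (S * N) := by
    have m0 : |(x₁ - x₀) * b * s₀| ≤ 27 / 2 * (S * N) := abs_le.2 ⟨by linarith, by linarith⟩
    have m1 : |(x₁ - x₀) * b * s₁| ≤ 27 / 2 * (S * N) := abs_le.2 ⟨by linarith, by linarith⟩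
    have m2 : |(x₁ - x₀) * b * s₂| ≤ 27 / 2 * (S * N) := abs_le.2 ⟨by linarith, by linarith⟩
    rcases hy with hy | hy
    · refine ⟨B₁ + D₁ * y, by rw [hp1 _ ⟨hx1, hy⟩, hp1 _ ⟨hx2, hy⟩]; ring,
        abs_le_of_mul_eq_add hb (sub_pos.2 hy.2).le (sub_pos.2 hy.1).le ?_ m0 m1 ?_⟩
      · linarith
      · rw [hs0, hs1, hy1]; ring
    · refine ⟨B₂ + D₂ * y, by rw [hp2 _ ⟨hx1, hy⟩, hp2 _ ⟨hx2, hy⟩]; ring,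
        abs_le_of_mul_eq_add hb (sub_pos.2 hy.2).le (sub_pos.2 hy.1).le ?_ m1 m2 ?_⟩
      · linarith
      · rw [hs1, hs2, hmid, hy2]; ring
  have hxx : |x - x'| ≤ x₁ - x₀ :=
    abs_le.2 ⟨by linarith [hx1.1, hx2.2], by linarith [hx1.2, hx2.1]⟩
  have hb1 : |q (x, y) - q (x', y)| * b ≤ 27 / 2 * (S * N) := by
    refine le_trans ?_ hσ'
    rw [hσ, abs_mul, abs_mul, abs_mul, abs_of_pos hd, abs_of_pos hb]
    calc |x - x'| * |σ| * b = |x - x'| * (b * |σ|) := by ring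
      _ ≤ (x₁ - x₀) * (b * |σ|) := mul_le_mul_of_nonneg_right hxx (by positivity)
      _ = _ := by ring
  have hb2 : (q (x, y) - q (x', y)) ^ 2 * b ^ 2 ≤ (27 / 2 * (S * N)) ^ 2 := by
    rw [← sq_abs, ← mul_pow]
    exact pow_le_pow_left₀ (by positivity) hb1 2
  calc (q (x, y) - q (x', y)) ^ 2 * ((x₁ - x₀) * b)
      = (q (x, y) - q (x', y)) ^ 2 * b ^ 2 * ((x₁ - x₀) / b) := by field_simp
    _ ≤ (27 / 2 * (S * N)) ^ 2 * ((x₁ - x₀) / b) :=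
        mul_le_mul_of_nonneg_right hb2 (by positivity)
    _ = (27 / 2) ^ 2 * S ^ 2 * N ^ 2 * ((x₁ - x₀) / b) := by ring
    _ = 5832 * (1 + ((x₁ - x₀) / b) ^ 2) * S ^ 2 := by
        rw [hNsq]; field_simp; ring

end

/-! ### Control of the difference of two blocks linked by a strip -/

section
variable {T : Set (Set (ℝ × ℝ))} {K : Set (ℝ × ℝ)} {q : ℝ × ℝ → ℝ} {S : ℝ}

theorem volume_real_rect {a b c d : ℝ} (hab : a ≤ b) (hcd : c ≤ d) :
    volume.real (Ioo a b ×ˢ Ioo c d) = (b - a) * (d - c) := by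
  rw [measureReal_def, Measure.volume_eq_prod, Measure.prod_prod, Real.volume_Ioo, Real.volume_Ioo,
    ENNReal.toReal_mul, ENNReal.toReal_ofReal (by linarith), ENNReal.toReal_ofReal (by linarith)]

/-- The integral of the bubble is two thirds of the length of the interval. -/
theorem abs_integral_bubble_mul_sub_le {a b c d cst E : ℝ} (hab : a < b) (hcd : c < d)
    (hq : ContExt (Ioo a b ×ˢ Ioo c d) q) (hE : ∀ p ∈ Ioo a b ×ˢ Ioo c d, |q p - cst| ≤ E) :
    |(∫ p in Ioo a b ×ˢ Ioo c d, bubble c d p.2 * q p) - cst * ((b - a) * (2 / 3 * (d - c)))| ≤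
      E * ((b - a) * (d - c)) := by
  have hm : MeasurableSet (Ioo a b ×ˢ Ioo c d) := measurableSet_Ioo.prod measurableSet_Ioo
  have hI : ∀ g : ℝ × ℝ → ℝ, ContExt (Ioo a b ×ˢ Ioo c d) g →
      IntegrableOn g (Ioo a b ×ˢ Ioo c d) := by
    rintro g ⟨g', hg', h⟩
    exact ((hg'.continuousOn.integrableOn_compact (isCompact_Icc.prod isCompact_Icc)).mono_set
      (prod_mono Ioo_subset_Icc_self Ioo_subset_Icc_self)).congr_fun h.symm hm
  have hb : Continuous fun p : ℝ × ℝ => bubble c d p.2 :=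
    (isBump_bubble hcd).continuous.comp continuous_snd
  have e : ∫ p in Ioo a b ×ˢ Ioo c d, bubble c d p.2 * cst =
      cst * ((b - a) * (2 / 3 * (d - c))) := by
    rw [setIntegral_congr_fun hm (g := fun p => 1 * (-(4 * c * d) / (d - c) ^ 2 +
      4 * (c + d) / (d - c) ^ 2 * p.2 + -4 / (d - c) ^ 2 * p.2 ^ 2) *
        (cst + 0 * p.1 + 0 * p.2 + 0 * p.1 * p.2))
      (fun p hp => by simp only [bubble_of_mem hp.2]; ring),
      integral_rect_mul_bilinear (u := fun _ => 1) (v := fun y => -(4 * c * d) / (d - c) ^ 2 +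
      4 * (c + d) / (d - c) ^ 2 * y + -4 / (d - c) ^ 2 * y ^ 2) (by fun_prop) (by fun_prop)
      hab.le hcd.le, integral_quadratic]
    have : d - c ≠ 0 := (sub_pos.2 hcd).ne'
    simp only [intervalIntegral.integral_const, smul_eq_mul]
    field_simp; ring
  rw [← e, ← integral_sub (hI _ (ContExt.mul ⟨_, hb, fun _ _ => rfl⟩ hq))
    (hI _ ⟨fun p => bubble c d p.2 * cst, by fun_prop, fun _ _ => rfl⟩), ← Real.norm_eq_abs,
    ← volume_real_rect hab.le hcd.le]
  refine norm_setIntegral_le_of_norm_le_const ?_ fun p hp => ?_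
  · rw [Measure.volume_eq_prod, Measure.prod_prod, Real.volume_Ioo, Real.volume_Ioo]
    exact ENNReal.mul_lt_top ENNReal.ofReal_lt_top ENNReal.ofReal_lt_top
  · rw [← mul_sub, Real.norm_eq_abs, abs_mul, abs_of_nonneg ((isBump_bubble hcd).nonneg _)]
    calc bubble c d p.2 * |q p - cst| ≤ 1 * E :=
          mul_le_mul ((isBump_bubble hcd).le_one _) (hE p hp) (abs_nonneg _) zero_le_one
      _ = E := one_mul E

/-- Let two cells `L` and `R` of one row be separated by a strip of further cells, and let `q` be
within `E` of a constant on each of them. The trapezoid in `x`, constant on the strip, times the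
bubble in `y` gives a velocity that transports mass from one cell to the other. Its seminorm does
not see how thin the strip is, and the values of `q` on the strip do not enter. -/
theorem DivBound.abs_sub_le_of_strip (hT : IsMesh T) (hq : ∀ K ∈ T, IsQ 1 K q)
    (h : DivBound T q S) (hS : 0 ≤ S) {w₀ w₁ w₂ w₃ y₀ y₁ M E cL cR : ℝ}
    (h01 : w₀ < w₁) (h12 : w₁ < w₂) (h23 : w₂ < w₃) (hy : y₀ < y₁)
    (hL : Ioo w₀ w₁ ×ˢ Ioo y₀ y₁ ∈ T) (hR : Ioo w₂ w₃ ×ˢ Ioo y₀ y₁ ∈ T)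
    {T₀ : Set (Set (ℝ × ℝ))} (h0 : T₀ ⊆ T)
    (hcover : Ioo w₀ w₃ ×ˢ Ioo y₀ y₁ ⊆ ⋃ K ∈ T₀, closure K)
    (hT₀ : ∀ K ∈ T₀, K = Ioo w₀ w₁ ×ˢ Ioo y₀ y₁ ∨ K = Ioo w₂ w₃ ×ˢ Ioo y₀ y₁ ∨
      K ⊆ Ioo w₁ w₂ ×ˢ Ioo y₀ y₁)
    (hM : 1 / (w₁ - w₀) ≤ M) (hM' : 1 / (w₃ - w₂) ≤ M)
    (hcL : ∀ p ∈ Ioo w₀ w₁ ×ˢ Ioo y₀ y₁, |q p - cL| ≤ E)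
    (hcR : ∀ p ∈ Ioo w₂ w₃ ×ˢ Ioo y₀ y₁, |q p - cR| ≤ E) :
    |cL - cR| * (2 / 3 * (y₁ - y₀)) ≤
      S * √((M ^ 2 + (4 / (y₁ - y₀)) ^ 2) * ((w₃ - w₀) * (y₁ - y₀))) + 2 * (E * (y₁ - y₀)) := by
  have hφ := isBump_trapezoid (w₁ := w₁) (w₂ := w₂) h01 h23 hM hM'
  have hψ := isBump_bubble hy
  have hne : Ioo w₀ w₁ ×ˢ Ioo y₀ y₁ ≠ Ioo w₂ w₃ ×ˢ Ioo y₀ y₁ := by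
    intro e
    have hm : ((w₀ + w₁) / 2, (y₀ + y₁) / 2) ∈ Ioo w₀ w₁ ×ˢ Ioo y₀ y₁ :=
      ⟨⟨by simp only; linarith, by simp only; linarith⟩,
        ⟨by simp only; linarith, by simp only; linarith⟩⟩
    rw [e] at hm
    have := hm.1.1
    simp only at this
    linarith
  have hf0 : ∀ p ∉ Ioo w₀ w₃ ×ˢ Ioo y₀ y₁,
      trapezoid w₀ w₁ w₂ w₃ p.1 * bubble y₀ y₁ p.2 = 0 := by
    intro p hp
    by_cases hp1 : p.1 ∈ Ioo w₀ w₃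
    · rw [hψ.zero_outside p.2 fun h2 => hp ⟨hp1, h2⟩, mul_zero]
    · rw [hφ.zero_outside p.1 hp1, zero_mul]
  have hbp : ∀ y ∈ Ioo y₀ y₁, bubble y₀ y₁ y =
      -(4 * y₀ * y₁) / (y₁ - y₀) ^ 2 + 4 * (y₀ + y₁) / (y₁ - y₀) ^ 2 * y +
        -4 / (y₁ - y₀) ^ 2 * y ^ 2 := fun y hy' => by
    rw [bubble_of_mem hy']; ring
  have hf : IsVelocityComponent T fun p => trapezoid w₀ w₁ w₂ w₃ p.1 * bubble y₀ y₁ p.2 := by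
    refine isVelocityComponent_of hT h0 (isOpen_Ioo.prod isOpen_Ioo) hcover
      ((hφ.continuous.comp continuous_fst).mul (hψ.continuous.comp continuous_snd)) hf0 ?_
    intro K hK
    have hQ : ∀ c : Fin 3 → ℝ,
        (∀ p ∈ K, trapezoid w₀ w₁ w₂ w₃ p.1 = c 0 + c 1 * p.1 + c 2 * p.1 ^ 2) →
        (∀ p ∈ K, p.2 ∈ Ioo y₀ y₁) →
        IsQ 2 K fun p => trapezoid w₀ w₁ w₂ w₃ p.1 * bubble y₀ y₁ p.2 := fun c hc hK =>
      isQ_two_of_mul (c := c) (e := ![-(4 * y₀ * y₁) / (y₁ - y₀) ^ 2,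
          4 * (y₀ + y₁) / (y₁ - y₀) ^ 2, -4 / (y₁ - y₀) ^ 2])
          fun p hp => by rw [hc _ hp, hbp _ (hK _ hp)]; rfl
    rcases hT₀ K hK with rfl | rfl | hK'
    · refine hQ ![-w₀ / (w₁ - w₀), 1 / (w₁ - w₀), 0] (fun p hp => ?_) fun p hp => hp.2
      rw [trapezoid_left h12.le h23 hp.1]; simp only [Matrix.cons_val]; ring
    · refine hQ ![w₃ / (w₃ - w₂), -1 / (w₃ - w₂), 0] (fun p hp => ?_) fun p hp => hp.2
      rw [trapezoid_right h01 h12.le hp.1]; simp only [Matrix.cons_val]; ring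
    · refine hQ ![1, 0, 0] (fun p hp => ?_) fun p hp => (hK' hp).2
      rw [trapezoid_mid h01 h23 (Ioo_subset_Icc_self (hK' hp).1)]; simp
  have key := h.bump_le hS (h01.trans (h12.trans h23)) hy hφ hψ hf
  have hl := sub_pos.2 h01
  have hr := sub_pos.2 h23
  have hyy := sub_pos.2 hy
  rw [hT.integral_eq_add hL hR hne] at key
  · rw [setIntegral_congr_fun (hT.measurableSet hL) (g := fun p =>
        1 / (w₁ - w₀) * (bubble y₀ y₁ p.2 * q p))
        (fun p hp => by simp only [deriv_trapezoid_left h12.le h23 hp.1]; ring),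
      setIntegral_congr_fun (hT.measurableSet hR) (g := fun p =>
        -1 / (w₃ - w₂) * (bubble y₀ y₁ p.2 * q p))
        (fun p hp => by simp only [deriv_trapezoid_right h01 h12.le hp.1]; ring),
      integral_const_mul, integral_const_mul] at key
    have kL := abs_integral_bubble_mul_sub_le h01 hy (hq _ hL).contExt hcL
    have kR := abs_integral_bubble_mul_sub_le h23 hy (hq _ hR).contExt hcR
    set IL := ∫ p in Ioo w₀ w₁ ×ˢ Ioo y₀ y₁, bubble y₀ y₁ p.2 * q p
    set IR := ∫ p in Ioo w₂ w₃ ×ˢ Ioo y₀ y₁, bubble y₀ y₁ p.2 * q p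
    have kL' : |1 / (w₁ - w₀) * IL - cL * (2 / 3 * (y₁ - y₀))| ≤ E * (y₁ - y₀) := by
      refine (abs_le_mul_of_eq (c := 1 / (w₁ - w₀)) (by positivity) ?_ kL).trans (le_of_eq ?_)
      · field_simp
      · field_simp
    have kR' : |1 / (w₃ - w₂) * IR - cR * (2 / 3 * (y₁ - y₀))| ≤ E * (y₁ - y₀) := by
      refine (abs_le_mul_of_eq (c := 1 / (w₃ - w₂)) (by positivity) ?_ kR).trans (le_of_eq ?_)
      · field_simp
      · field_simp
    have e : |cL - cR| * (2 / 3 * (y₁ - y₀)) = |(cL - cR) * (2 / 3 * (y₁ - y₀))| := by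
      rw [abs_mul, abs_of_pos (by positivity : 0 < 2 / 3 * (y₁ - y₀))]
    rw [e]
    rw [neg_div, neg_mul] at key
    rw [abs_le] at key kL' kR' ⊢
    constructor <;> linarith
  · intro K hK
    have := (hf.dx_contExt hT hK).mul (hq K hK).contExt
    simpa only [dx_mul] using this
  · intro K hK h1 h2 p hp
    by_cases hpW : p ∈ Ioo w₀ w₃ ×ˢ Ioo y₀ y₁
    · obtain ⟨K', hK', hp'⟩ := mem_iUnion₂.1 (hcover hpW)
      have hKK : K = K' := by
        by_contra hne'
        exact Set.disjoint_left.1 (hT.disjoint_closure hK (h0 hK') hne') hp hp'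
      subst hKK
      rcases hT₀ K hK' with h3 | h3 | h3
      · exact absurd h3 h1
      · exact absurd h3 h2
      · rw [deriv_trapezoid_mid h01 h23 (h3 hp).1]; ring
    · rcases mul_eq_zero.1 (hf0 p hpW) with h3 | h3
      · rw [deriv_eq_zero_of_nonneg hφ.nonneg h3]; ring
      · rw [h3]; ring

end

/-! ### Half-axes and reflected boxes -/

namespace Arm
variable (A : Arm)

theorem ℓ_pos : 0 < A.ℓ := by linarith [A.h_pos, A.two_h_le]
theorem h_lt_ℓ : A.h < A.ℓ := by linarith [A.h_pos, A.two_h_le]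

/-- Half of the length of the far part. -/
def half : ℝ := (A.ℓ - A.h) / 2

theorem half_pos : 0 < A.half := by unfold half; linarith [A.h_lt_ℓ]
theorem ℓ_le_half : A.ℓ ≤ 4 * A.half := by unfold half; linarith [A.two_h_le]
theorem half_le : A.half ≤ A.ℓ / 2 := by unfold half; linarith [A.h_pos]
theorem h_le_half : A.h ≤ 2 * A.half := by unfold half; linarith [A.two_h_le]

/-- All grid intervals that may occur on a half-axis. -/
def interval : Fin 6 → Set ℝ :=
  ![Ioo 0 A.h, Ioo 0 (A.h / 2), Ioo (A.h / 2) A.h, Ioo A.h A.ℓ, Ioo A.h ((A.h + A.ℓ) / 2),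
    Ioo ((A.h + A.ℓ) / 2) A.ℓ]

variable {A} {I I' : Set ℝ}

theorem mem_range_interval (h : I ∈ A.near ∪ A.far) : I ∈ range A.interval := by
  rcases h with (⟨-, rfl⟩ | ⟨-, rfl | rfl⟩) | (⟨-, rfl⟩ | ⟨-, rfl | rfl⟩)
  exacts [⟨0, rfl⟩, ⟨1, rfl⟩, ⟨2, rfl⟩, ⟨3, rfl⟩, ⟨4, rfl⟩, ⟨5, rfl⟩]

theorem exists_of_near (h : I ∈ A.near) :
    ∃ a b, 0 ≤ a ∧ a < b ∧ b ≤ A.h ∧ A.h / 2 ≤ b - a ∧ I = Ioo a b := by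
  have := A.h_pos
  rcases h with ⟨-, rfl⟩ | ⟨-, rfl | rfl⟩
  · exact ⟨0, A.h, by linarith, by linarith, by linarith, by linarith, rfl⟩
  · exact ⟨0, A.h / 2, by linarith, by linarith, by linarith, by linarith, rfl⟩
  · exact ⟨A.h / 2, A.h, by linarith, by linarith, by linarith, by linarith, rfl⟩

theorem exists_of_far (h : I ∈ A.far) :
    ∃ a b, A.h ≤ a ∧ a < b ∧ b ≤ A.ℓ ∧ I = Ioo a b := by
  have := A.h_lt_ℓ
  rcases h with ⟨-, rfl⟩ | ⟨-, rfl | rfl⟩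
  · exact ⟨A.h, A.ℓ, by linarith, by linarith, by linarith, rfl⟩
  · exact ⟨A.h, (A.h + A.ℓ) / 2, by linarith, by linarith, by linarith, rfl⟩
  · exact ⟨(A.h + A.ℓ) / 2, A.ℓ, by linarith, by linarith, by linarith, rfl⟩

theorem exists_of_mem (h : I ∈ A.near ∪ A.far) :
    ∃ a b, 0 ≤ a ∧ a < b ∧ b ≤ A.ℓ ∧ I = Ioo a b := by
  have := A.h_lt_ℓ
  have := A.h_pos
  rcases h with h | h
  · obtain ⟨a, b, h1, h2, h3, -, rfl⟩ := exists_of_near h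
    exact ⟨a, b, h1, h2, by linarith, rfl⟩
  · obtain ⟨a, b, h1, h2, h3, rfl⟩ := exists_of_far h
    exact ⟨a, b, by linarith, h2, h3, rfl⟩

theorem pos_of_mem (h : I ∈ A.near ∪ A.far) {x : ℝ} (hx : x ∈ I) : 0 < x := by
  obtain ⟨a, b, h1, h2, h3, rfl⟩ := exists_of_mem h
  exact h1.trans_lt hx.1

theorem near_far_disjoint (h : I ∈ A.near) (h' : I' ∈ A.far) {x : ℝ} (hx : x ∈ I) (hx' : x ∈ I') :
    False := by
  obtain ⟨a, b, h1, h2, h3, -, rfl⟩ := exists_of_near h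
  obtain ⟨a, b, h1, h2, h3, rfl⟩ := exists_of_far h'
  linarith [hx.2, hx'.1]

theorem eq_of_mem (h : I ∈ A.near ∪ A.far) (h' : I' ∈ A.near ∪ A.far) {x : ℝ} (hx : x ∈ I)
    (hx' : x ∈ I') : I = I' := by
  rcases h with h | h <;> rcases h' with h' | h'
  · rcases h with ⟨h, rfl⟩ | ⟨h, rfl | rfl⟩ <;> rcases h' with ⟨h', rfl⟩ | ⟨h', rfl | rfl⟩ <;>
      first | rfl | exact absurd h' h | exact absurd h h' |
        (exfalso; linarith [hx.1, hx.2, hx'.1, hx'.2])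
  · exact (near_far_disjoint h h' hx hx').elim
  · exact (near_far_disjoint h' h hx' hx).elim
  · rcases h with ⟨h, rfl⟩ | ⟨h, rfl | rfl⟩ <;> rcases h' with ⟨h', rfl⟩ | ⟨h', rfl | rfl⟩ <;>
      first | rfl | exact absurd h' h | exact absurd h h' |
        (exfalso; linarith [hx.1, hx.2, hx'.1, hx'.2])

theorem far_fst (h : A.farSplit) : Ioo A.h (A.h + A.half) ∈ A.far :=
  Or.inr ⟨h, Or.inl (by rw [half]; congr 1; ring)⟩

theorem far_snd (h : A.farSplit) : Ioo (A.h + A.half) (A.h + A.half + A.half) ∈ A.far :=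
  Or.inr ⟨h, Or.inr (by rw [half]; congr 1 <;> ring)⟩

theorem far_eq (h : A.farSplit) (hI : I ∈ A.far) :
    I = Ioo A.h (A.h + A.half) ∨ I = Ioo (A.h + A.half) (A.h + A.half + A.half) := by
  rcases hI with ⟨h', -⟩ | ⟨-, rfl | rfl⟩
  · exact absurd h h'
  · left; rw [half]; congr 1; ring
  · right; rw [half]; congr 1 <;> ring

end Arm

/-- The reflection of a set of numbers that belongs to a half-axis. -/
def refl (b : Bool) (I : Set ℝ) : Set ℝ := {x | sgn b * x ∈ I}

@[simp] theorem sgn_true : sgn true = 1 := rfl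
@[simp] theorem sgn_false : sgn false = -1 := rfl
theorem sgn_mul_self (b : Bool) : sgn b * sgn b = 1 := by cases b <;> simp

theorem sgn_mul_sgn_mul (b : Bool) (x : ℝ) : sgn b * (sgn b * x) = x := by
  rw [← mul_assoc, sgn_mul_self, one_mul]

theorem refl_true (I : Set ℝ) : refl true I = I := by ext; simp [refl]
theorem refl_false (a b : ℝ) : refl false (Ioo a b) = Ioo (-b) (-a) := by
  ext x
  simp only [refl, sgn_false, mem_ofPred_eq, mem_Ioo]
  constructor <;> rintro ⟨h1, h2⟩ <;> constructor <;> linarith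

theorem box_eq (s : Bool × Bool) (I J : Set ℝ) : box s I J = refl s.1 I ×ˢ refl s.2 J := rfl

theorem exists_refl_eq (s : Bool) {a b : ℝ} (h : a < b) :
    ∃ a' b', a' < b' ∧ b' - a' = b - a ∧ refl s (Ioo a b) = Ioo a' b' := by
  cases s
  · exact ⟨-b, -a, by linarith, by ring, refl_false a b⟩
  · exact ⟨a, b, h, rfl, refl_true _⟩

theorem exists_box_eq (s : Bool × Bool) {a b c d : ℝ} (hab : a < b) (hcd : c < d) :
    ∃ a' b' c' d', a' < b' ∧ c' < d' ∧ b' - a' = b - a ∧ d' - c' = d - c ∧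
      box s (Ioo a b) (Ioo c d) = Ioo a' b' ×ˢ Ioo c' d' := by
  obtain ⟨a', b', h1, h2, h3⟩ := exists_refl_eq s.1 hab
  obtain ⟨c', d', h4, h5, h6⟩ := exists_refl_eq s.2 hcd
  exact ⟨a', b', c', d', h1, h4, h2, h5, by rw [box_eq, h3, h6]⟩

theorem volume_real_box (s : Bool × Bool) {a b c d : ℝ} (hab : a < b) (hcd : c < d) :
    volume.real (box s (Ioo a b) (Ioo c d)) = (b - a) * (d - c) := by
  obtain ⟨a', b', c', d', h1, h2, h3, h4, h5⟩ := exists_box_eq s hab hcd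
  rw [h5, volume_real_rect h1.le h2.le, h3, h4]

theorem preimage_swap_box (s : Bool × Bool) (I J : Set ℝ) :
    Prod.swap ⁻¹' box s I J = box s.swap J I := by
  ext p; simp only [box, mem_preimage, mem_ofPred_eq, Prod.fst_swap, Prod.snd_swap, and_comm]

theorem sgn_eq_of_mul_pos {b b' : Bool} {x : ℝ} (h : 0 < sgn b * x) (h' : 0 < sgn b' * x) :
    b = b' := by
  cases b <;> cases b' <;> simp at h h' ⊢ <;> linarith

/-! ### The partitions of a corner patch -/

namespace CornerPatch

variable (P : CornerPatch)

theorem exists_of_mem_cells {K : Set (ℝ × ℝ)} (hK : K ∈ P.cells) :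
    ∃ s ∈ P.quadrants, ∃ I ∈ (P.armX s.1).near ∪ (P.armX s.1).far,
      ∃ J ∈ (P.armY s.2).near ∪ (P.armY s.2).far, K = box s I J := by
  rcases hK with ⟨s, hs, I, hI, J, hJ, rfl⟩ | ⟨s, hs, I, J, h, rfl⟩
  · exact ⟨s, hs, I, Or.inl hI, J, Or.inl hJ, rfl⟩
  · rcases h with ⟨hI, hJ⟩ | ⟨hI, hJ⟩ | ⟨hI, hJ⟩
    · exact ⟨s, hs, I, Or.inr hI, J, Or.inl hJ, rfl⟩
    · exact ⟨s, hs, I, Or.inl hI, J, Or.inr hJ, rfl⟩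
    · exact ⟨s, hs, I, Or.inr hI, J, Or.inr hJ, rfl⟩

theorem cells_subset_range : P.cells ⊆ range fun i : (Bool × Bool) × Fin 6 × Fin 6 =>
    box i.1 ((P.armX i.1.1).interval i.2.1) ((P.armY i.1.2).interval i.2.2) := by
  intro K hK
  obtain ⟨s, -, I, hI, J, hJ, rfl⟩ := P.exists_of_mem_cells hK
  obtain ⟨i, rfl⟩ := Arm.mem_range_interval hI
  obtain ⟨j, rfl⟩ := Arm.mem_range_interval hJ
  exact ⟨(s, i, j), rfl⟩

theorem eq_of_mem_boxes {s s' : Bool × Bool} {I I' J J' : Set ℝ}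
    (hI : I ∈ (P.armX s.1).near ∪ (P.armX s.1).far)
    (hJ : J ∈ (P.armY s.2).near ∪ (P.armY s.2).far)
    (hI' : I' ∈ (P.armX s'.1).near ∪ (P.armX s'.1).far)
    (hJ' : J' ∈ (P.armY s'.2).near ∪ (P.armY s'.2).far)
    {p : ℝ × ℝ} (hp : p ∈ box s I J) (hp' : p ∈ box s' I' J') : s = s' ∧ I = I' ∧ J = J' := by
  have hs : s = s' := Prod.ext
    (sgn_eq_of_mul_pos (Arm.pos_of_mem hI hp.1) (Arm.pos_of_mem hI' hp'.1))
    (sgn_eq_of_mul_pos (Arm.pos_of_mem hJ hp.2) (Arm.pos_of_mem hJ' hp'.2))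
  subst hs
  exact ⟨rfl, Arm.eq_of_mem hI hI' hp.1 hp'.1, Arm.eq_of_mem hJ hJ' hp.2 hp'.2⟩

theorem isMesh_cells : IsMesh P.cells := by
  refine ⟨(finite_range _).subset P.cells_subset_range, fun K hK => ?_, fun K hK K' hK' hne => ?_⟩
  · obtain ⟨s, -, I, hI, J, hJ, rfl⟩ := P.exists_of_mem_cells hK
    obtain ⟨a, b, -, hab, -, rfl⟩ := Arm.exists_of_mem hI
    obtain ⟨c, d, -, hcd, -, rfl⟩ := Arm.exists_of_mem hJ
    obtain ⟨a', b', c', d', h1, h2, -, -, h5⟩ := exists_box_eq s hab hcd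
    exact ⟨a', b', c', d', h1, h2, h5⟩
  · obtain ⟨s, -, I, hI, J, hJ, rfl⟩ := P.exists_of_mem_cells hK
    obtain ⟨s', -, I', hI', J', hJ', rfl⟩ := P.exists_of_mem_cells hK'
    refine Set.disjoint_left.2 fun p hp hp' => hne ?_
    obtain ⟨rfl, rfl, rfl⟩ := P.eq_of_mem_boxes hI hJ hI' hJ' hp hp'
    rfl

theorem isMesh_edgeCells : IsMesh P.edgeCells := P.isMesh_cells.mono subset_union_right
theorem isMesh_cornerCells : IsMesh P.cornerCells := P.isMesh_cells.mono subset_union_left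

theorem disjoint_cornerCells_edgeCells : Disjoint P.cornerCells P.edgeCells := by
  refine Set.disjoint_left.2 fun K hK hK' => ?_
  have hne : K.Nonempty := by
    obtain ⟨a, b, c, d, h1, h2, rfl⟩ := P.isMesh_cornerCells.rect K hK
    exact (nonempty_Ioo.2 h1).prod (nonempty_Ioo.2 h2)
  obtain ⟨p, hp⟩ := hne
  obtain ⟨s, hs, I, hI, J, hJ, rfl⟩ := hK
  obtain ⟨s', hs', I', J', h, e⟩ := hK'
  have hp' : p ∈ box s' I' J' := e ▸ hp
  rcases h with ⟨hI', hJ'⟩ | ⟨hI', hJ'⟩ | ⟨hI', hJ'⟩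
  · obtain ⟨rfl, rfl, rfl⟩ := P.eq_of_mem_boxes (Or.inl hI) (Or.inl hJ) (Or.inr hI') (Or.inl hJ')
      hp hp'
    exact Arm.near_far_disjoint hI hI' hp.1 hp'.1
  · obtain ⟨rfl, rfl, rfl⟩ := P.eq_of_mem_boxes (Or.inl hI) (Or.inl hJ) (Or.inl hI') (Or.inr hJ')
      hp hp'
    exact Arm.near_far_disjoint hJ hJ' hp.2 hp'.2
  · obtain ⟨rfl, rfl, rfl⟩ := P.eq_of_mem_boxes (Or.inl hI) (Or.inl hJ) (Or.inr hI') (Or.inr hJ')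
      hp hp'
    exact Arm.near_far_disjoint hI hI' hp.1 hp'.1

theorem card_edgeCells_le : P.isMesh_edgeCells.finite.toFinset.card ≤ 144 := by
  rw [← Set.ncard_eq_toFinset_card _ P.isMesh_edgeCells.finite]
  refine (Set.ncard_le_ncard (subset_union_right.trans P.cells_subset_range)
    (finite_range _)).trans ?_
  rw [← image_univ]
  refine (Set.ncard_image_le finite_univ).trans ?_
  simp [Set.ncard_univ]

/-- The corner patch reflected in the diagonal. -/
def swap : CornerPatch where
  armX := P.armY
  armY := P.armX
  quadrants := P.quadrants.image Prod.swap
  nonempty := P.nonempty.image _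
  not_opposite := fun s h => P.not_opposite s.swap (by
    have := congrArg (Finset.image Prod.swap) h
    rw [Finset.image_image, Prod.swap_swap_eq, Finset.image_id] at this
    rw [this]; simp [Prod.swap])

variable {P}

theorem swap_mem_quadrants {s : Bool × Bool} (h : s ∈ P.quadrants) : s.swap ∈ P.swap.quadrants :=
  Finset.mem_image_of_mem _ h

theorem exists_of_mem_swap {s : Bool × Bool} (h : s ∈ P.swap.quadrants) :
    s.swap ∈ P.quadrants := by
  obtain ⟨t, ht, rfl⟩ := Finset.mem_image.1 h
  simpa using ht

theorem edgeCells_swap : P.swap.edgeCells = swapT P.edgeCells := by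
  ext K
  constructor
  · rintro ⟨s, hs, I, J, h, rfl⟩
    refine ⟨box s.swap J I, ⟨s.swap, exists_of_mem_swap hs, J, I, ?_, rfl⟩, ?_⟩
    · change (I ∈ (P.armY s.1).far ∧ J ∈ (P.armX s.2).near) ∨
        (I ∈ (P.armY s.1).near ∧ J ∈ (P.armX s.2).far) ∨
        (I ∈ (P.armY s.1).far ∧ J ∈ (P.armX s.2).far) at h
      simp only [Prod.fst_swap, Prod.snd_swap]
      tauto
    · rw [preimage_swap_box, Prod.swap_swap]
  · rintro ⟨_, ⟨s, hs, I, J, h, rfl⟩, rfl⟩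
    refine ⟨s.swap, swap_mem_quadrants hs, J, I, ?_, preimage_swap_box s I J⟩
    change (J ∈ (P.armY s.2).far ∧ I ∈ (P.armX s.1).near) ∨
        (J ∈ (P.armY s.2).near ∧ I ∈ (P.armX s.1).far) ∨
        (J ∈ (P.armY s.2).far ∧ I ∈ (P.armX s.1).far)
    tauto

theorem EdgeDivided.swap (h : P.EdgeDivided) : P.swap.EdgeDivided := fun s hs =>
  (h s.swap (exists_of_mem_swap hs)).symm

theorem ShapeRegular.swap {σ : ℝ} (h : P.ShapeRegular σ) : P.swap.ShapeRegular σ := fun s hs =>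
  let ⟨h1, h2, h3, h4⟩ := h s.swap (exists_of_mem_swap hs)
  ⟨h2, h1, h4, h3⟩

end CornerPatch

/-! ### Restriction to a part of a partition, and an inverse estimate -/

section
variable {T T₁ T₂ : Set (Set (ℝ × ℝ))} {K : Set (ℝ × ℝ)} {q : ℝ × ℝ → ℝ} {S : ℝ}

theorem IsVelocityComponent.eq_zero_of_notMem {f : ℝ × ℝ → ℝ} (hT : IsMesh T) (h1 : T₁ ⊆ T)
    (hf : IsVelocityComponent T₁ f) (hK : K ∈ T) (hK1 : K ∉ T₁) : ∀ p ∈ K, f p = 0 := by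
  intro p hp
  refine hf.zero_outside p fun h => ?_
  obtain ⟨K', hK', hp'⟩ := mem_iUnion₂.1 (interior_subset h)
  exact Set.disjoint_left.1 (hT.disjoint_closure hK (h1 hK') fun e => hK1 (e ▸ hK')) hp hp'

theorem IsVelocityComponent.extend {f : ℝ × ℝ → ℝ} (hT : IsMesh T) (h1 : T₁ ⊆ T)
    (hf : IsVelocityComponent T₁ f) : IsVelocityComponent T f := by
  refine ⟨hf.continuous, fun p hp => hf.zero_outside p fun h => hp (domain_mono h1 h),
    fun K hK => ?_⟩
  by_cases hK1 : K ∈ T₁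
  · exact hf.biquadratic K hK1
  · exact isQ_of_eqOn_zero (hf.eq_zero_of_notMem hT h1 hK hK1)

theorem IsVelocityComponent.deriv_eq_zero_of_notMem {f : ℝ × ℝ → ℝ} (hT : IsMesh T) (h1 : T₁ ⊆ T)
    (hf : IsVelocityComponent T₁ f) (hK : K ∈ T) (hK1 : K ∉ T₁) :
    ∀ p ∈ K, dx f p = 0 ∧ dy f p = 0 := by
  intro p hp
  have : ∀ᶠ p' in nhds p, f p' = 0 := by
    filter_upwards [(hT.isOpen hK).mem_nhds hp] using hf.eq_zero_of_notMem hT h1 hK hK1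
  exact ⟨(hasDerivAt_fst_of_eventually_zero this).deriv,
    (hasDerivAt_snd_of_eventually_zero this).deriv⟩

theorem IsMesh.integral_domain_eq_of_subset (hT : IsMesh T) (h1 : T₁ ⊆ T) {g : ℝ × ℝ → ℝ}
    (hg : ∀ K ∈ T, ContExt K g) (h0 : ∀ K ∈ T, K ∉ T₁ → ∀ p ∈ K, g p = 0) :
    ∫ p in domain T, g p = ∫ p in domain T₁, g p := by
  rw [hT.integral_domain fun K hK => hT.integrableOn hK (hg K hK),
    (hT.mono h1).integral_domain fun K hK => hT.integrableOn (h1 hK) (hg K (h1 hK))]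
  refine (Finset.sum_subset (by simpa using h1) fun K hK hK' => ?_).symm
  exact setIntegral_eq_zero_of_forall_eq_zero
    (h0 K (by simpa using hK) (by simpa using hK'))

theorem IsMesh.volume_domain_pos (hT : IsMesh T) (hne : T.Nonempty) :
    0 < volume.real (domain T) := by
  obtain ⟨K, hK⟩ := hne
  have hKne : K.Nonempty := by
    obtain ⟨a, b, c, d, h1, h2, rfl⟩ := hT.rect K hK
    exact (nonempty_Ioo.2 h1).prod (nonempty_Ioo.2 h2)
  exact ENNReal.toReal_pos ((((hT.isOpen hK).measure_pos volume hKne).trans_le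
    (measure_mono (hT.subset_domain hK))).ne') hT.domain_volume_ne_top

theorem IsMesh.integrableOn_domain_of_contExt (hT : IsMesh T) {g : ℝ × ℝ → ℝ}
    (hg : ∀ K ∈ T, ContExt K g) : IntegrableOn g (domain T) :=
  hT.integrableOn_domain fun K hK => hT.integrableOn hK (hg K hK)

/-- On a part of the partition, subtract the mean value of `q`. The velocities of the part,
extended by zero, are velocities of the whole partition, and they do not see the constant. -/
theorem InfSupStable.exists_mul_l2norm_sub_le (hT : IsMesh T) (h1 : T₁ ⊆ T) (hne : T₁.Nonempty)
    {β : ℝ} (h : InfSupStable T₁ β) (hq : IsPressure T q) (hS : 0 ≤ S)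
    (hv : ∀ v, IsVelocity T v → divProd (domain T) v q ≤ S * h1seminorm (domain T) v) :
    ∃ c, β * l2norm (domain T₁) (fun p => q p - c) ≤ S := by
  have hT1 := hT.mono h1
  have hpos := hT1.volume_domain_pos hne
  have hqI : IntegrableOn q (domain T₁) :=
    hT1.integrableOn_domain_of_contExt fun K hK => hq.contExt (h1 hK)
  have hcI : ∀ c : ℝ, IntegrableOn (fun _ => c) (domain T₁) := fun c =>
    integrableOn_const hT1.domain_volume_ne_top
  set c := (∫ p in domain T₁, q p) / volume.real (domain T₁) with hc
  have hp : IsPressure T₁ (fun p => q p - c) := by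
    refine ⟨(hq.continuousOn.mono (domain_mono h1)).sub continuousOn_const,
      fun K hK => (hq.bilinear K (h1 hK)).sub_const c, ?_⟩
    rw [integral_sub hqI (hcI c), setIntegral_const, smul_eq_mul, hc]
    field_simp; simp
  refine ⟨c, h.mul_l2norm_le hp hS fun v hv1 => ?_⟩
  have hvT : IsVelocity T v := ⟨hv1.1.extend hT h1, hv1.2.extend hT h1⟩
  have e1 : h1seminorm (domain T) v = h1seminorm (domain T₁) v := by
    unfold h1seminorm
    rw [hT.integral_domain_eq_of_subset h1]
    · exact fun K hK => ((((hvT.1.dx_contExt hT hK).sq.add (hvT.1.dy_contExt hT hK).sq).add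
        (hvT.2.dx_contExt hT hK).sq).add (hvT.2.dy_contExt hT hK).sq)
    · intro K hK hK1 p hp
      obtain ⟨h2, h3⟩ := hv1.1.deriv_eq_zero_of_notMem hT h1 hK hK1 p hp
      obtain ⟨h4, h5⟩ := hv1.2.deriv_eq_zero_of_notMem hT h1 hK hK1 p hp
      simp [h2, h3, h4, h5]
  have e2 : divProd (domain T) v q = divProd (domain T₁) v q := by
    unfold divProd
    rw [hT.integral_domain_eq_of_subset h1]
    · exact fun K hK => ((hvT.1.dx_contExt hT hK).add (hvT.2.dy_contExt hT hK)).mul (hq.contExt hK)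
    · intro K hK hK1 p hp
      obtain ⟨h2, h3⟩ := hv1.1.deriv_eq_zero_of_notMem hT h1 hK hK1 p hp
      obtain ⟨h4, h5⟩ := hv1.2.deriv_eq_zero_of_notMem hT h1 hK hK1 p hp
      simp [h2, h5]
  have hdiv : ∫ p in domain T₁, (dx v.1 p + dy v.2 p) = 0 := by
    rw [integral_add, hv1.1.integral_dx hT1, hv1.2.integral_dy hT1, add_zero]
    · exact hT1.integrableOn_domain_of_contExt fun K hK => hv1.1.dx_contExt hT1 hK
    · exact hT1.integrableOn_domain_of_contExt fun K hK => hv1.2.dy_contExt hT1 hK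
  have e3 : divProd (domain T₁) v (fun p => q p - c) = divProd (domain T₁) v q := by
    unfold divProd
    simp only [mul_sub]
    rw [integral_sub, integral_mul_const, hdiv, zero_mul, sub_zero]
    · exact hT1.integrableOn_domain_of_contExt fun K hK =>
        ((hv1.1.dx_contExt hT1 hK).add (hv1.2.dy_contExt hT1 hK)).mul (hq.contExt (h1 hK))
    · exact hT1.integrableOn_domain_of_contExt fun K hK =>
        ((hv1.1.dx_contExt hT1 hK).add (hv1.2.dy_contExt hT1 hK)).mul
          ⟨_, continuous_const, fun _ _ => rfl⟩
  rw [e3, ← e2, ← e1]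
  exact hv v hvT

/-- Among all constants, zero is the closest to a function of mean value zero. -/
theorem IsPressure.integral_sq_le (hT : IsMesh T) (hq : IsPressure T q) (c : ℝ) :
    ∫ p in domain T, q p ^ 2 ≤ ∫ p in domain T, (q p - c) ^ 2 := by
  have hqI := hT.integrableOn_domain_of_contExt fun K hK => hq.contExt hK
  have hq2 := hT.integrableOn_domain_of_contExt fun K hK => (hq.contExt hK).sq
  have hcI : IntegrableOn (fun _ => c ^ 2) (domain T) :=
    integrableOn_const hT.domain_volume_ne_top
  have hsub : IntegrableOn (fun p => q p ^ 2 - 2 * c * q p) (domain T) :=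
    hq2.sub (hqI.const_mul (2 * c))
  have e : ∫ p in domain T, (q p - c) ^ 2 =
      (∫ p in domain T, q p ^ 2) - 2 * c * (∫ p in domain T, q p) +
        volume.real (domain T) * c ^ 2 := by
    rw [← smul_eq_mul (a := volume.real _), ← setIntegral_const, ← integral_const_mul,
      ← integral_sub hq2 (hqI.const_mul _), ← integral_add hsub hcI]
    congr 1; ext p; ring
  rw [e, hq.mean_zero]
  have : 0 ≤ volume.real (domain T) * c ^ 2 := by positivity
  linarith

theorem sq_le_integral_affine_sq {a b x₀ α γ : ℝ} (hab : a < b) (hx : x₀ ∈ Icc a b) :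
    (b - a) / 4 * (α + γ * x₀) ^ 2 ≤ ∫ x in Ioo a b, (α + γ * x) ^ 2 := by
  rw [← integral_Ioc_eq_integral_Ioo, ← intervalIntegral.integral_of_le hab.le,
    integral_cubic a b (α ^ 2) (2 * α * γ) (γ ^ 2) 0 fun x => by ring]
  obtain ⟨u, hu⟩ : ∃ u, u = α + γ * a := ⟨_, rfl⟩
  obtain ⟨w, hw⟩ : ∃ w, w = α + γ * b := ⟨_, rfl⟩
  have hd := sub_pos.2 hab
  have e : α ^ 2 * (b - a) + 2 * α * γ * ((b ^ 2 - a ^ 2) / 2) + γ ^ 2 * ((b ^ 3 - a ^ 3) / 3) +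
      0 * ((b ^ 4 - a ^ 4) / 4) = (b - a) / 4 * (4 / 3 * (u ^ 2 + u * w + w ^ 2)) := by
    rw [hu, hw]; ring
  rw [e]
  refine mul_le_mul_of_nonneg_left ?_ (by positivity)
  have hM : |α + γ * x₀| ≤ max |u| |w| :=
    abs_le_of_mul_eq_add hd (sub_nonneg.2 hx.2) (sub_nonneg.2 hx.1) (by ring)
      (le_max_left _ _) (le_max_right _ _) (by rw [hu, hw]; ring)
  have h2 : (α + γ * x₀) ^ 2 ≤ (max |u| |w|) ^ 2 := by
    rw [← sq_abs]; exact pow_le_pow_left₀ (abs_nonneg _) hM 2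
  refine h2.trans ?_
  rcases max_choice |u| |w| with h | h <;> rw [h, sq_abs]
  · nlinarith [sq_nonneg (u + 2 * w)]
  · nlinarith [sq_nonneg (2 * u + w)]

/-- Inverse estimate: the value of a bilinear function at a point of a rectangle is controlled by
the `L²` norm, with the scaling of the area. -/
theorem sq_mul_volume_le_integral_sq {a b c d A B C D : ℝ} (hab : a < b) (hcd : c < d) {z : ℝ × ℝ}
    (hz : z ∈ Icc a b ×ˢ Icc c d) :
    (A + B * z.1 + C * z.2 + D * z.1 * z.2) ^ 2 * ((b - a) * (d - c)) ≤
      16 * ∫ p in Ioo a b ×ˢ Ioo c d, (A + B * p.1 + C * p.2 + D * p.1 * p.2) ^ 2 := by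
  have hI : ∀ g : ℝ × ℝ → ℝ, Continuous g → IntegrableOn g (Ioo a b ×ˢ Ioo c d) := fun g hg =>
    (hg.continuousOn.integrableOn_compact (isCompact_Icc.prod isCompact_Icc)).mono_set
      (prod_mono Ioo_subset_Icc_self Ioo_subset_Icc_self)
  have hint := hI (fun p => (A + B * p.1 + C * p.2 + D * p.1 * p.2) ^ 2) (by fun_prop)
  have h1 : (b - a) / 4 * ((A + C * z.2) + (B + D * z.2) * z.1) ^ 2 ≤
      ∫ x in Ioo a b, ((A + C * z.2) + (B + D * z.2) * x) ^ 2 :=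
    sq_le_integral_affine_sq hab hz.1
  have h2 : ∫ x in Ioo a b, (d - c) / 4 * ((A + C * z.2) + (B + D * z.2) * x) ^ 2 ≤
      ∫ x in Ioo a b, ∫ y in Ioo c d, (A + B * x + C * y + D * x * y) ^ 2 := by
    refine setIntegral_mono_on ?_ ?_ measurableSet_Ioo fun x _ => ?_
    · have hc : Continuous fun x => (d - c) / 4 * ((A + C * z.2) + (B + D * z.2) * x) ^ 2 := by
        fun_prop
      exact (hc.continuousOn.integrableOn_compact isCompact_Icc).mono_set Ioo_subset_Icc_self
    · rw [IntegrableOn, Measure.volume_eq_prod, ← Measure.prod_restrict] at hint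
      exact hint.integral_prod_left
    · have := sq_le_integral_affine_sq (α := A + B * x) (γ := C + D * x) hcd hz.2
      calc _ = (d - c) / 4 * (A + B * x + (C + D * x) * z.2) ^ 2 := by ring
        _ ≤ _ := this
        _ = _ := by congr 1; ext y; ring
  rw [integral_const_mul] at h2
  have h3 : ∫ p in Ioo a b ×ˢ Ioo c d, (A + B * p.1 + C * p.2 + D * p.1 * p.2) ^ 2 =
      ∫ x in Ioo a b, ∫ y in Ioo c d, (A + B * x + C * y + D * x * y) ^ 2 := by
    rw [Measure.volume_eq_prod] at hint ⊢
    exact setIntegral_prod _ hint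
  rw [h3]
  have h4 := mul_le_mul_of_nonneg_left h1 (by linarith : 0 ≤ (d - c) / 4)
  calc _ = 16 * ((d - c) / 4 * ((b - a) / 4 * ((A + C * z.2) + (B + D * z.2) * z.1) ^ 2)) := by ring
    _ ≤ _ := mul_le_mul_of_nonneg_left (h4.trans h2) (by norm_num)

theorem IsPressure.sq_sub_mul_volume_le (hT : IsMesh T) (hq : IsPressure T q) (h1 : T₁ ⊆ T)
    (hK : K ∈ T₁) {z : ℝ × ℝ} (hz : z ∈ domain T) (hzK : z ∈ closure K) (c : ℝ) :
    (q z - c) ^ 2 * volume.real K ≤ 16 * ∫ p in domain T₁, (q p - c) ^ 2 := by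
  obtain ⟨A, B, C, D, hp⟩ := (hq.bilinear K (h1 hK)).exists_bilinear
  have hqz := eq_of_mem_closure hq.continuousOn (hT.subset_domain (h1 hK)) (by fun_prop) hp hz hzK
  have hle : ∫ p in K, (q p - c) ^ 2 ≤ ∫ p in domain T₁, (q p - c) ^ 2 := by
    refine setIntegral_mono_set ((hT.mono h1).integrableOn_domain_of_contExt fun K hK =>
      ((hq.contExt (h1 hK)).sub_const c).sq) (Filter.Eventually.of_forall fun p => sq_nonneg _)
      (LE.le.eventuallyLE ((hT.mono h1).subset_domain hK))
  have hm := hT.measurableSet (h1 hK)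
  obtain ⟨a, b, c', d, hab, hcd, rfl⟩ := hT.rect K (h1 hK)
  rw [closure_prod_eq, closure_Ioo hab.ne, closure_Ioo hcd.ne] at hzK
  have key := sq_mul_volume_le_integral_sq (A := A - c) (B := B) (C := C) (D := D) hab hcd hzK
  rw [volume_real_rect hab.le hcd.le, hqz]
  calc _ = (A - c + B * z.1 + C * z.2 + D * z.1 * z.2) ^ 2 * ((b - a) * (d - c')) := by ring
    _ ≤ _ := key
    _ = 16 * ∫ p in Ioo a b ×ˢ Ioo c' d, (q p - c) ^ 2 := by
        rw [setIntegral_congr_fun hm fun p hp' => ?_]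
        simp only [hp p hp']; ring
    _ ≤ _ := mul_le_mul_of_nonneg_left hle (by norm_num)

theorem refl_Icc_subset_closure (s : Bool) {a b : ℝ} (h : a < b) :
    refl s (Icc a b) ⊆ closure (refl s (Ioo a b)) := by
  intro x hx
  change sgn s * x ∈ Icc a b at hx
  cases s
  · rw [refl_false, closure_Ioo (neg_lt_neg h).ne]
    rw [sgn_false] at hx
    exact ⟨by linarith [hx.2], by linarith [hx.1]⟩
  · rw [refl_true, closure_Ioo h.ne]
    simpa using hx

theorem isOpen_refl (s : Bool) {I : Set ℝ} (hI : IsOpen I) : IsOpen (refl s I) :=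
  hI.preimage (by fun_prop : Continuous fun x : ℝ => sgn s * x)

theorem mem_closure_box {s : Bool × Bool} {a b c d : ℝ} (hab : a < b) (hcd : c < d) {p : ℝ × ℝ}
    (h1 : sgn s.1 * p.1 ∈ Icc a b) (h2 : sgn s.2 * p.2 ∈ Icc c d) :
    p ∈ closure (box s (Ioo a b) (Ioo c d)) := by
  rw [box_eq, closure_prod_eq]
  exact ⟨refl_Icc_subset_closure s.1 hab h1, refl_Icc_subset_closure s.2 hcd h2⟩

end

/-! ### Stability on the patch from stability on its two parts -/

theorem Arm.exists_near_last (A : Arm) : ∃ a, a ≤ A.h / 2 ∧ Ioo a A.h ∈ A.near := by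
  have := A.h_pos
  by_cases h : A.nearSplit
  · exact ⟨A.h / 2, le_rfl, Or.inr ⟨h, Or.inr rfl⟩⟩
  · exact ⟨0, by linarith, Or.inl ⟨h, rfl⟩⟩

namespace CornerPatch
variable {P : CornerPatch} {q : ℝ × ℝ → ℝ}

theorem cornerCells_nonempty : P.cornerCells.Nonempty := by
  obtain ⟨s, hs⟩ := P.nonempty
  obtain ⟨a, -, ha⟩ := (P.armX s.1).exists_near_last
  obtain ⟨b, -, hb⟩ := (P.armY s.2).exists_near_last
  exact ⟨_, s, hs, _, ha, _, hb, rfl⟩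

theorem edgeCells_nonempty (hE : P.EdgeDivided) : P.edgeCells.Nonempty := by
  obtain ⟨s, hs⟩ := P.nonempty
  exact ⟨_, s, hs, _, _, Or.inr (Or.inr ⟨Arm.far_fst (hE s hs).1, Arm.far_fst (hE s hs).2⟩), rfl⟩

/-- The vertex `(h, h)` of a quadrant is a vertex of a cell of the corner region and of a cell of
the big rectangle, both of area at least `h * h / 4`. As `q` is continuous there, two constants
that approximate `q` in the two regions cannot differ much. -/
theorem sq_sub_mul_corner_le (hE : P.EdgeDivided) (hq : IsPressure P.cells q) {s : Bool × Bool}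
    (hs : s ∈ P.quadrants) (c₁ c₂ : ℝ) :
    (c₁ - c₂) ^ 2 * ((P.armX s.1).h * (P.armY s.2).h) ≤
      128 * ((∫ p in domain P.cornerCells, (q p - c₁) ^ 2) +
        ∫ p in domain P.edgeCells, (q p - c₂) ^ 2) := by
  obtain ⟨a, ha, hI⟩ := (P.armX s.1).exists_near_last
  obtain ⟨c, hc, hJ⟩ := (P.armY s.2).exists_near_last
  have hI' := Arm.far_fst (hE s hs).1
  have hJ' := Arm.far_fst (hE s hs).2
  set X := P.armX s.1
  set Y := P.armY s.2
  have hXp := X.h_pos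
  have hYp := Y.h_pos
  have hXl := X.half_pos
  have hYl := Y.half_pos
  have hXh := X.h_le_half
  have hYh := Y.h_le_half
  have k1 : box s (Ioo a X.h) (Ioo c Y.h) ∈ P.cornerCells := ⟨s, hs, _, hI, _, hJ, rfl⟩
  have k2 : box s (Ioo a X.h) (Ioo Y.h (Y.h + Y.half)) ∈ P.edgeCells :=
    ⟨s, hs, _, _, Or.inr (Or.inl ⟨hI, hJ'⟩), rfl⟩
  have k3 : box s (Ioo X.h (X.h + X.half)) (Ioo c Y.h) ∈ P.edgeCells :=
    ⟨s, hs, _, _, Or.inl ⟨hI', hJ⟩, rfl⟩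
  have k4 : box s (Ioo X.h (X.h + X.half)) (Ioo Y.h (Y.h + Y.half)) ∈ P.edgeCells :=
    ⟨s, hs, _, _, Or.inr (Or.inr ⟨hI', hJ'⟩), rfl⟩
  have haX : a < X.h := by linarith
  have hcY : c < Y.h := by linarith
  have hX1 : X.h < X.h + X.half := by linarith
  have hY1 : Y.h < Y.h + Y.half := by linarith
  -- the four cells around the vertex `(h, h)` show that it is an interior point of the patch
  set z : ℝ × ℝ := (sgn s.1 * X.h, sgn s.2 * Y.h) with hz
  have hz1 : sgn s.1 * z.1 = X.h := sgn_mul_sgn_mul _ _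
  have hz2 : sgn s.2 * z.2 = Y.h := sgn_mul_sgn_mul _ _
  have hzD : z ∈ domain P.cells := by
    refine interior_maximal (s := ⋃ K ∈ P.cells, closure K)
      (t := box s (Ioo a (X.h + X.half)) (Ioo c (Y.h + Y.half))) ?_
      ((isOpen_refl _ isOpen_Ioo).prod (isOpen_refl _ isOpen_Ioo)) ?_
    · rintro p ⟨h1, h2⟩
      rcases le_total (sgn s.1 * p.1) X.h with h3 | h3 <;>
        rcases le_total (sgn s.2 * p.2) Y.h with h4 | h4
      · exact mem_iUnion₂.2 ⟨_, Or.inl k1, mem_closure_box haX hcY ⟨h1.1.le, h3⟩ ⟨h2.1.le, h4⟩⟩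
      · exact mem_iUnion₂.2 ⟨_, Or.inr k2, mem_closure_box haX hY1 ⟨h1.1.le, h3⟩ ⟨h4, h2.2.le⟩⟩
      · exact mem_iUnion₂.2 ⟨_, Or.inr k3, mem_closure_box hX1 hcY ⟨h3, h1.2.le⟩ ⟨h2.1.le, h4⟩⟩
      · exact mem_iUnion₂.2 ⟨_, Or.inr k4, mem_closure_box hX1 hY1 ⟨h3, h1.2.le⟩ ⟨h4, h2.2.le⟩⟩
    · refine ⟨?_, ?_⟩
      · rw [hz1]; exact ⟨haX, hX1⟩
      · rw [hz2]; exact ⟨hcY, hY1⟩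
  have e1 := hq.sq_sub_mul_volume_le P.isMesh_cells subset_union_left k1 hzD
    (mem_closure_box haX hcY (by rw [hz1]; exact right_mem_Icc.2 haX.le)
      (by rw [hz2]; exact right_mem_Icc.2 hcY.le)) c₁
  have e2 := hq.sq_sub_mul_volume_le P.isMesh_cells subset_union_right k4 hzD
    (mem_closure_box hX1 hY1 (by rw [hz1]; exact left_mem_Icc.2 hX1.le)
      (by rw [hz2]; exact left_mem_Icc.2 hY1.le)) c₂
  rw [volume_real_box s haX hcY] at e1
  rw [volume_real_box s hX1 hY1] at e2
  have v1 : X.h * Y.h / 4 ≤ (X.h - a) * (Y.h - c) := by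
    calc X.h * Y.h / 4 = (X.h / 2) * (Y.h / 2) := by ring
      _ ≤ _ := mul_le_mul (by linarith) (by linarith) (by linarith) (by linarith)
  have v2 : X.h * Y.h / 4 ≤ (X.h + X.half - X.h) * (Y.h + Y.half - Y.h) := by
    calc X.h * Y.h / 4 = (X.h / 2) * (Y.h / 2) := by ring
      _ ≤ _ := mul_le_mul (by linarith) (by linarith) (by linarith) (by linarith)
  have f1 := (mul_le_mul_of_nonneg_left v1 (sq_nonneg (q z - c₁))).trans e1
  have f2 := (mul_le_mul_of_nonneg_left v2 (sq_nonneg (q z - c₂))).trans e2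
  have f3 : (c₁ - c₂) ^ 2 * (X.h * Y.h) ≤
      2 * ((q z - c₁) ^ 2 + (q z - c₂) ^ 2) * (X.h * Y.h) := by
    refine mul_le_mul_of_nonneg_right ?_ (by positivity)
    nlinarith [sq_nonneg ((q z - c₁) + (q z - c₂))]
  linarith

theorem volume_corner_le : volume.real (domain P.cornerCells) ≤
    ∑ s ∈ P.quadrants, (P.armX s.1).h * (P.armY s.2).h := by
  rw [measureReal_congr P.isMesh_cornerCells.domain_ae_eq]
  have hb : ∀ s : Bool × Bool, volume.real (box s (Ioo 0 (P.armX s.1).h) (Ioo 0 (P.armY s.2).h)) =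
      (P.armX s.1).h * (P.armY s.2).h := fun s => by
    rw [volume_real_box s (Arm.h_pos _) (Arm.h_pos _), sub_zero, sub_zero]
  refine (measureReal_mono (s₂ := ⋃ s ∈ P.quadrants,
    box s (Ioo 0 (P.armX s.1).h) (Ioo 0 (P.armY s.2).h)) ?_ ?_).trans
    ((measureReal_biUnion_finset_le _ _).trans (le_of_eq (Finset.sum_congr rfl fun s _ => hb s)))
  · rintro p ⟨_, ⟨s, hs, I, hI, J, hJ, rfl⟩, hp⟩
    obtain ⟨a, b, h1, -, h2, -, rfl⟩ := Arm.exists_of_near hI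
    obtain ⟨c, d, h3, -, h4, -, rfl⟩ := Arm.exists_of_near hJ
    exact mem_iUnion₂.2 ⟨s, hs, Ioo_subset_Ioo h1 h2 hp.1, Ioo_subset_Ioo h3 h4 hp.2⟩
  · refine ((measure_biUnion_lt_top P.quadrants.finite_toSet fun s _ => ?_).ne)
    by_contra htop
    have h0 := hb s
    rw [measureReal_def, not_lt_top_iff.1 htop, ENNReal.toReal_top] at h0
    have := mul_pos (P.armX s.1).h_pos (P.armY s.2).h_pos
    linarith

/-- The pressure is close to one constant in the corner region and to another one in the edge
patch; the continuity of the pressure at the vertices `(h, h)` controls the difference of the two,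
in the scaling of the corner region. No velocity across the interface of the two regions is needed.
-/
theorem infSupStable_cells {β βc : ℝ} (hβ : 0 < β) (hβc : 0 < βc) (hE : P.EdgeDivided)
    (h : InfSupStable P.edgeCells β) (hc : InfSupStable P.cornerCells βc) :
    InfSupStable P.cells (√(1026 * ((β ^ 2)⁻¹ + (βc ^ 2)⁻¹)))⁻¹ := by
  refine infSupStable_of P.isMesh_cells (by positivity) fun q hq S hS hv => ?_
  obtain ⟨c₁, h1⟩ := hc.exists_mul_l2norm_sub_le P.isMesh_cells subset_union_left
    P.cornerCells_nonempty hq hS hv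
  obtain ⟨c₂, h2⟩ := h.exists_mul_l2norm_sub_le P.isMesh_cells subset_union_right
    (edgeCells_nonempty hE) hq hS hv
  set n₁ := l2norm (domain P.cornerCells) (fun p => q p - c₁) with hn1
  set n₂ := l2norm (domain P.edgeCells) (fun p => q p - c₂) with hn2
  have n1sq := l2norm_sq (domain P.cornerCells) (fun p => q p - c₁)
  have n2sq := l2norm_sq (domain P.edgeCells) (fun p => q p - c₂)
  rw [← hn1] at n1sq
  rw [← hn2] at n2sq
  have hvol : (c₁ - c₂) ^ 2 * volume.real (domain P.cornerCells) ≤ 512 * (n₁ ^ 2 + n₂ ^ 2) := by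
    calc _ ≤ (c₁ - c₂) ^ 2 * ∑ s ∈ P.quadrants, (P.armX s.1).h * (P.armY s.2).h :=
          mul_le_mul_of_nonneg_left volume_corner_le (sq_nonneg _)
      _ ≤ ∑ s ∈ P.quadrants, 128 * (n₁ ^ 2 + n₂ ^ 2) := by
          rw [Finset.mul_sum, n1sq, n2sq]
          exact Finset.sum_le_sum fun s hs => sq_sub_mul_corner_le hE hq hs c₁ c₂
      _ = P.quadrants.card * (128 * (n₁ ^ 2 + n₂ ^ 2)) := by rw [Finset.sum_const, nsmul_eq_mul]
      _ ≤ 4 * (128 * (n₁ ^ 2 + n₂ ^ 2)) := by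
          refine mul_le_mul_of_nonneg_right ?_ (by positivity)
          exact_mod_cast (Finset.card_le_univ P.quadrants).trans (by simp)
      _ = _ := by ring
  have hqc : ∀ c : ℝ, ∀ K ∈ P.cells, ContExt K fun p => (q p - c) ^ 2 := fun c K hK =>
    ((hq.contExt hK).sub_const c).sq
  have hI : ∀ c : ℝ, IntegrableOn (fun p => (q p - c) ^ 2) (domain P.cornerCells) := fun c =>
    P.isMesh_cornerCells.integrableOn_domain_of_contExt fun K hK => hqc c K (Or.inl hK)
  have hcorner : ∫ p in domain P.cornerCells, (q p - c₂) ^ 2 ≤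
      2 * n₁ ^ 2 + 2 * ((c₁ - c₂) ^ 2 * volume.real (domain P.cornerCells)) := by
    have hcI : IntegrableOn (fun _ => 2 * (c₁ - c₂) ^ 2) (domain P.cornerCells) :=
      integrableOn_const P.isMesh_cornerCells.domain_volume_ne_top
    calc _ ≤ ∫ p in domain P.cornerCells, (2 * (q p - c₁) ^ 2 + 2 * (c₁ - c₂) ^ 2) := by
          refine setIntegral_mono (hI c₂) (((hI c₁).const_mul 2).add hcI) fun p => ?_
          simp only
          nlinarith [sq_nonneg ((q p - c₁) - (c₁ - c₂))]
      _ = _ := by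
          rw [integral_add ((hI c₁).const_mul 2) hcI, integral_const_mul, setIntegral_const, n1sq,
            smul_eq_mul]
          ring
  -- `1026 = 2 + 2 * 512`
  have hq2 : l2norm (domain P.cells) q ^ 2 ≤ 1026 * (n₁ ^ 2 + n₂ ^ 2) := by
    rw [l2norm_sq]
    refine (hq.integral_sq_le P.isMesh_cells c₂).trans ?_
    unfold cells
    rw [IsMesh.integral_domain_union P.isMesh_cells P.disjoint_cornerCells_edgeCells
      (fun K hK => P.isMesh_cells.integrableOn hK (hqc c₂ K hK)), ← n2sq]
    nlinarith [sq_nonneg n₁, sq_nonneg n₂]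
  have b1 : n₁ ^ 2 ≤ S ^ 2 * (βc ^ 2)⁻¹ := by
    rw [← div_eq_mul_inv, le_div_iff₀ (by positivity), ← mul_pow, mul_comm]
    exact pow_le_pow_left₀ (mul_nonneg hβc.le (l2norm_nonneg _ _)) h1 2
  have b2 : n₂ ^ 2 ≤ S ^ 2 * (β ^ 2)⁻¹ := by
    rw [← div_eq_mul_inv, le_div_iff₀ (by positivity), ← mul_pow, mul_comm]
    exact pow_le_pow_left₀ (mul_nonneg hβ.le (l2norm_nonneg _ _)) h2 2
  rw [inv_mul_le_iff₀ (by positivity)]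
  refine le_of_sq_le_sq ?_ (by positivity)
  rw [mul_pow, Real.sq_sqrt (by positivity)]
  nlinarith

end CornerPatch

/-! ### Oscillation in the cells of a quadrant -/

section
variable {T : Set (Set (ℝ × ℝ))} {K : Set (ℝ × ℝ)} {q : ℝ × ℝ → ℝ} {S : ℝ}

theorem sgn_mul_mem_refl {b : Bool} {I : Set ℝ} {t : ℝ} (h : t ∈ I) : sgn b * t ∈ refl b I := by
  change sgn b * (sgn b * t) ∈ I
  rwa [sgn_mul_sgn_mul]

/-- The bound of `DivBound.sq_sub_le` in the coordinates of a quadrant. -/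
theorem DivBound.sq_sub_le_of_boxes (hT : IsMesh T) (hqc : ContinuousOn q (domain T))
    (hq : ∀ K ∈ T, IsQ 1 K q) (h : DivBound T q S) (hS : 0 ≤ S) {s : Bool × Bool}
    {a b c η : ℝ} (hab : a < b) (hη : 0 < η) (hK1 : box s (Ioo a b) (Ioo c (c + η)) ∈ T)
    (hK2 : box s (Ioo a b) (Ioo (c + η) (c + η + η)) ∈ T) {x x' y : ℝ}
    (hx1 : x ∈ refl s.1 (Ioo a b)) (hx2 : x' ∈ refl s.1 (Ioo a b))
    (hy : y ∈ refl s.2 (Ioo c (c + η)) ∪ refl s.2 (Ioo (c + η) (c + η + η))) :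
    (q (x, y) - q (x', y)) ^ 2 * ((b - a) * η) ≤
      5832 * (1 + ((b - a) / η) ^ 2) * S ^ 2 := by
  obtain ⟨a', b', hab', hd, e⟩ := exists_refl_eq s.1 hab
  rw [box_eq, e] at hK1 hK2
  rw [e] at hx1 hx2
  rw [← hd]
  cases hs : s.2
  · rw [hs, refl_false] at hK1 hK2
    rw [hs, refl_false, refl_false, union_comm] at hy
    exact h.sq_sub_le hT hqc hq hS hab' hη (by ring) (by ring) hK2 hK1 hx1 hx2 hy
  · rw [hs, refl_true] at hK1 hK2
    rw [hs, refl_true, refl_true] at hy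
    exact h.sq_sub_le hT hqc hq hS hab' hη rfl rfl hK1 hK2 hx1 hx2 hy

/-- Oscillation bounds on two neighbouring cells add up across the common edge, by continuity. -/
theorem abs_sub_le_of_adjacent (hqc : ContinuousOn q (domain T)) {a b b' c d y E E' : ℝ}
    (hab : a < b) (hbb : b < b') (hK1 : Ioo a b ×ˢ Ioo c d ∈ T) (hK2 : Ioo b b' ×ˢ Ioo c d ∈ T)
    (hy : y ∈ Ioo c d)
    (hE : ∀ x ∈ Ioo a b, ∀ x' ∈ Ioo a b, |q (x, y) - q (x', y)| ≤ E)
    (hE' : ∀ x ∈ Ioo b b', ∀ x' ∈ Ioo b b', |q (x, y) - q (x', y)| ≤ E') :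
    ∀ x ∈ Ioo a b, ∀ x' ∈ Ioo b b', |q (x, y) - q (x', y)| ≤ E + E' := by
  have hD : (b, y) ∈ domain T := by
    refine interior_maximal ?_ (isOpen_Ioo.prod isOpen_Ioo : IsOpen (Ioo a b' ×ˢ Ioo c d))
      ⟨⟨hab, hbb⟩, hy⟩
    rintro ⟨t, y⟩ ⟨h1, h2⟩
    rcases le_total t b with h3 | h3
    · refine mem_iUnion₂.2 ⟨_, hK1, ?_⟩
      rw [closure_prod_eq, closure_Ioo hab.ne]
      exact ⟨⟨h1.1.le, h3⟩, subset_closure h2⟩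
    · refine mem_iUnion₂.2 ⟨_, hK2, ?_⟩
      rw [closure_prod_eq, closure_Ioo hbb.ne]
      exact ⟨⟨h3, h1.2.le⟩, subset_closure h2⟩
  have hf : ContinuousAt (fun t => q (t, y)) b :=
    ContinuousAt.comp (f := fun t : ℝ => (t, y)) (hqc.continuousAt ((isOpen_domain T).mem_nhds hD))
      (by fun_prop : Continuous fun t : ℝ => (t, y)).continuousAt
  have hl : ∀ x, Filter.Tendsto (fun t => |q (x, y) - q (t, y)|) (nhds b)
      (nhds |q (x, y) - q (b, y)|) := fun x => (hf.tendsto.const_sub _).abs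
  intro x hx x' hx'
  have h1 : |q (x, y) - q (b, y)| ≤ E := by
    have : (nhdsWithin b (Ioo a b)).NeBot := right_nhdsWithin_Ioo_neBot hab
    refine le_of_tendsto ((hl x).mono_left nhdsWithin_le_nhds : Filter.Tendsto _
      (nhdsWithin b (Ioo a b)) _) ?_
    filter_upwards [self_mem_nhdsWithin] with t ht using hE x hx t ht
  have h2 : |q (x', y) - q (b, y)| ≤ E' := by
    have : (nhdsWithin b (Ioo b b')).NeBot := left_nhdsWithin_Ioo_neBot hbb
    refine le_of_tendsto ((hl x').mono_left nhdsWithin_le_nhds : Filter.Tendsto _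
      (nhdsWithin b (Ioo b b')) _) ?_
    filter_upwards [self_mem_nhdsWithin] with t ht using hE' x' hx' t ht
  rw [abs_sub_comm] at h2
  exact (abs_sub_le _ (q (b, y)) _).trans (add_le_add h1 h2)

theorem abs_sub_le_of_adjacent_refl (hqc : ContinuousOn q (domain T)) {s : Bool × Bool}
    {a b b' c d y E E' : ℝ} (hab : a < b) (hbb : b < b') (hcd : c < d)
    (hK1 : box s (Ioo a b) (Ioo c d) ∈ T) (hK2 : box s (Ioo b b') (Ioo c d) ∈ T)
    (hy : y ∈ refl s.2 (Ioo c d))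
    (hE : ∀ x ∈ refl s.1 (Ioo a b), ∀ x' ∈ refl s.1 (Ioo a b), |q (x, y) - q (x', y)| ≤ E)
    (hE' : ∀ x ∈ refl s.1 (Ioo b b'), ∀ x' ∈ refl s.1 (Ioo b b'),
      |q (x, y) - q (x', y)| ≤ E') :
    ∀ x ∈ refl s.1 (Ioo a b), ∀ x' ∈ refl s.1 (Ioo b b'), |q (x, y) - q (x', y)| ≤ E + E' := by
  obtain ⟨c', d', -, -, e⟩ := exists_refl_eq s.2 hcd
  rw [box_eq, e] at hK1 hK2
  rw [e] at hy
  cases hs : s.1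
  · rw [hs, refl_false] at hK1 hK2 hE hE'
    rw [refl_false, refl_false]
    intro x hx x' hx'
    rw [abs_sub_comm, add_comm]
    exact abs_sub_le_of_adjacent hqc (neg_lt_neg hbb) (neg_lt_neg hab) hK2 hK1 hy hE' hE x' hx' x hx
  · rw [hs, refl_true] at hK1 hK2 hE hE'
    rw [refl_true, refl_true]
    exact abs_sub_le_of_adjacent hqc hab hbb hK1 hK2 hy hE hE'

end

/-! ### Pressures on the edge patch -/

/-- A pressure `q` (up to a constant) on the edge cells of a shape-regular corner patch, together
with a bound for the divergence form. -/
structure EdgeBound (P : CornerPatch) (σ : ℝ) (q : ℝ × ℝ → ℝ) (S : ℝ) : Prop where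
  divided : P.EdgeDivided
  regular : P.ShapeRegular σ
  one_le : 1 ≤ σ
  continuousOn : ContinuousOn q (domain P.edgeCells)
  bilinear : ∀ K ∈ P.edgeCells, IsQ 1 K q
  bound : DivBound P.edgeCells q S
  nonneg : 0 ≤ S

/-- The union of the two halves of the far part of a half-axis. -/
def farSet (b : Bool) (A : Arm) : Set ℝ :=
  refl b (Ioo A.h (A.h + A.half)) ∪ refl b (Ioo (A.h + A.half) (A.h + A.half + A.half))

/-- The constant function with this value has the squared `L²` norm
`23328 * (1 + 4 * σ ^ 2) * S ^ 2` on a rectangle of area `w`. -/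
def osc (σ S w : ℝ) : ℝ := √(23328 * (1 + 4 * σ ^ 2) * S ^ 2 / w)

theorem osc_anti {σ S w w' : ℝ} (hw : 0 < w) (h : w ≤ w') : osc σ S w' ≤ osc σ S w :=
  Real.sqrt_le_sqrt (div_le_div_of_nonneg_left (by positivity) hw h)

theorem osc_nonneg (σ S w : ℝ) : 0 ≤ osc σ S w := Real.sqrt_nonneg _

theorem osc_div_four (σ S w : ℝ) : osc σ S (w / 4) = 2 * osc σ S w := by
  unfold osc
  rw [show 23328 * (1 + 4 * σ ^ 2) * S ^ 2 / (w / 4) =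
    2 ^ 2 * (23328 * (1 + 4 * σ ^ 2) * S ^ 2 / w) by ring, Real.sqrt_mul (by norm_num),
    Real.sqrt_sq (by norm_num)]

theorem osc_sq_mul {σ S w : ℝ} (hw : 0 < w) :
    osc σ S w ^ 2 * w = 23328 * (1 + 4 * σ ^ 2) * S ^ 2 := by
  unfold osc
  rw [Real.sq_sqrt (by positivity)]; field_simp

namespace EdgeBound
variable {P : CornerPatch} {σ : ℝ} {q : ℝ × ℝ → ℝ} {S : ℝ}

theorem swap (D : EdgeBound P σ q S) : EdgeBound P.swap σ (q ∘ Prod.swap) S := by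
  refine ⟨D.divided.swap, D.regular.swap, D.one_le, ?_, ?_, ?_, D.nonneg⟩
  · rw [CornerPatch.edgeCells_swap, domain_swapT]
    exact D.continuousOn.comp continuous_swap.continuousOn fun p hp => hp
  · rw [CornerPatch.edgeCells_swap]
    rintro _ ⟨K, hK, rfl⟩
    exact (D.bilinear K hK).comp_swap
  · rw [CornerPatch.edgeCells_swap]
    exact D.bound.swapT

variable {s : Bool × Bool}

theorem mem_edgeCells {I J : Set ℝ} (hs : s ∈ P.quadrants)
    (hI : I ∈ (P.armX s.1).near ∪ (P.armX s.1).far) (hJ : J ∈ (P.armY s.2).far) :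
    box s I J ∈ P.edgeCells := by
  rcases hI with hI | hI
  · exact ⟨s, hs, I, J, Or.inr (Or.inl ⟨hI, hJ⟩), rfl⟩
  · exact ⟨s, hs, I, J, Or.inr (Or.inr ⟨hI, hJ⟩), rfl⟩

/-- Oscillation of `q` across a thin vertical cell or a cell of the big rectangle. Both have a
width of at most `2 * σ` times their height. -/
theorem abs_sub_le_osc (D : EdgeBound P σ q S) (hs : s ∈ P.quadrants) {a b : ℝ} (hab : a < b)
    (hI : Ioo a b ∈ (P.armX s.1).near ∪ (P.armX s.1).far)
    (hba : b - a ≤ 2 * σ * (P.armY s.2).half) {y : ℝ} (hy : y ∈ farSet s.2 (P.armY s.2)) :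
    ∀ x ∈ refl s.1 (Ioo a b), ∀ x' ∈ refl s.1 (Ioo a b),
      |q (x, y) - q (x', y)| ≤ osc σ S ((b - a) * (P.armY s.2).ℓ) := by
  intro x hx x' hx'
  have hY := (D.divided s hs).2
  have hd := sub_pos.2 hab
  set Y := P.armY s.2
  have hη := Y.half_pos
  have h := D.bound.sq_sub_le_of_boxes P.isMesh_edgeCells D.continuousOn D.bilinear D.nonneg hab
    hη (mem_edgeCells hs hI (Arm.far_fst hY)) (mem_edgeCells hs hI (Arm.far_snd hY)) hx hx' hy
  refine Real.abs_le_sqrt ?_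
  rw [le_div_iff₀ (mul_pos hd Y.ℓ_pos)]
  have h1 : ((b - a) / Y.half) ^ 2 ≤ 4 * σ ^ 2 := by
    calc _ ≤ (2 * σ) ^ 2 := pow_le_pow_left₀ (by positivity) ((div_le_iff₀ hη).2 hba) 2
      _ = _ := by ring
  calc (q (x, y) - q (x', y)) ^ 2 * ((b - a) * Y.ℓ)
      ≤ (q (x, y) - q (x', y)) ^ 2 * ((b - a) * (4 * Y.half)) := by
        have := Y.ℓ_le_half; gcongr
    _ = 4 * ((q (x, y) - q (x', y)) ^ 2 * ((b - a) * Y.half)) := by ring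
    _ ≤ 4 * (5832 * (1 + 4 * σ ^ 2) * S ^ 2) := by
        refine mul_le_mul_of_nonneg_left (h.trans ?_) (by norm_num)
        gcongr
    _ = _ := by ring

theorem near_le (D : EdgeBound P σ q S) (hs : s ∈ P.quadrants) :
    (P.armX s.1).h ≤ 2 * σ * (P.armY s.2).half := by
  have h1 := (D.regular s hs).2.2.1
  have h2 := (P.armY s.2).h_le_half
  have h3 := D.one_le
  nlinarith

theorem half_le (D : EdgeBound P σ q S) (hs : s ∈ P.quadrants) :
    (P.armX s.1).half ≤ 2 * σ * (P.armY s.2).half := by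
  have h1 := (D.regular s hs).1
  have h2 := (P.armY s.2).ℓ_le_half
  have h3 := D.one_le
  have h4 := (P.armX s.1).half_le
  nlinarith

theorem exists_of_mem_farSet {A : Arm} (hA : A.farSplit) {b : Bool} {y : ℝ}
    (hy : y ∈ farSet b A) : ∃ c d, c < d ∧ Ioo c d ∈ A.far ∧ y ∈ refl b (Ioo c d) := by
  have := A.half_pos
  rcases hy with hy | hy
  · exact ⟨_, _, by linarith, Arm.far_fst hA, hy⟩
  · exact ⟨_, _, by linarith, Arm.far_snd hA, hy⟩

/-- Oscillation along a horizontal segment of the big rectangle of a quadrant. -/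
theorem abs_sub_far_le (D : EdgeBound P σ q S) (hs : s ∈ P.quadrants) {x x' y : ℝ}
    (hx : x ∈ farSet s.1 (P.armX s.1)) (hx' : x' ∈ farSet s.1 (P.armX s.1))
    (hy : y ∈ farSet s.2 (P.armY s.2)) :
    |q (x, y) - q (x', y)| ≤ 4 * osc σ S ((P.armX s.1).ℓ * (P.armY s.2).ℓ) := by
  have hX := (D.divided s hs).1
  obtain ⟨c, d, hcd, hJ, hyJ⟩ := exists_of_mem_farSet (D.divided s hs).2 hy
  have hle := D.half_le hs
  have hp := (P.armX s.1).half_pos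
  have hl := (P.armX s.1).ℓ_le_half
  have hYp := (P.armY s.2).ℓ_pos
  have hXp := (P.armX s.1).ℓ_pos
  set X := P.armX s.1
  set Y := P.armY s.2
  have ho : osc σ S (X.half * Y.ℓ) ≤ 2 * osc σ S (X.ℓ * Y.ℓ) := by
    rw [← osc_div_four]
    refine osc_anti (by positivity) ?_
    nlinarith
  have hn := osc_nonneg σ S (X.ℓ * Y.ℓ)
  have h1 := D.abs_sub_le_osc hs (a := X.h) (b := X.h + X.half) (by linarith)
    (Or.inr (Arm.far_fst hX)) (by linarith) hy
  have h2 := D.abs_sub_le_osc hs (a := X.h + X.half) (b := X.h + X.half + X.half) (by linarith)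
    (Or.inr (Arm.far_snd hX)) (by linarith) hy
  rw [add_sub_cancel_left] at h1 h2
  have h3 := abs_sub_le_of_adjacent_refl D.continuousOn (by linarith) (by linarith) hcd
    (mem_edgeCells hs (Or.inr (Arm.far_fst hX)) hJ) (mem_edgeCells hs (Or.inr (Arm.far_snd hX)) hJ)
    hyJ h1 h2
  rcases hx with hx | hx <;> rcases hx' with hx' | hx'
  · linarith [h1 x hx x' hx']
  · linarith [h3 x hx x' hx']
  · rw [abs_sub_comm]; linarith [h3 x' hx' x hx]
  · linarith [h2 x hx x' hx']

/-- Oscillation along a horizontal segment from a thin vertical cell to the big rectangle. -/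
theorem abs_sub_near_le (D : EdgeBound P σ q S) (hs : s ∈ P.quadrants) {I : Set ℝ}
    (hI : I ∈ (P.armX s.1).near) {x x' y : ℝ} (hx : x ∈ refl s.1 I)
    (hx' : x' ∈ refl s.1 (Ioo (P.armX s.1).h ((P.armX s.1).h + (P.armX s.1).half)))
    (hy : y ∈ farSet s.2 (P.armY s.2)) :
    |q (x, y) - q (x', y)| ≤ 8 * osc σ S ((P.armX s.1).h * (P.armY s.2).ℓ) := by
  have hX := (D.divided s hs).1
  obtain ⟨c, d, hcd, hJ, hyJ⟩ := exists_of_mem_farSet (D.divided s hs).2 hy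
  have hle := D.half_le hs
  have hnle := D.near_le hs
  have hp := (P.armX s.1).half_pos
  have hhp := (P.armX s.1).h_pos
  have hhh := (P.armX s.1).h_le_half
  have hYp := (P.armY s.2).ℓ_pos
  set X := P.armX s.1
  set Y := P.armY s.2
  have ho : ∀ w, X.h / 2 ≤ w → osc σ S (w * Y.ℓ) ≤ 2 * osc σ S (X.h * Y.ℓ) := by
    intro w hw
    rw [← osc_div_four]
    refine osc_anti (by positivity) ?_
    nlinarith
  have hn := osc_nonneg σ S (X.h * Y.ℓ)
  have h1 := D.abs_sub_le_osc hs (a := X.h) (b := X.h + X.half) (by linarith)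
    (Or.inr (Arm.far_fst hX)) (by linarith) hy
  have hfar := ho (X.h + X.half - X.h) (by linarith)
  by_cases hns : X.nearSplit
  · have m1 : Ioo 0 (X.h / 2) ∈ X.near := Or.inr ⟨hns, Or.inl rfl⟩
    have m2 : Ioo (X.h / 2) X.h ∈ X.near := Or.inr ⟨hns, Or.inr rfl⟩
    have g1 := D.abs_sub_le_osc hs (a := 0) (b := X.h / 2) (by linarith) (Or.inl m1)
      (by linarith) hy
    have g2 := D.abs_sub_le_osc hs (a := X.h / 2) (b := X.h) (by linarith) (Or.inl m2)
      (by linarith) hy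
    have k1 := abs_sub_le_of_adjacent_refl D.continuousOn (by linarith) (by linarith) hcd
      (mem_edgeCells hs (Or.inl m1) hJ) (mem_edgeCells hs (Or.inl m2) hJ) hyJ g1 g2
    have k2 := abs_sub_le_of_adjacent_refl D.continuousOn (by linarith) (by linarith) hcd
      (mem_edgeCells hs (Or.inl m2) hJ) (mem_edgeCells hs (Or.inr (Arm.far_fst hX)) hJ) hyJ g2 h1
    have o1 := ho (X.h / 2 - 0) (by linarith)
    have o2 := ho (X.h - X.h / 2) (by linarith)
    rcases hI with ⟨h, -⟩ | ⟨-, rfl | rfl⟩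
    · exact absurd hns h
    · -- through the midpoint of the second near interval
      have hmid : sgn s.1 * (3 / 4 * X.h) ∈ refl s.1 (Ioo (X.h / 2) X.h) := 
        sgn_mul_mem_refl ⟨by linarith, by linarith⟩
      have l1 := k1 x hx _ hmid
      have l2 := k2 _ hmid x' hx'
      have l3 := abs_sub_le (q (x, y)) (q (sgn s.1 * (3 / 4 * X.h), y)) (q (x', y))
      linarith
    · linarith [k2 x hx x' hx']
  · have m1 : Ioo 0 X.h ∈ X.near := Or.inl ⟨hns, rfl⟩
    have g1 := D.abs_sub_le_osc hs (a := 0) (b := X.h) (by linarith) (Or.inl m1)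
      (by linarith) hy
    have k1 := abs_sub_le_of_adjacent_refl D.continuousOn (by linarith) (by linarith) hcd
      (mem_edgeCells hs (Or.inl m1) hJ) (mem_edgeCells hs (Or.inr (Arm.far_fst hX)) hJ) hyJ g1 h1
    have o1 := ho (X.h - 0) (by linarith)
    rcases hI with ⟨-, rfl⟩ | ⟨h, -⟩
    · linarith [k1 x hx x' hx']
    · exact absurd h hns

/-- In the big rectangle of a quadrant, move first horizontally and then vertically. -/
theorem abs_sub_block_le (D : EdgeBound P σ q S) (hs : s ∈ P.quadrants) {p p' : ℝ × ℝ}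
    (hp : p ∈ farSet s.1 (P.armX s.1) ×ˢ farSet s.2 (P.armY s.2))
    (hp' : p' ∈ farSet s.1 (P.armX s.1) ×ˢ farSet s.2 (P.armY s.2)) :
    |q p - q p'| ≤ 8 * osc σ S ((P.armX s.1).ℓ * (P.armY s.2).ℓ) := by
  have h1 := D.abs_sub_far_le hs hp.1 hp'.1 hp.2
  have h2 : |q (p'.1, p.2) - q (p'.1, p'.2)| ≤
      4 * osc σ S ((P.armY s.2).ℓ * (P.armX s.1).ℓ) :=
    D.swap.abs_sub_far_le (CornerPatch.swap_mem_quadrants hs) hp.2 hp'.2 hp'.1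
  rw [mul_comm (P.armY s.2).ℓ] at h2
  have h3 := abs_sub_le (q (p.1, p.2)) (q (p'.1, p.2)) (q (p'.1, p'.2))
  linarith

end EdgeBound

/-! ### Linking the quadrants -/

/-- A point of the big rectangle of a quadrant: the centre of its cell next to the corner. -/
def blockPoint (P : CornerPatch) (s : Bool × Bool) : ℝ × ℝ :=
  (sgn s.1 * ((P.armX s.1).h + (P.armX s.1).half / 2),
    sgn s.2 * ((P.armY s.2).h + (P.armY s.2).half / 2))

theorem blockPoint_mem_fst (P : CornerPatch) (s : Bool × Bool) : (blockPoint P s).1 ∈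
    refl s.1 (Ioo (P.armX s.1).h ((P.armX s.1).h + (P.armX s.1).half)) := by
  have := (P.armX s.1).half_pos
  exact sgn_mul_mem_refl ⟨by linarith, by linarith⟩

theorem blockPoint_mem_snd (P : CornerPatch) (s : Bool × Bool) : (blockPoint P s).2 ∈
    refl s.2 (Ioo (P.armY s.2).h ((P.armY s.2).h + (P.armY s.2).half)) := by
  have := (P.armY s.2).half_pos
  exact sgn_mul_mem_refl ⟨by linarith, by linarith⟩

theorem blockPoint_mem (P : CornerPatch) (s : Bool × Bool) :
    blockPoint P s ∈ farSet s.1 (P.armX s.1) ×ˢ farSet s.2 (P.armY s.2) :=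
  ⟨Or.inl (blockPoint_mem_fst P s), Or.inl (blockPoint_mem_snd P s)⟩

theorem Arm.exists_near_Icc (A : Arm) {x : ℝ} (hx : x ∈ Icc 0 A.h) :
    ∃ a b, a < b ∧ Ioo a b ∈ A.near ∧ x ∈ Icc a b := by
  have := A.h_pos
  by_cases h : A.nearSplit
  · rcases le_total x (A.h / 2) with h1 | h1
    · exact ⟨0, A.h / 2, by linarith, Or.inr ⟨h, Or.inl rfl⟩, hx.1, h1⟩
    · exact ⟨A.h / 2, A.h, by linarith, Or.inr ⟨h, Or.inr rfl⟩, h1, hx.2⟩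
  · exact ⟨0, A.h, by linarith, Or.inl ⟨h, rfl⟩, hx⟩

/-- The constant in the estimate of the difference of the values in adjacent quadrants. -/
def linkConst (σ : ℝ) : ℝ :=
  6 * √(σ * (16 * σ ^ 2 + 256)) + 48 * √(23328 * (1 + 4 * σ ^ 2) * σ)

theorem osc_sq_div_mul {σ S l : ℝ} (hσ : 0 < σ) (hS : 0 ≤ S) (hl : 0 < l) :
    osc σ S (l ^ 2 / σ) * l = √(23328 * (1 + 4 * σ ^ 2) * σ) * S := by
  unfold osc
  rw [show 23328 * (1 + 4 * σ ^ 2) * S ^ 2 / (l ^ 2 / σ) =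
    23328 * (1 + 4 * σ ^ 2) * σ * (S / l) ^ 2 by field_simp, Real.sqrt_mul (by positivity),
    Real.sqrt_sq (by positivity)]
  field_simp

namespace EdgeBound
variable {P : CornerPatch} {σ : ℝ} {q : ℝ × ℝ → ℝ} {S : ℝ}

/-- The values in two quadrants that share a vertical half-axis differ by at most a multiple of
`S / ℓ`: the strip between their big rectangles consists of the thin cells along this half-axis. -/
theorem abs_blockPoint_sub_le (D : EdgeBound P σ q S) {b : Bool} (ht : (true, b) ∈ P.quadrants)
    (hf : (false, b) ∈ P.quadrants) :
    |q (blockPoint P (false, b)) - q (blockPoint P (true, b))| * (P.armY b).ℓ ≤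
      linkConst σ * S := by
  have hXt := Arm.far_fst (D.divided _ ht).1
  have hXf := Arm.far_fst (D.divided _ hf).1
  have hY := Arm.far_fst (D.divided _ ht).2
  have bt := fun p hp => D.abs_sub_block_le ht (p := p) hp (blockPoint_mem P (true, b))
  have bf := fun p hp => D.abs_sub_block_le hf (p := p) hp (blockPoint_mem P (false, b))
  obtain ⟨rt1, rt2, -, -⟩ := D.regular _ ht
  obtain ⟨rf1, rf2, -, -⟩ := D.regular _ hf
  simp only at hXt hXf hY bt bf rt1 rt2 rf1 rf2
  have hσ : 0 < σ := zero_lt_one.trans_le D.one_le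
  have mt : ∀ I ∈ (P.armX true).near ∪ (P.armX true).far, ∀ J ∈ (P.armY b).far,
    box (true, b) I J ∈ P.edgeCells := fun I hI J hJ => mem_edgeCells ht hI hJ
  have mf : ∀ I ∈ (P.armX false).near ∪ (P.armX false).far, ∀ J ∈ (P.armY b).far,
    box (false, b) I J ∈ P.edgeCells := fun I hI J hJ => mem_edgeCells hf hI hJ
  set X := P.armX true
  set Z := P.armX false
  set Y := P.armY b
  have pX := X.half_pos
  have pZ := Z.half_pos
  have pY := Y.half_pos
  have pXh := X.h_pos
  have pZh := Z.h_pos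
  have pYl := Y.ℓ_pos
  obtain ⟨y₀, y₁, hy, hlen, hJ⟩ := exists_refl_eq b (by linarith : Y.h < Y.h + Y.half)
  rw [add_sub_cancel_left] at hlen
  have eL : box (false, b) (Ioo Z.h (Z.h + Z.half)) (Ioo Y.h (Y.h + Y.half)) =
      Ioo (-(Z.h + Z.half)) (-Z.h) ×ˢ Ioo y₀ y₁ := by
    rw [box_eq]; simp only [hJ, refl_false]
  have eR : box (true, b) (Ioo X.h (X.h + X.half)) (Ioo Y.h (Y.h + Y.half)) =
      Ioo X.h (X.h + X.half) ×ˢ Ioo y₀ y₁ := by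
    rw [box_eq]; simp only [hJ, refl_true]
  have hbound : ∀ l, Y.ℓ ≤ σ * l → osc σ S (l * Y.ℓ) ≤ osc σ S (Y.ℓ ^ 2 / σ) := by
    intro l hl
    refine osc_anti (by positivity) ?_
    rw [div_le_iff₀ hσ]
    nlinarith
  -- the cells next to the corner line, in the row of height `half`
  let T₀ : Set (Set (ℝ × ℝ)) := {K | ∃ I, (I ∈ X.near ∨ I = Ioo X.h (X.h + X.half)) ∧
      K = box (true, b) I (Ioo Y.h (Y.h + Y.half))} ∪
    {K | ∃ I, (I ∈ Z.near ∨ I = Ioo Z.h (Z.h + Z.half)) ∧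
      K = box (false, b) I (Ioo Y.h (Y.h + Y.half))}
  have key := D.bound.abs_sub_le_of_strip P.isMesh_edgeCells D.bilinear D.nonneg
    (w₀ := -(Z.h + Z.half)) (w₁ := -Z.h) (w₂ := X.h) (w₃ := X.h + X.half) (y₀ := y₀) (y₁ := y₁)
    (M := 4 * σ / Y.ℓ) (E := 8 * osc σ S (Y.ℓ ^ 2 / σ)) (cL := q (blockPoint P (false, b)))
    (cR := q (blockPoint P (true, b))) (by linarith) (by linarith) (by linarith) hy
    (eL ▸ mf _ (Or.inr hXf) _ hY) (eR ▸ mt _ (Or.inr hXt) _ hY) (T₀ := T₀) ?_ ?_ ?_ ?_ ?_ ?_ ?_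
  · rw [hlen] at key
    have hN : √(((4 * σ / Y.ℓ) ^ 2 + (4 / Y.half) ^ 2) *
        ((X.h + X.half - -(Z.h + Z.half)) * Y.half)) ≤ √(σ * (16 * σ ^ 2 + 256)) := by
      refine Real.sqrt_le_sqrt ?_
      have a1 : (4 / Y.half) ^ 2 ≤ (16 / Y.ℓ) ^ 2 := by
        refine pow_le_pow_left₀ (by positivity) ?_ 2
        rw [div_le_div_iff₀ pY pYl]
        linarith [Y.ℓ_le_half]
      have a2 : X.h + X.half - -(Z.h + Z.half) ≤ 2 * (σ * Y.ℓ) := by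
        have e1 : X.h + X.half ≤ X.ℓ := by unfold Arm.half; linarith [X.h_lt_ℓ]
        have e2 : Z.h + Z.half ≤ Z.ℓ := by unfold Arm.half; linarith [Z.h_lt_ℓ]
        linarith
      calc _ ≤ ((4 * σ / Y.ℓ) ^ 2 + (16 / Y.ℓ) ^ 2) * (2 * (σ * Y.ℓ) * (Y.ℓ / 2)) := by
            have := Y.half_le
            gcongr
            exact mul_nonneg (by linarith) pY.le
        _ = _ := by field_simp; ring
    have hSN := mul_le_mul_of_nonneg_left hN D.nonneg
    have hO := osc_sq_div_mul hσ D.nonneg pYl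
    have hOn := osc_nonneg σ S (Y.ℓ ^ 2 / σ)
    have h1 := mul_le_mul_of_nonneg_left Y.half_le hOn
    have h2 := mul_le_mul_of_nonneg_left Y.ℓ_le_half
      (abs_nonneg (q (blockPoint P (false, b)) - q (blockPoint P (true, b))))
    unfold linkConst
    linarith
  · rintro K (⟨I, hI | rfl, rfl⟩ | ⟨I, hI | rfl, rfl⟩)
    exacts [mt _ (Or.inl hI) _ hY, mt _ (Or.inr hXt) _ hY, mf _ (Or.inl hI) _ hY,
      mf _ (Or.inr hXf) _ hY]
  · rintro ⟨x, y⟩ ⟨hx, hy'⟩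
    have hyb : sgn b * y ∈ Icc Y.h (Y.h + Y.half) :=
      Ioo_subset_Icc_self (by rw [← hJ] at hy'; exact hy')
    rcases le_total 0 x with h0 | h0
    · rcases le_total x X.h with h1 | h1
      · obtain ⟨a, b', hab, hI, hxI⟩ := X.exists_near_Icc ⟨h0, h1⟩
        exact mem_iUnion₂.2 ⟨_, Or.inl ⟨_, Or.inl hI, rfl⟩,
          mem_closure_box hab (by linarith) (by simpa using hxI) hyb⟩
      · exact mem_iUnion₂.2 ⟨_, Or.inl ⟨_, Or.inr rfl, rfl⟩,
          mem_closure_box (by linarith) (by linarith) (by simpa using ⟨h1, hx.2.le⟩) hyb⟩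
    · rcases le_total (-Z.h) x with h1 | h1
      · obtain ⟨a, b', hab, hI, hxI⟩ := Z.exists_near_Icc (x := -x) ⟨by linarith, by linarith⟩
        exact mem_iUnion₂.2 ⟨_, Or.inr ⟨_, Or.inl hI, rfl⟩,
          mem_closure_box hab (by linarith) (by simpa using hxI) hyb⟩
      · have := hx.1
        simp only at this
        exact mem_iUnion₂.2 ⟨_, Or.inr ⟨_, Or.inr rfl, rfl⟩,
          mem_closure_box (by linarith) (by linarith)
            (by simp only [sgn_false, neg_mul, one_mul]; constructor <;> linarith) hyb⟩
  · rintro K (⟨I, hI | rfl, rfl⟩ | ⟨I, hI | rfl, rfl⟩)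
    · right; right
      obtain ⟨a, b', h1, h2, h3, -, rfl⟩ := Arm.exists_of_near hI
      rw [box_eq]
      simp only [hJ, refl_true]
      exact prod_mono (Ioo_subset_Ioo (by linarith) h3) subset_rfl
    · exact Or.inr (Or.inl eR)
    · right; right
      obtain ⟨a, b', h1, h2, h3, -, rfl⟩ := Arm.exists_of_near hI
      rw [box_eq]
      simp only [hJ, refl_false]
      exact prod_mono (Ioo_subset_Ioo (by linarith) (by linarith)) subset_rfl
    · exact Or.inl eL
  · rw [div_le_div_iff₀ (by linarith) pYl]
    nlinarith [Z.ℓ_le_half]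
  · rw [div_le_div_iff₀ (by linarith) pYl]
    nlinarith [X.ℓ_le_half]
  · intro p hp
    rw [← eL] at hp
    exact (bf p ⟨Or.inl hp.1, Or.inl hp.2⟩).trans
      (mul_le_mul_of_nonneg_left (hbound _ rf2) (by norm_num))
  · intro p hp
    rw [← eR] at hp
    exact (bt p ⟨Or.inl hp.1, Or.inl hp.2⟩).trans
      (mul_le_mul_of_nonneg_left (hbound _ rt2) (by norm_num))

end EdgeBound

theorem linkConst_pos {σ : ℝ} (hσ : 0 < σ) : 0 < linkConst σ := by
  unfold linkConst; positivity

/-- The constant in the estimate of a pressure on the edge patch by the divergence form. -/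
def edgeConst (σ : ℝ) : ℝ :=
  144 * (2 * (256 * (23328 * (1 + 4 * σ ^ 2)) + σ * (2 * σ ^ 3 * linkConst σ) ^ 2))

theorem edgeConst_pos {σ : ℝ} (hσ : 0 < σ) : 0 < edgeConst σ := by
  unfold edgeConst; positivity

/-- Two quadrants are equal, adjacent, or opposite; in the last case a third quadrant of the patch
is adjacent to both. -/
theorem CornerPatch.exists_between (P : CornerPatch) {s u : Bool × Bool}
    (hs : s ∈ P.quadrants) (hu : u ∈ P.quadrants) :
    ∃ w ∈ P.quadrants, (s.1 = w.1 ∨ s.2 = w.2) ∧ (w.1 = u.1 ∨ w.2 = u.2) := by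
  by_cases h : s.1 = u.1 ∨ s.2 = u.2
  · exact ⟨s, hs, Or.inl rfl, h⟩
  · have hop : u = (!s.1, !s.2) := by
      obtain ⟨s1, s2⟩ := s
      obtain ⟨u1, u2⟩ := u
      clear hs hu
      revert h; revert s1 s2 u1 u2; decide
    obtain ⟨w, hw, hne⟩ : ∃ w ∈ P.quadrants, w ≠ s ∧ w ≠ u := by
      by_contra hcon
      push Not at hcon
      refine P.not_opposite s (Finset.Subset.antisymm (fun w hw => ?_) ?_)
      · by_cases hws : w = s
        · simp [hws]
        · simp [← hop, hcon w hw hws]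
      · rw [← hop]
        intro w hw
        rcases Finset.mem_insert.1 hw with rfl | hw
        · exact hs
        · rw [Finset.mem_singleton.1 hw]; exact hu
    refine ⟨w, hw, ?_⟩
    subst hop
    obtain ⟨s1, s2⟩ := s
    obtain ⟨w1, w2⟩ := w
    clear h hs hu hw
    revert hne; revert s1 s2 w1 w2; decide

namespace EdgeBound
variable {P : CornerPatch} {σ : ℝ} {q : ℝ × ℝ → ℝ} {S : ℝ}

theorem pos (D : EdgeBound P σ q S) : 0 < σ := zero_lt_one.trans_le D.one_le

theorem abs_blockPoint_sub_row_le (D : EdgeBound P σ q S) {b b₁ b₂ : Bool}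
    (h1 : (b₁, b) ∈ P.quadrants) (h2 : (b₂, b) ∈ P.quadrants) :
    |q (blockPoint P (b₁, b)) - q (blockPoint P (b₂, b))| * (P.armY b).ℓ ≤ linkConst σ * S := by
  have h0 : 0 ≤ linkConst σ * S := mul_nonneg (linkConst_pos D.pos).le D.nonneg
  cases b₁ <;> cases b₂
  · simpa
  · exact D.abs_blockPoint_sub_le h2 h1
  · rw [abs_sub_comm]; exact D.abs_blockPoint_sub_le h1 h2
  · simpa

theorem abs_blockPoint_sub_adjacent_le (D : EdgeBound P σ q S) {s u : Bool × Bool}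
    (hs : s ∈ P.quadrants) (hu : u ∈ P.quadrants) (h : s.1 = u.1 ∨ s.2 = u.2) :
    |q (blockPoint P s) - q (blockPoint P u)| * (P.armX s.1).ℓ ≤ σ * (linkConst σ * S) := by
  have h0 : 0 ≤ linkConst σ * S := mul_nonneg (linkConst_pos D.pos).le D.nonneg
  obtain ⟨s1, s2⟩ := s
  obtain ⟨u1, u2⟩ := u
  rcases h with h | h <;> simp only at h <;> subst h
  · have h1 : |q (blockPoint P (s1, s2)) - q (blockPoint P (s1, u2))| * (P.armX s1).ℓ ≤
        linkConst σ * S :=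
      D.swap.abs_blockPoint_sub_row_le (b := s1) (b₁ := s2) (b₂ := u2)
        (CornerPatch.swap_mem_quadrants hs) (CornerPatch.swap_mem_quadrants hu)
    exact h1.trans (le_mul_of_one_le_left h0 D.one_le)
  · have h1 := D.abs_blockPoint_sub_row_le hs hu
    have h2 := (D.regular _ hs).1
    simp only at h2
    calc _ ≤ |q (blockPoint P (s1, s2)) - q (blockPoint P (u1, s2))| * (σ * (P.armY s2).ℓ) :=
          mul_le_mul_of_nonneg_left h2 (abs_nonneg _)
      _ = σ * (|q (blockPoint P (s1, s2)) - q (blockPoint P (u1, s2))| * (P.armY s2).ℓ) := by ring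
      _ ≤ _ := mul_le_mul_of_nonneg_left h1 D.pos.le

theorem ℓ_le (D : EdgeBound P σ q S) {s u : Bool × Bool}
    (hs : s ∈ P.quadrants) (hu : u ∈ P.quadrants) (h : s.1 = u.1 ∨ s.2 = u.2) :
    (P.armX s.1).ℓ ≤ σ ^ 2 * (P.armX u.1).ℓ := by
  have hp := (P.armX u.1).ℓ_pos
  have h1 := D.one_le
  rcases h with h | h
  · rw [h]; exact le_mul_of_one_le_left hp.le (one_le_pow₀ h1)
  · have h2 := (D.regular _ hs).1
    have h3 := (D.regular _ hu).2.1
    rw [h] at h2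
    calc _ ≤ σ * (P.armY u.2).ℓ := h2
      _ ≤ σ * (σ * (P.armX u.1).ℓ) := mul_le_mul_of_nonneg_left h3 D.pos.le
      _ = _ := by ring

theorem abs_blockPoint_sub_all_le (D : EdgeBound P σ q S) {s u : Bool × Bool}
    (hs : s ∈ P.quadrants) (hu : u ∈ P.quadrants) :
    |q (blockPoint P s) - q (blockPoint P u)| * (P.armX s.1).ℓ ≤
      2 * σ ^ 3 * linkConst σ * S := by
  obtain ⟨w, hw, h1, h2⟩ := P.exists_between hs hu
  have e1 := D.abs_blockPoint_sub_adjacent_le hs hw h1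
  have e2 := D.abs_blockPoint_sub_adjacent_le hw hu h2
  have e3 := D.ℓ_le hs hw h1
  have h0 : 0 ≤ linkConst σ * S := mul_nonneg (linkConst_pos D.pos).le D.nonneg
  have hσ := D.one_le
  have hσ3 : σ ≤ σ ^ 3 := le_self_pow₀ hσ (by norm_num)
  have hp := (P.armX s.1).ℓ_pos
  set A := |q (blockPoint P s) - q (blockPoint P w)|
  set B := |q (blockPoint P w) - q (blockPoint P u)|
  have hB : 0 ≤ B := abs_nonneg _
  calc _ ≤ (A + B) * (P.armX s.1).ℓ := mul_le_mul_of_nonneg_right (abs_sub_le _ _ _) hp.le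
    _ = A * (P.armX s.1).ℓ + B * (P.armX s.1).ℓ := by ring
    _ ≤ σ * (linkConst σ * S) + B * (σ ^ 2 * (P.armX w.1).ℓ) :=
        add_le_add e1 (mul_le_mul_of_nonneg_left e3 hB)
    _ = σ * (linkConst σ * S) + σ ^ 2 * (B * (P.armX w.1).ℓ) := by ring
    _ ≤ σ ^ 3 * (linkConst σ * S) + σ ^ 2 * (σ * (linkConst σ * S)) :=
        add_le_add (mul_le_mul_of_nonneg_right hσ3 h0)
          (mul_le_mul_of_nonneg_left e2 (sq_nonneg σ))
    _ = _ := by ring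

theorem mem_farSet {A : Arm} (hA : A.farSplit) {b : Bool} {I : Set ℝ} (hI : I ∈ A.far) {x : ℝ}
    (hx : x ∈ refl b I) : x ∈ farSet b A := by
  rcases Arm.far_eq hA hI with rfl | rfl
  · exact Or.inl hx
  · exact Or.inr hx

/-- On a thin vertical cell, `q` is compared with its value in the big rectangle at the same
height. -/
theorem exists_bound_near (D : EdgeBound P σ q S) {s : Bool × Bool} (hs : s ∈ P.quadrants)
    {I J : Set ℝ} (hI : I ∈ (P.armX s.1).near) (hJ : J ∈ (P.armY s.2).far) :
    ∃ w, 0 < w ∧ volume.real (box s I J) ≤ w ∧ w ≤ (P.armX s.1).ℓ * (P.armY s.2).ℓ ∧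
      ∀ p ∈ box s I J, |q p - q (blockPoint P s)| ≤ 16 * osc σ S w := by
  have hXY := D.divided s hs
  have hXh := (P.armX s.1).h_pos
  have hYl := (P.armY s.2).ℓ_pos
  have hle : (P.armX s.1).h * (P.armY s.2).ℓ ≤ (P.armX s.1).ℓ * (P.armY s.2).ℓ :=
    mul_le_mul_of_nonneg_right (P.armX s.1).h_lt_ℓ.le hYl.le
  refine ⟨(P.armX s.1).h * (P.armY s.2).ℓ, by positivity, ?_, hle, fun p hp => ?_⟩
  · obtain ⟨a, b, h1, h2, h3, -, rfl⟩ := Arm.exists_of_near hI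
    obtain ⟨c, d, h4, h5, h6, rfl⟩ := Arm.exists_of_far hJ
    rw [volume_real_box s h2 h5]
    have := (P.armY s.2).h_pos
    exact mul_le_mul (by linarith) (by linarith) (by linarith) (by linarith)
  · have hp2 := mem_farSet hXY.2 hJ hp.2
    have e1 := D.abs_sub_near_le hs hI hp.1 (blockPoint_mem_fst P s) hp2
    have e2 := D.abs_sub_block_le hs (p := ((blockPoint P s).1, p.2))
      ⟨(blockPoint_mem P s).1, hp2⟩ (blockPoint_mem P s)
    have e3 := osc_anti (σ := σ) (S := S) (by positivity) hle
    have e4 := abs_sub_le (q (p.1, p.2)) (q ((blockPoint P s).1, p.2)) (q (blockPoint P s))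
    linarith

theorem exists_bound (D : EdgeBound P σ q S) {s : Bool × Bool} (hs : s ∈ P.quadrants)
    {I J : Set ℝ} (h : (I ∈ (P.armX s.1).far ∧ J ∈ (P.armY s.2).near) ∨
      (I ∈ (P.armX s.1).near ∧ J ∈ (P.armY s.2).far) ∨
      (I ∈ (P.armX s.1).far ∧ J ∈ (P.armY s.2).far)) :
    ∃ w, 0 < w ∧ volume.real (box s I J) ≤ w ∧ w ≤ (P.armX s.1).ℓ * (P.armY s.2).ℓ ∧
      ∀ p ∈ box s I J, |q p - q (blockPoint P s)| ≤ 16 * osc σ S w := by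
  rcases h with ⟨hI, hJ⟩ | ⟨hI, hJ⟩ | ⟨hI, hJ⟩
  · obtain ⟨w, h1, h2, h3, h4⟩ := D.swap.exists_bound_near (CornerPatch.swap_mem_quadrants hs)
      (I := J) (J := I) hJ hI
    refine ⟨w, h1, le_trans (le_of_eq ?_) h2, h3.trans (le_of_eq (mul_comm _ _)), fun p hp =>
      h4 p.swap ⟨hp.2, hp.1⟩⟩
    obtain ⟨a, b, -, hab, -, rfl⟩ := Arm.exists_of_far hI
    obtain ⟨c, d, -, hcd, -, -, rfl⟩ := Arm.exists_of_near hJ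
    rw [volume_real_box _ hab hcd, volume_real_box _ hcd hab, mul_comm]
  · exact D.exists_bound_near hs hI hJ
  · have hXl := (P.armX s.1).ℓ_pos
    have hYl := (P.armY s.2).ℓ_pos
    refine ⟨_, by positivity, ?_, le_rfl, fun p hp => ?_⟩
    · obtain ⟨a, b, h1, h2, h3, rfl⟩ := Arm.exists_of_far hI
      obtain ⟨c, d, h4, h5, h6, rfl⟩ := Arm.exists_of_far hJ
      rw [volume_real_box s h2 h5]
      have := (P.armY s.2).h_pos
      have := (P.armX s.1).h_pos
      exact mul_le_mul (by linarith) (by linarith) (by linarith) (by linarith)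
    · refine (D.abs_sub_block_le hs ⟨mem_farSet (D.divided s hs).1 hI hp.1,
        mem_farSet (D.divided s hs).2 hJ hp.2⟩ (blockPoint_mem P s)).trans ?_
      have := osc_nonneg σ S ((P.armX s.1).ℓ * (P.armY s.2).ℓ)
      linarith

/-- On each cell, `q` differs from a fixed value by a constant whose squared `L²` norm on the cell
is bounded by `S ^ 2`. The factor `144` bounds the number of cells: four quadrants, with six
possible intervals on each of their two half-axes. -/
theorem sq_sub_mul_volume_le (D : EdgeBound P σ q S) {u : Bool × Bool} (hu : u ∈ P.quadrants)
    {K : Set (ℝ × ℝ)} (hK : K ∈ P.edgeCells) : ∀ p ∈ K,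
    144 * ((q p - q (blockPoint P u)) ^ 2 * volume.real K) ≤ edgeConst σ * S ^ 2 := by
  obtain ⟨s, hs, I, J, h, rfl⟩ := hK
  obtain ⟨w, hw, h1, h2, h3⟩ := D.exists_bound hs h
  intro p hp
  have e1 := h3 p hp
  have e2 := D.abs_blockPoint_sub_all_le hs hu
  have hXl := (P.armX s.1).ℓ_pos
  have hσ := D.pos
  set A := q p - q (blockPoint P s)
  set B := q (blockPoint P s) - q (blockPoint P u)
  have hAB : q p - q (blockPoint P u) = A + B := by simp only [A, B]; ring
  have f1 : A ^ 2 * w ≤ 256 * (23328 * (1 + 4 * σ ^ 2) * S ^ 2) := by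
    rw [← osc_sq_mul hw, ← sq_abs]
    calc |A| ^ 2 * w ≤ (16 * osc σ S w) ^ 2 * w :=
          mul_le_mul_of_nonneg_right (pow_le_pow_left₀ (abs_nonneg _) e1 2) hw.le
      _ = _ := by ring
  have f2 : B ^ 2 * w ≤ σ * (2 * σ ^ 3 * linkConst σ) ^ 2 * S ^ 2 := by
    have h4 : w ≤ σ * (P.armX s.1).ℓ ^ 2 := by
      have := mul_le_mul_of_nonneg_left (D.regular s hs).2.1 hXl.le
      calc w ≤ _ := h2
        _ ≤ _ := this
        _ = _ := by ring
    calc B ^ 2 * w ≤ B ^ 2 * (σ * (P.armX s.1).ℓ ^ 2) :=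
          mul_le_mul_of_nonneg_left h4 (sq_nonneg _)
      _ = σ * (|B| * (P.armX s.1).ℓ) ^ 2 := by rw [mul_pow, sq_abs]; ring
      _ ≤ σ * (2 * σ ^ 3 * linkConst σ * S) ^ 2 :=
          mul_le_mul_of_nonneg_left (pow_le_pow_left₀ (by positivity) e2 2) hσ.le
      _ = _ := by ring
  have f3 : (A + B) ^ 2 * volume.real (box s I J) ≤ 2 * (A ^ 2 * w + B ^ 2 * w) := by
    calc (A + B) ^ 2 * volume.real (box s I J) ≤ (A + B) ^ 2 * w :=
          mul_le_mul_of_nonneg_left h1 (sq_nonneg _)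
      _ ≤ (2 * (A ^ 2 + B ^ 2)) * w := by
          refine mul_le_mul_of_nonneg_right ?_ hw.le
          nlinarith [sq_nonneg (A - B)]
      _ = _ := by ring
  rw [hAB]
  unfold edgeConst
  linarith

theorem integral_sq_le (D : EdgeBound P σ q S) (hq : IsPressure P.edgeCells q) :
    ∫ p in domain P.edgeCells, q p ^ 2 ≤ edgeConst σ * S ^ 2 := by
  obtain ⟨u, hu⟩ := P.nonempty
  have hT := P.isMesh_edgeCells
  refine (hq.integral_sq_le hT (q (blockPoint P u))).trans ?_
  rw [hT.integral_domain fun K hK => hT.integrableOn hK ((hq.contExt hK).sub_const _).sq]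
  have hM : 0 ≤ edgeConst σ * S ^ 2 := mul_nonneg (edgeConst_pos D.pos).le (sq_nonneg _)
  have hcell : ∀ K ∈ hT.finite.toFinset, ∫ p in K, (q p - q (blockPoint P u)) ^ 2 ≤
      edgeConst σ * S ^ 2 / 144 := by
    intro K hK
    have hK : K ∈ P.edgeCells := by simpa using hK
    have hpos : 0 < volume.real K := by
      obtain ⟨a, b, c, d, h1, h2, rfl⟩ := hT.rect K hK
      rw [volume_real_rect h1.le h2.le]
      exact mul_pos (sub_pos.2 h1) (sub_pos.2 h2)
    have hfin : volume K < ⊤ :=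
      (measure_mono subset_closure).trans_lt (hT.isCompact_closure hK).measure_lt_top
    calc _ ≤ ‖∫ p in K, (q p - q (blockPoint P u)) ^ 2‖ := Real.le_norm_self _
      _ ≤ edgeConst σ * S ^ 2 / 144 / volume.real K * volume.real K := by
          refine norm_setIntegral_le_of_norm_le_const hfin fun p hp => ?_
          rw [Real.norm_of_nonneg (sq_nonneg _), le_div_iff₀ hpos, le_div_iff₀ (by norm_num)]
          linarith [D.sq_sub_mul_volume_le hu hK p hp]
      _ = _ := by field_simp
  refine (Finset.sum_le_card_nsmul _ _ _ hcell).trans ?_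
  rw [nsmul_eq_mul]
  calc _ ≤ 144 * (edgeConst σ * S ^ 2 / 144) := by
        refine mul_le_mul_of_nonneg_right ?_ (by positivity)
        exact_mod_cast P.card_edgeCells_le
    _ = _ := by ring

end EdgeBound

/-! ### Stability on the edge patch -/

namespace CornerPatch
variable {P : CornerPatch}

theorem ShapeRegular.mono {σ τ : ℝ} (h : P.ShapeRegular σ) (hle : σ ≤ τ) : P.ShapeRegular τ := by
  intro s hs
  obtain ⟨h1, h2, h3, h4⟩ := h s hs
  have k : ∀ {a b : ℝ}, 0 < b → a ≤ σ * b → a ≤ τ * b := fun hb h =>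
    h.trans (mul_le_mul_of_nonneg_right hle hb.le)
  exact ⟨k (Arm.ℓ_pos _) h1, k (Arm.ℓ_pos _) h2, k (Arm.h_pos _) h3, k (Arm.h_pos _) h4⟩

theorem infSupStable_edgeCells {σ : ℝ} (hσ : 1 ≤ σ) (hE : P.EdgeDivided)
    (hR : P.ShapeRegular σ) : InfSupStable P.edgeCells (√(edgeConst σ))⁻¹ := by
  have hpos := edgeConst_pos (zero_lt_one.trans_le hσ)
  refine infSupStable_of P.isMesh_edgeCells (by positivity) fun q hq S hS hv => ?_
  have D : EdgeBound P σ q S :=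
    ⟨hE, hR, hσ, hq.continuousOn, hq.bilinear, divBound_of hv, hS⟩
  rw [inv_mul_le_iff₀ (by positivity)]
  refine le_of_sq_le_sq ?_ (by positivity)
  rw [mul_pow, Real.sq_sqrt hpos.le, l2norm_sq]
  exact D.integral_sq_le hq

end CornerPatch
end TaylorHood
end

theorem theorem3p2 :
    ∃ Φ : ℝ → ℝ → ℝ, (∀ β βc : ℝ, 0 < β → 0 < βc → 0 < Φ β βc) ∧
      (∀ P : TaylorHood.CornerPatch, P.EdgeDivided → ∀ β βc : ℝ, 0 < β → 0 < βc →
        TaylorHood.InfSupStable P.edgeCells β →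
        TaylorHood.InfSupStable P.cornerCells βc →
        TaylorHood.InfSupStable P.cells (Φ β βc)) ∧
      (∀ σ : ℝ, ∃ β : ℝ, 0 < β ∧
        ∀ P : TaylorHood.CornerPatch, P.EdgeDivided → P.ShapeRegular σ →
          TaylorHood.InfSupStable P.edgeCells β ∧
          ∀ βc : ℝ, 0 < βc → TaylorHood.InfSupStable P.cornerCells βc →
            TaylorHood.InfSupStable P.cells (Φ β βc)) := by
  refine ⟨fun β βc => (√(1026 * ((β ^ 2)⁻¹ + (βc ^ 2)⁻¹)))⁻¹, fun β βc h1 h2 => by positivity,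
    fun P hE β βc hβ hβc h hc => TaylorHood.CornerPatch.infSupStable_cells hβ hβc hE h hc,
    fun σ => ?_⟩
  have h1 : 1 ≤ max σ 1 := le_max_right _ _
  have hpos : 0 < (√(TaylorHood.edgeConst (max σ 1)))⁻¹ :=
    inv_pos.2 (Real.sqrt_pos.2 (TaylorHood.edgeConst_pos (zero_lt_one.trans_le h1)))
  refine ⟨_, hpos, fun P hE hR => ?_⟩
  have hβ := TaylorHood.CornerPatch.infSupStable_edgeCells h1 hE (hR.mono (le_max_left _ _))
  exact ⟨hβ, fun βc hβc hc => TaylorHood.CornerPatch.infSupStable_cells hpos hβc hE hβ hc⟩
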